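/- Fix $\phi\in C_0^\infty(\mathbb R)$, real-valued, with $\phi(t)=1$ for $|t|\le \frac12$ and $\phi(t)=0$ for $|t|\ge 1$. Let $n\ge 2$ be an integer, $0<\mu<1$, and let $E,A,B$ be real constants. Let $\lambda>0$, let $S(x,y)$ be a real polynomial of degree at most $n$, and let $K$ be a complex-valued function that is $C^2$ off the diagonal of $\mathbb R^2$ with $$|\partial_y^iK(x,y)|\le E|x-y|^{-\mu-i}\qquad (x\ne y,\ i=0,1,2).$$ For $\psi\in C_0^\infty(\mathbb R^2)$ (complex-valued) with $\operatorname{supp}\psi\subset\mathcal B$, let $D(\mathcal B)$ denote the operator $$D(\mathcal B)f(x)=\int_{\mathbb R}e^{i\lambda S(x,y)}|S''_{xy}(x,y)|^{1/2}K(x,y)\bigl[1-\phi\bigl((x-y)\lambda^{1/n}\bigr)\bigr]\psi(x,y)f(y)\,dy .$$ Let $\mathcal B_j=\{a_j<x<b_j,\ c_j<y<d_j\}$ $(j=1,2)$ be nonempty open boxes, $\rho_j=d_j-c_j$, and put $$\widetilde{\mathcal B_1}=\{a_1-\tfrac1{10}(b_1-a_1)<x<b_1+\tfrac1{10}(b_1-a_1),\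 c_1<y<d_1\},$$ $$\mathcal B_1^*=\{a_1-(b_1-a_1)<x<b_1+(b_1-a_1),\ c_1<y<d_1\}.$$ Let $\operatorname{span}(\mathcal B_1,\mathcal B_2)$ be the union of all segments parallel to the $x$-axis that join a point $(x,y)\in\mathcal B_1$ with a point $(z,y)\in\mathcal B_2$. Let $\psi_1,\psi_2$ be the amplitudes of $D(\mathcal B_1),D(\mathcal B_2)$. Assume that for some $\nu>0$: (A1) $S''_{xy}$ does not change sign in $\operatorname{span}(\mathcal B_1,\mathcal B_2)$, $\ \nu\le|S''_{xy}|\le A\nu$ on $\widetilde{\mathcal B_1}$, and $|S''_{xy}|\le A\nu$ on $\operatorname{span}(\mathcal B_1,\mathcal B_2)$; (A2) $\mathcal B_2\subset\mathcal B_1^*$; (A3) $\sum_{k=0}^{2}\rho_j^k|\partial_y^k\psi_j|\le B$ everywhere, for $j=1,2$. Then $D(\mathcal B_1)$ and $D(\mathcal B_2)$ are bounded operators on $L^2(\mathbb R)$, and $$\|D(\mathcal B_1)D(\mathcal B_2)^*\|_{L^2\to L^2},\ \ \|D(\mathcal B_2)D(\mathcal B_1)^*\|_{L^2\to L^2}\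 \le\ C\,\lambda^{\frac{2\mu}{n}-1}\,\frac{\sup_{\mathcal B_2}|S''_{xy}|^{1/2}}{\sup_{\widetilde{\mathcal B_1}}|S''_{xy}|^{1/2}} .$$ In particular, if the assumptions hold with $\mathcal B_1=\mathcal B_2=\mathcal B$ and $\psi_1=\psi_2=\psi$, then $$\|D(\mathcal B)\|_{L^2\to L^2}\le C\,\lambda^{\frac{\mu}{n}-\frac12}.$$ Here $C$ depends only on $E,A,B,\mu,n$ and on the fixed cut-off $\phi$; it does not depend on $\lambda$, $S$, $K$, $\nu$, the boxes or the amplitudes. -/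

import Mathlib

open MeasureTheory Set
open scoped ContDiff ENNReal

noncomputable section

namespace DampedOsc

/-- The Hilbert space `L²(ℝ)` of complex-valued functions. -/
abbrev L2 : Type := Lp ℂ 2 (volume : Measure ℝ)

/-- The bounded operator `T` on `L²(ℝ)` is the integral operator with kernel `k`, that is
`T f (x) = ∫ k(x,y) f(y) dy` (an absolutely convergent integral) for almost every `x`. -/
def HasKernel (T : L2 →L[ℂ] L2) (k : ℝ → ℝ → ℂ) : Prop :=
  ∀ f : L2, ∀ᵐ x : ℝ, Integrable (fun y => k x y * f y) ∧ T f x = ∫ y, k x y * f y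

/-- A bounded operator is determined by its kernel. -/
theorem HasKernel.unique {T T' : L2 →L[ℂ] L2} {k : ℝ → ℝ → ℂ}
    (h : HasKernel T k) (h' : HasKernel T' k) : T = T' := by
  ext1 f
  apply Lp.ext
  filter_upwards [h f, h' f] with x hx hx'
  rw [hx.2, hx'.2]

/-- The value `S(x,y)` of a real polynomial in two variables. -/
def val (S : MvPolynomial (Fin 2) ℝ) (x y : ℝ) : ℝ :=
  MvPolynomial.eval ![x, y] S

/-- The mixed second derivative `S''_{xy}(x,y)`. -/
def hess (S : MvPolynomial (Fin 2) ℝ) (x y : ℝ) : ℝ :=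
  MvPolynomial.eval ![x, y] (MvPolynomial.pderiv 0 (MvPolynomial.pderiv 1 S))

/-- `φ` is a smooth cut-off function, equal to `1` for `|t| ≤ 1/2` and to `0` for `|t| ≥ 1`. -/
structure IsCutoff (φ : ℝ → ℝ) : Prop where
  smooth : ContDiff ℝ ∞ φ
  eq_one : ∀ t : ℝ, |t| ≤ 1 / 2 → φ t = 1
  eq_zero : ∀ t : ℝ, 1 ≤ |t| → φ t = 0

/-- `K` is `C²` away from the diagonal, with `|∂_y^i K(x,y)| ≤ E |x-y|^{-μ-i}` for `i = 0, 1, 2`. -/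
structure IsSingularKernel (E μ : ℝ) (K : ℝ → ℝ → ℂ) : Prop where
  contDiffOn : ContDiffOn ℝ 2 (fun p : ℝ × ℝ => K p.1 p.2) {p : ℝ × ℝ | p.1 ≠ p.2}
  bound : ∀ i : ℕ, i ≤ 2 → ∀ x y : ℝ, x ≠ y →
    ‖iteratedDeriv i (fun t => K x t) y‖ ≤ E * |x - y| ^ (-μ - (i : ℝ))

/-- The (nonempty) open box `a < x < b`, `c < y < d`. -/
structure Box where
  a : ℝ
  b : ℝ
  c : ℝ
  d : ℝ
  hab : a < b
  hcd : c < d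

namespace Box

/-- The box as a set. -/
def toSet (Q : Box) : Set (ℝ × ℝ) := Ioo Q.a Q.b ×ˢ Ioo Q.c Q.d

/-- The height `ρ = d - c`. -/
def rho (Q : Box) : ℝ := Q.d - Q.c

/-- The box with its `x`-side enlarged by a tenth of its length at both ends. -/
def tilde (Q : Box) : Set (ℝ × ℝ) :=
  Ioo (Q.a - 1 / 10 * (Q.b - Q.a)) (Q.b + 1 / 10 * (Q.b - Q.a)) ×ˢ Ioo Q.c Q.d

/-- The box with its `x`-side enlarged by its full length at both ends. -/
def star (Q : Box) : Set (ℝ × ℝ) :=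
  Ioo (Q.a - (Q.b - Q.a)) (Q.b + (Q.b - Q.a)) ×ˢ Ioo Q.c Q.d

/-- The union of all horizontal segments joining a point of `Q₁` with a point of `Q₂`. -/
def span (Q₁ Q₂ : Box) : Set (ℝ × ℝ) :=
  {p | ∃ x z y : ℝ, (x, y) ∈ Q₁.toSet ∧ (z, y) ∈ Q₂.toSet ∧ p ∈ segment ℝ (x, y) (z, y)}

end Box

/-- `S''_{xy}` does not change sign on the span of the two boxes, `ν ≤ |S''_{xy}| ≤ A ν` on the
enlarged major box, and `|S''_{xy}| ≤ A ν` on the span. -/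
structure HessCond (S : MvPolynomial (Fin 2) ℝ) (A ν : ℝ) (Q₁ Q₂ : Box) : Prop where
  sign : (∀ p ∈ Q₁.span Q₂, 0 ≤ hess S p.1 p.2) ∨ (∀ p ∈ Q₁.span Q₂, hess S p.1 p.2 ≤ 0)
  lower : ∀ p ∈ Q₁.tilde, ν ≤ |hess S p.1 p.2|
  upper : ∀ p ∈ Q₁.tilde, |hess S p.1 p.2| ≤ A * ν
  upper_span : ∀ p ∈ Q₁.span Q₂, |hess S p.1 p.2| ≤ A * ν

/-- `ψ` is smooth and compactly supported in the box `Q`, with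
`∑_{k ≤ 2} ρ^k |∂_y^k ψ| ≤ B` everywhere. -/
structure IsAmplitude (B : ℝ) (Q : Box) (ψ : ℝ → ℝ → ℂ) : Prop where
  smooth : ContDiff ℝ ∞ (fun p : ℝ × ℝ => ψ p.1 p.2)
  compact : HasCompactSupport (fun p : ℝ × ℝ => ψ p.1 p.2)
  supp : tsupport (fun p : ℝ × ℝ => ψ p.1 p.2) ⊆ Q.toSet
  bound : ∀ x y : ℝ,
    ∑ k ∈ Finset.range 3, Q.rho ^ k * ‖iteratedDeriv k (fun t => ψ x t) y‖ ≤ B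

/-- The kernel of the damped operator:
`e^{iλS(x,y)} |S''_{xy}|^{1/2} K(x,y) [1 - φ((x-y) λ^{1/n})] ψ(x,y)`. -/
def dampedKernel (φ : ℝ → ℝ) (n : ℕ) (lam : ℝ) (S : MvPolynomial (Fin 2) ℝ)
    (K ψ : ℝ → ℝ → ℂ) (x y : ℝ) : ℂ :=
  Complex.exp (Complex.I * ((lam * val S x y : ℝ) : ℂ)) * ((√|hess S x y| : ℝ) : ℂ) * K x y *
    ((1 - φ ((x - y) * lam ^ (1 / (n : ℝ))) : ℝ) : ℂ) * ψ x y

/-- `sup_U |S''_{xy}|^{1/2}`. -/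
def supSqrtHess (S : MvPolynomial (Fin 2) ℝ) (U : Set (ℝ × ℝ)) : ℝ :=
  sSup ((fun p : ℝ × ℝ => √|hess S p.1 p.2|) '' U)

end DampedOsc

end

/-! It suffices to bound `D₁ D₂*`: the other product is its adjoint, and ‖D D*‖ = ‖D‖² gives the
single-operator bound. The kernel of `D₁ D₂*` at (x, z) is an oscillatory integral in y with phase
λ(S(x,y) - S(z,y)). Telescoping dilates of φ decomposes both factors into pieces at distance r = 2^j
λ^{-1/n} from the diagonal, where K has size r^{-μ} and varies on the scale r.

For a pair of pieces at distances r, r', all smooth factors live on the scale ℓ = min(r, r', ρ₂),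
and the integrand is supported in length at most 4ℓ. The y-derivative of the phase is λ times the
integral of S''_{xy}(·, y) from z to x. It is comparable to λν|x - z|: a twentieth of the segment,
next to x, lies in the enlarged major box, and the rest contributes with the same sign. Markov's
inequality turns these sizes into derivative bounds. Two integrations by parts, together with the
trivial bound, give (`exists_dyadic_pairing_bound`) C √ν √s r^{-μ} r'^{-μ} ℓ / (1 + (λν|x - z|ℓ)²),
where s = sup |S''_{xy}| over the minor box.

The difficulty is the factor |S''_{xy}(z,y)|^{1/2}, which may vanish, so that its derivatives have
no pointwise bounds. It is however the square root of a polynomial Q in y, and its derivatives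
change sign a bounded number of times. Hence (√Q)' has L¹ norm O(√s), and so has (√Q)'' once
weighted by the distance to the ends of the interval (`exists_sqrt_polynomial_variation`). The
weight is available because the remaining amplitude vanishes at the ends (`norm_mul_le_weight`).

Integrating in x - z removes ℓ and leaves π/(λν). Schur's test and the geometric sums of r^{-μ} over
r = 2^j λ^{-1/n} then give λ^{2μ/n - 1} √s / √ν. -/

noncomputable section

namespace DampedOsc

/-! ### Markov's inequality, and variation controlled by counting sign changes -/

open Polynomial in
/-- Markov's inequality with an unspecified constant. -/
theorem exists_markov (n : ℕ) : ∃ C : ℝ, 1 ≤ C ∧ ∀ p : ℝ[X], p.natDegree ≤ n →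
    ∀ c d M : ℝ, c < d → (∀ y ∈ Ioo c d, |p.eval y| ≤ M) →
    ∀ y ∈ Ioo c d, |p.derivative.eval y| * (d - c) ≤ C * M := by
  -- The interpolation nodes are interior to (0, 1) because the bound is only assumed on an open
  -- interval. After affine rescaling the constant is 1 plus the sum of sup norms of the derivatives
  -- of the Lagrange basis.
  set v : ℕ → ℝ := fun i => (i + 1) / (n + 2) with hv
  set s := Finset.range (n + 1) with hs
  have hinj : InjOn v s := by
    intro i _ j _ h
    have : (n + 2 : ℝ) ≠ 0 := by positivity
    simp only [hv] at h
    field_simp at h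
    exact_mod_cast (add_right_cancel h)
  have hv01 : ∀ i ∈ s, v i ∈ Ioo (0 : ℝ) 1 := by
    intro i hi
    have hi' : (i : ℝ) + 1 < n + 2 := by
      have : i < n + 1 := Finset.mem_range.1 hi
      exact_mod_cast (by omega : i + 1 < n + 2)
    refine ⟨by positivity, ?_⟩
    rw [hv]; simp only; rw [div_lt_one (by positivity)]; exact hi'
  have hb : ∀ i : ℕ, ∃ b : ℝ, 0 ≤ b ∧
      ∀ t ∈ Icc (0 : ℝ) 1, |(Lagrange.basis s v i).derivative.eval t| ≤ b := by
    intro i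
    obtain ⟨b, hb⟩ := isCompact_Icc.exists_bound_of_continuousOn
      (s := Icc (0 : ℝ) 1) (Lagrange.basis s v i).derivative.continuous.continuousOn
    exact ⟨b, (norm_nonneg _).trans (hb 0 (by simp)), hb⟩
  choose b hb0 hb using hb
  refine ⟨1 + ∑ i ∈ s, b i, by linarith [Finset.sum_nonneg fun i (_ : i ∈ s) => hb0 i], ?_⟩
  intro p hp c d M hcd hM y hy
  set L : ℝ[X] := C c + C (d - c) * X with hL
  have hLe : ∀ t, L.eval t = c + (d - c) * t := by intro t; simp [hL]
  set P := p.comp L with hP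
  have hPd : P.degree < s.card := by
    rw [hs, Finset.card_range]
    refine lt_of_le_of_lt degree_le_natDegree ?_
    have h1 : P.natDegree ≤ n := by
      rw [hP, natDegree_comp]
      have : L.natDegree ≤ 1 := by
        rw [hL, add_comm]; exact natDegree_linear_le
      nlinarith
    exact_mod_cast Nat.lt_succ_of_le h1
  have hint := Lagrange.eq_interpolate hinj hPd
  have hM0 : 0 ≤ M := (abs_nonneg _).trans (hM y hy)
  have hd : 0 < d - c := sub_pos.2 hcd
  set t := (y - c) / (d - c) with ht
  have ht01 : t ∈ Icc (0 : ℝ) 1 := by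
    constructor
    · exact div_nonneg (by linarith [hy.1]) hd.le
    · rw [ht, div_le_one hd]; linarith [hy.2]
  have hyt : L.eval t = y := by rw [hLe, ht]; field_simp; ring
  have h1 : P.derivative.eval t = p.derivative.eval y * (d - c) := by
    rw [hP, derivative_comp, eval_mul, eval_comp, hyt, hL]
    simp [mul_comm]
  rw [← abs_of_pos hd, ← abs_mul, ← h1, hint, Lagrange.interpolate_apply, derivative_sum,
    eval_finsetSum]
  refine (Finset.abs_sum_le_sum_abs _ _).trans ?_
  calc _ ≤ ∑ i ∈ s, b i * M := by
        refine Finset.sum_le_sum fun i hi => ?_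
        rw [derivative_C_mul, eval_mul, eval_C, abs_mul, mul_comm]
        refine mul_le_mul (hb i t ht01) ?_ (abs_nonneg _) (hb0 i)
        rw [hP, eval_comp, hLe]
        apply hM
        have := hv01 i hi
        constructor
        · nlinarith [this.1]
        · nlinarith [this.2]
    _ ≤ _ := by rw [← Finset.sum_mul]; nlinarith

theorem integral_abs_eq_of_sign {G g : ℝ → ℝ} {a b M : ℝ} (hab : a ≤ b)
    (hG : ∀ y ∈ Icc a b, HasDerivAt G (g y) y) (hg : ContinuousOn g (Icc a b))
    (hM : ∀ y ∈ Icc a b, |G y| ≤ M)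
    (hs : (∀ y ∈ Icc a b, 0 ≤ g y) ∨ ∀ y ∈ Icc a b, g y ≤ 0) :
    ∫ y in a..b, |g y| ≤ 2 * M := by
  have hi : IntervalIntegrable g volume a b := by
    apply ContinuousOn.intervalIntegrable; rwa [uIcc_of_le hab]
  have hF : ∫ y in a..b, g y = G b - G a :=
    intervalIntegral.integral_eq_sub_of_hasDerivAt (by rwa [uIcc_of_le hab]) hi
  have ha := abs_le.1 (hM a ⟨le_rfl, hab⟩)
  have hb := abs_le.1 (hM b ⟨hab, le_rfl⟩)
  rcases hs with hs | hs
  · have : ∫ y in a..b, |g y| = ∫ y in a..b, g y := by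
      apply intervalIntegral.integral_congr
      intro y hy; rw [uIcc_of_le hab] at hy; exact abs_of_nonneg (hs y hy)
    rw [this, hF]; linarith
  · have : ∫ y in a..b, |g y| = ∫ y in a..b, -g y := by
      apply intervalIntegral.integral_congr
      intro y hy; rw [uIcc_of_le hab] at hy; exact abs_of_nonpos (hs y hy)
    rw [this, intervalIntegral.integral_neg, hF]; linarith

open Polynomial in
/-- If the derivative of `G` changes sign at most as often as a polynomial of degree `m`,
then the variation of `G` is controlled by its size. -/
theorem integral_abs_deriv_le_of_sign_polynomial (m : ℕ) : ∀ (R : ℝ[X]), R.natDegree ≤ m →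
    ∀ (G g w : ℝ → ℝ) (a b M : ℝ), a ≤ b →
    (∀ y ∈ Icc a b, HasDerivAt G (g y) y) → ContinuousOn g (Icc a b) →
    (∀ y ∈ Icc a b, 0 ≤ w y) → (∀ y ∈ Icc a b, g y = R.eval y * w y) →
    (∀ y ∈ Icc a b, |G y| ≤ M) → ∫ y in a..b, |g y| ≤ 2 * M * 2 ^ m := by
  -- Without interior roots `R` keeps one sign, so `G` is monotone and its variation is at most 2M.
  have key : ∀ (R : ℝ[X]) (G g w : ℝ → ℝ) (a b M : ℝ), a ≤ b →
      (∀ y ∈ Icc a b, HasDerivAt G (g y) y) → ContinuousOn g (Icc a b) →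
      (∀ y ∈ Icc a b, 0 ≤ w y) → (∀ y ∈ Icc a b, g y = R.eval y * w y) →
      (∀ y ∈ Icc a b, |G y| ≤ M) → (∀ r ∈ Ioo a b, R.eval r ≠ 0) →
      ∫ y in a..b, |g y| ≤ 2 * M := by
    intro R G g w a b M hab hG hg hw hR hM hr
    refine integral_abs_eq_of_sign hab hG hg hM ?_
    have hpre : (∀ y ∈ Icc a b, 0 ≤ R.eval y) ∨ ∀ y ∈ Icc a b, R.eval y ≤ 0 := by
      rcases hab.eq_or_lt with rfl | hlt
      · rcases le_total 0 (R.eval a) with h | h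
        · left; intro y hy; rw [Icc_self] at hy; rwa [mem_singleton_iff.1 hy]
        · right; intro y hy; rw [Icc_self] at hy; rwa [mem_singleton_iff.1 hy]
      have hcl : closure (Ioo a b) = Icc a b := closure_Ioo hlt.ne
      have hc : Continuous fun y => R.eval y := R.continuous
      have hio : (∀ y ∈ Ioo a b, 0 ≤ R.eval y) ∨ ∀ y ∈ Ioo a b, R.eval y ≤ 0 := by
        by_contra! hcon
        obtain ⟨⟨x, hx, hx0⟩, y, hy, hy0⟩ := hcon
        obtain ⟨z, hz, hz0⟩ := (isPreconnected_Ioo (a := a) (b := b)).intermediate_value hx hy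
          hc.continuousOn (show (0 : ℝ) ∈ Icc _ _ from ⟨hx0.le, hy0.le⟩)
        exact hr z hz hz0
      rcases hio with h | h
      · left; rw [← hcl]; intro y hy
        exact closure_minimal h (isClosed_le continuous_const hc) hy
      · right; rw [← hcl]; intro y hy
        exact closure_minimal h (isClosed_le hc continuous_const) hy
    rcases hpre with h | h
    · left; intro y hy; rw [hR y hy]; exact mul_nonneg (h y hy) (hw y hy)
    · right; intro y hy; rw [hR y hy]; exact mul_nonpos_of_nonpos_of_nonneg (h y hy) (hw y hy)
  have hM0 : ∀ (G : ℝ → ℝ) (a b M : ℝ), a ≤ b → (∀ y ∈ Icc a b, |G y| ≤ M) → 0 ≤ M :=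
    fun G a b M hab hM => (abs_nonneg _).trans (hM a ⟨le_rfl, hab⟩)
  induction m with
  | zero =>
    intro R hR0 G g w a b M hab hG hg hw hR hM
    by_cases h0 : R = 0
    · have : ∫ y in a..b, |g y| = ∫ y in a..b, (0 : ℝ) := by
        apply intervalIntegral.integral_congr
        intro y hy; rw [uIcc_of_le hab] at hy
        simp [hR y hy, h0]
      rw [this]; simp [hM0 G a b M hab hM]
    rw [pow_zero, mul_one]
    refine key R G g w a b M hab hG hg hw hR hM fun r _ hr => h0 ?_
    rw [eq_C_of_natDegree_le_zero hR0] at hr ⊢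
    simpa using hr
  | succ m ih =>
    intro R hRd G g w a b M hab hG hg hw hR hM
    have hM' := hM0 G a b M hab hM
    by_cases hroot : ∃ r ∈ Ioo a b, R.eval r = 0
    · obtain ⟨r, hr, hr0⟩ := hroot
      -- Split at the root: y - r has one sign on each side and moves into the weight `w`, leaving a
      -- quotient of lower degree on both halves. Each degree doubles the bound at most, hence 2^m.
      obtain ⟨R₁, rfl⟩ := dvd_iff_isRoot.2 hr0
      have hd1 : R₁.natDegree ≤ m := by
        by_cases h0 : R₁ = 0
        · simp [h0]
        rw [natDegree_mul (X_sub_C_ne_zero r) h0, natDegree_X_sub_C] at hRd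
        omega
      have hl : Icc a r ⊆ Icc a b := Icc_subset_Icc le_rfl hr.2.le
      have hrr : Icc r b ⊆ Icc a b := Icc_subset_Icc hr.1.le le_rfl
      have h1 := ih (-R₁) (by simpa using hd1) G g (fun y => (r - y) * w y) a r M hr.1.le
        (fun y hy => hG y (hl hy)) (hg.mono hl)
        (fun y hy => mul_nonneg (by linarith [hy.2]) (hw y (hl hy)))
        (fun y hy => by rw [hR y (hl hy)]; simp; ring) (fun y hy => hM y (hl hy))
      have h2 := ih R₁ hd1 G g (fun y => (y - r) * w y) r b M hr.2.le
        (fun y hy => hG y (hrr hy)) (hg.mono hrr)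
        (fun y hy => mul_nonneg (by linarith [hy.1]) (hw y (hrr hy)))
        (fun y hy => by rw [hR y (hrr hy)]; simp; ring) (fun y hy => hM y (hrr hy))
      rw [← intervalIntegral.integral_add_adjacent_intervals (b := r)]
      · rw [pow_succ]; linarith
      · apply ContinuousOn.intervalIntegrable
        rw [uIcc_of_le hr.1.le]; exact (hg.mono hl).abs
      · apply ContinuousOn.intervalIntegrable
        rw [uIcc_of_le hr.2.le]; exact (hg.mono hrr).abs
    · push Not at hroot
      have := key R G g w a b M hab hG hg hw hR hM hroot
      have h2 : (1 : ℝ) ≤ 2 ^ (m + 1) := one_le_pow₀ (by norm_num)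
      nlinarith

/-! ### Calculus of C² bounds at a length scale -/

section C2Bound

variable {𝔸 : Type*} [NormedField 𝔸] [NormedAlgebra ℝ 𝔸]

/-- `u` is twice continuously differentiable on `s` with `|u^{(k)}| ≤ U ℓ^{-k}` for `k ≤ 2`. -/
def C2Bound (s : Set ℝ) (ℓ U : ℝ) (u : ℝ → 𝔸) : Prop :=
  ∃ u₁ u₂ : ℝ → 𝔸, (∀ y ∈ s, HasDerivAt u (u₁ y) y) ∧ (∀ y ∈ s, HasDerivAt u₁ (u₂ y) y) ∧
    ContinuousOn u₂ s ∧ ∀ y ∈ s, ‖u y‖ ≤ U ∧ ‖u₁ y‖ * ℓ ≤ U ∧ ‖u₂ y‖ * ℓ ^ 2 ≤ U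

namespace C2Bound

variable {s t : Set ℝ} {ℓ ℓ' U V : ℝ} {u v : ℝ → 𝔸}

theorem mono_set (h : C2Bound s ℓ U u) (hts : t ⊆ s) : C2Bound t ℓ U u := by
  obtain ⟨u₁, u₂, h1, h2, h3, h4⟩ := h
  exact ⟨u₁, u₂, fun y hy => h1 y (hts hy), fun y hy => h2 y (hts hy), h3.mono hts,
    fun y hy => h4 y (hts hy)⟩

theorem mono (h : C2Bound s ℓ U u) (h0 : 0 ≤ ℓ') (hℓ : ℓ' ≤ ℓ) (hU : U ≤ V) :
    C2Bound s ℓ' V u := by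
  obtain ⟨u₁, u₂, h1, h2, h3, h4⟩ := h
  refine ⟨u₁, u₂, h1, h2, h3, fun y hy => ?_⟩
  obtain ⟨b0, b1, b2⟩ := h4 y hy
  refine ⟨b0.trans hU, le_trans ?_ (b1.trans hU), le_trans ?_ (b2.trans hU)⟩ <;> gcongr

/-- The coefficients 1, 2, 1 of the second-order Leibniz rule add up to the factor 4. -/
theorem mul (hu : C2Bound s ℓ U u) (hv : C2Bound s ℓ V v) (h0 : 0 ≤ ℓ) :
    C2Bound s ℓ (4 * U * V) (fun y => u y * v y) := by
  obtain ⟨u₁, u₂, h1, h2, h3, h4⟩ := hu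
  obtain ⟨v₁, v₂, k1, k2, k3, k4⟩ := hv
  have hc {w w' : ℝ → 𝔸} (h : ∀ y ∈ s, HasDerivAt w (w' y) y) : ContinuousOn w s :=
    fun y hy => (h y hy).continuousAt.continuousWithinAt
  refine ⟨fun y => u₁ y * v y + u y * v₁ y,
    fun y => (u₂ y * v y + u₁ y * v₁ y) + (u₁ y * v₁ y + u y * v₂ y),
    fun y hy => (h1 y hy).mul (k1 y hy),
    fun y hy => ((h2 y hy).mul (k1 y hy)).add ((h1 y hy).mul (k2 y hy)),
    ((h3.mul (hc k1)).add ((hc h2).mul (hc k2))).add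
      (((hc h2).mul (hc k2)).add ((hc h1).mul k3)), fun y hy => ?_⟩
  obtain ⟨a0, a1, a2⟩ := h4 y hy
  obtain ⟨b0, b1, b2⟩ := k4 y hy
  have hU : 0 ≤ U := (norm_nonneg _).trans a0
  have hV : 0 ≤ V := (norm_nonneg _).trans b0
  have hUV := mul_nonneg hU hV
  refine ⟨?_, ?_, ?_⟩
  · rw [norm_mul]
    have := mul_le_mul a0 b0 (norm_nonneg _) hU
    linarith
  · have t1 := norm_add_le (u₁ y * v y) (u y * v₁ y)
    rw [norm_mul, norm_mul] at t1
    have t2 := mul_le_mul_of_nonneg_right t1 h0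
    have e1 := mul_le_mul a1 b0 (norm_nonneg _) hU
    have e2 := mul_le_mul a0 b1 (by positivity) hU
    nlinarith
  · have t1 := norm_add₃_le (a := u₂ y * v y + u₁ y * v₁ y) (b := u₁ y * v₁ y) (c := u y * v₂ y)
    have t0 := norm_add_le (u₂ y * v y) (u₁ y * v₁ y)
    simp only [← add_assoc]
    simp only [norm_mul] at t0 t1
    have t2 := mul_le_mul_of_nonneg_right (t1.trans (by gcongr)) (sq_nonneg ℓ)
    have e1 := mul_le_mul a2 b0 (norm_nonneg _) hU
    have e2 := mul_le_mul a1 b1 (by positivity) hU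
    have e3 := mul_le_mul a0 b2 (by positivity) hU
    nlinarith

theorem congr (h : C2Bound s ℓ U u) (hs : IsOpen s) (huv : EqOn v u s) : C2Bound s ℓ U v := by
  obtain ⟨u₁, u₂, h1, h2, h3, h4⟩ := h
  refine ⟨u₁, u₂, fun y hy => ?_, h2, h3, fun y hy => ?_⟩
  · exact (h1 y hy).congr_of_eventuallyEq (huv.eventuallyEq_of_mem (hs.mem_nhds hy))
  · rw [huv hy]; exact h4 y hy

theorem ofReal {p : ℝ → ℝ} (h : C2Bound s ℓ U p) : C2Bound s ℓ U (fun y => (p y : ℂ)) := by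
  obtain ⟨u₁, u₂, h1, h2, h3, h4⟩ := h
  refine ⟨fun y => (u₁ y : ℂ), fun y => (u₂ y : ℂ), fun y hy => (h1 y hy).ofReal_comp,
    fun y hy => (h2 y hy).ofReal_comp, Complex.continuous_ofReal.comp_continuousOn h3,
    fun y hy => ?_⟩
  simpa only [Complex.norm_real] using h4 y hy

theorem conj {p : ℝ → ℂ} (h : C2Bound s ℓ U p) :
    C2Bound s ℓ U (fun y => (starRingEnd ℂ) (p y)) := by
  obtain ⟨u₁, u₂, h1, h2, h3, h4⟩ := h
  refine ⟨fun y => (starRingEnd ℂ) (u₁ y), fun y => (starRingEnd ℂ) (u₂ y),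
    fun y hy => (h1 y hy).star, fun y hy => (h2 y hy).star,
    Complex.continuous_conj.comp_continuousOn h3, fun y hy => ?_⟩
  simpa only [RCLike.norm_conj] using h4 y hy

/-- The worst term is (1/p)'' = -p''/p² + 2p'²/p³, which costs A + 2A² ≤ 3A². -/
theorem inv {p : ℝ → ℝ} {A m : ℝ} (h : C2Bound s ℓ (A * m) p) (hA : 1 ≤ A) (hm : 0 < m)
    (hℓ : 0 ≤ ℓ) (hp : ∀ y ∈ s, m ≤ |p y|) : C2Bound s ℓ (3 * A ^ 2 / m) (fun y => (p y)⁻¹) := by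
  obtain ⟨u₁, u₂, h1, h2, h3, h4⟩ := h
  have hp0 : ∀ y ∈ s, p y ≠ 0 := fun y hy => abs_pos.1 (hm.trans_le (hp y hy))
  have hc {w w' : ℝ → ℝ} (h : ∀ y ∈ s, HasDerivAt w (w' y) y) : ContinuousOn w s :=
    fun y hy => (h y hy).continuousAt.continuousWithinAt
  refine ⟨fun y => - u₁ y / p y ^ 2, fun y => - u₂ y / p y ^ 2 + 2 * u₁ y ^ 2 / p y ^ 3,
    fun y hy => (h1 y hy).inv (hp0 y hy), fun y hy => ?_, ?_, fun y hy => ?_⟩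
  · refine ((h2 y hy).neg.div ((h1 y hy).pow 2) (pow_ne_zero 2 (hp0 y hy))).congr_deriv ?_
    have := hp0 y hy
    simp only [Pi.neg_apply, Pi.pow_apply]
    field_simp
    ring
  · refine (h3.neg.div ((hc h1).pow 2) fun y hy => pow_ne_zero 2 (hp0 y hy)).add
      ((((hc h2).pow 2).const_mul 2).div ((hc h1).pow 3) fun y hy => pow_ne_zero 3 (hp0 y hy))
  · obtain ⟨a0, a1, a2⟩ := h4 y hy
    have hpy := hp y hy
    have hinv : |p y|⁻¹ ≤ m⁻¹ := inv_anti₀ hm hpy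
    have hi0 : 0 ≤ |p y|⁻¹ := by positivity
    have e0 : 3 * A ^ 2 / m = 3 * A ^ 2 * m⁻¹ := div_eq_mul_inv _ _
    have hm1 : m * m⁻¹ = 1 := mul_inv_cancel₀ hm.ne'
    have hm0 : 0 < m⁻¹ := by positivity
    have hA2 : A ≤ A ^ 2 := by nlinarith
    have hi2 : |p y|⁻¹ ^ 2 ≤ m⁻¹ ^ 2 := by gcongr
    have hi3 : |p y|⁻¹ ^ 3 ≤ m⁻¹ ^ 3 := by gcongr
    have n1 : 0 ≤ A * m := by positivity
    simp only [Real.norm_eq_abs] at a1 a2 ⊢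
    have b1 : |u₁ y| * |p y|⁻¹ ^ 2 * ℓ ≤ A * m⁻¹ := by
      calc |u₁ y| * |p y|⁻¹ ^ 2 * ℓ = (|u₁ y| * ℓ) * |p y|⁻¹ ^ 2 := by ring
        _ ≤ (A * m) * m⁻¹ ^ 2 := by gcongr
        _ = A * m⁻¹ * (m * m⁻¹) := by ring
        _ = _ := by rw [hm1, mul_one]
    have b2 : |u₂ y| * |p y|⁻¹ ^ 2 * ℓ ^ 2 ≤ A * m⁻¹ := by
      calc |u₂ y| * |p y|⁻¹ ^ 2 * ℓ ^ 2 = (|u₂ y| * ℓ ^ 2) * |p y|⁻¹ ^ 2 := by ring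
        _ ≤ (A * m) * m⁻¹ ^ 2 := by gcongr
        _ = A * m⁻¹ * (m * m⁻¹) := by ring
        _ = _ := by rw [hm1, mul_one]
    have b3 : 2 * |u₁ y| ^ 2 * |p y|⁻¹ ^ 3 * ℓ ^ 2 ≤ 2 * A ^ 2 * m⁻¹ := by
      calc 2 * |u₁ y| ^ 2 * |p y|⁻¹ ^ 3 * ℓ ^ 2 = 2 * (|u₁ y| * ℓ) ^ 2 * |p y|⁻¹ ^ 3 := by ring
        _ ≤ 2 * (A * m) ^ 2 * m⁻¹ ^ 3 := by gcongr
        _ = 2 * A ^ 2 * m⁻¹ * (m * m⁻¹) ^ 2 := by ring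
        _ = _ := by rw [hm1]; ring
    refine ⟨?_, ?_, ?_⟩
    · rw [abs_inv, e0]; nlinarith
    · rw [abs_div, abs_neg, abs_pow, div_eq_mul_inv, ← inv_pow, e0]; nlinarith
    · have := abs_add_le (- u₂ y / p y ^ 2) (2 * u₁ y ^ 2 / p y ^ 3)
      rw [abs_div, abs_neg, abs_div, abs_mul, abs_pow, abs_pow, abs_pow, abs_two,
        div_eq_mul_inv |u₂ y|, div_eq_mul_inv (2 * |u₁ y| ^ 2), ← inv_pow, ← inv_pow] at this
      have hAm := mul_le_mul_of_nonneg_right hA2 hm0.le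
      have := mul_le_mul_of_nonneg_right this (sq_nonneg ℓ)
      rw [e0]; nlinarith

/-- The lower bound `m` keeps `p` away from the singularity of the root; (√p)'' = p''/(2√p) -
p'²/(4p^{3/2}) costs A/2 + A²/4 ≤ A². -/
theorem sqrt {p : ℝ → ℝ} {A m : ℝ} (h : C2Bound s ℓ (A * m) p) (hA : 1 ≤ A) (hm : 0 < m)
    (hℓ : 0 ≤ ℓ) (hp : ∀ y ∈ s, m ≤ p y) : C2Bound s ℓ (A ^ 2 * √m) (fun y => √(p y)) := by
  obtain ⟨u₁, u₂, h1, h2, h3, h4⟩ := h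
  have hp0 : ∀ y ∈ s, 0 < p y := fun y hy => hm.trans_le (hp y hy)
  have hc {w w' : ℝ → ℝ} (h : ∀ y ∈ s, HasDerivAt w (w' y) y) : ContinuousOn w s :=
    fun y hy => (h y hy).continuousAt.continuousWithinAt
  have hd : ∀ y ∈ s, HasDerivAt (fun y => √(p y)) (u₁ y / (2 * √(p y))) y :=
    fun y hy => (h1 y hy).sqrt (hp0 y hy).ne'
  refine ⟨fun y => u₁ y / (2 * √(p y)),
    fun y => u₂ y / (2 * √(p y)) - u₁ y ^ 2 / (4 * √(p y) ^ 3),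
    hd, fun y hy => ?_, ?_, fun y hy => ?_⟩
  · have h0 : √(p y) ≠ 0 := (Real.sqrt_pos.2 (hp0 y hy)).ne'
    refine ((h2 y hy).div ((hd y hy).const_mul 2) (by positivity)).congr_deriv ?_
    field_simp
    ring
  · have h0 : ∀ y ∈ s, √(p y) ≠ 0 := fun y hy => (Real.sqrt_pos.2 (hp0 y hy)).ne'
    refine (h3.div ((hc hd).const_mul 2) fun y hy => ?_).sub
      (((hc h2).pow 2).div (((hc hd).pow 3).const_mul 4) fun y hy => ?_) <;>
    have := h0 y hy <;> positivity
  · obtain ⟨a0, a1, a2⟩ := h4 y hy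
    have hr : √m ≤ √(p y) := Real.sqrt_le_sqrt (hp y hy)
    have hm0 : 0 < √m := Real.sqrt_pos.2 hm
    have hq0 : 0 < √(p y) := hm0.trans_le hr
    have hmm : √m ^ 2 = m := Real.sq_sqrt hm.le
    have hqq : √(p y) ^ 2 = p y := Real.sq_sqrt (hp0 y hy).le
    have hA2 : A ≤ A ^ 2 := by nlinarith
    simp only [Real.norm_eq_abs] at a0 a1 a2 ⊢
    rw [abs_of_pos (hp0 y hy)] at a0
    have b1 : |u₁ y| * ℓ / (2 * √(p y)) ≤ A / 2 * √m := by
      rw [div_le_iff₀ (by positivity)]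
      calc _ ≤ A * m := a1
        _ = A * √m * √m := by rw [mul_assoc, ← sq, hmm]
        _ ≤ A * √m * √(p y) := by gcongr
        _ = _ := by ring
    have b2 : |u₂ y| * ℓ ^ 2 / (2 * √(p y)) ≤ A / 2 * √m := by
      rw [div_le_iff₀ (by positivity)]
      calc _ ≤ A * m := a2
        _ = A * √m * √m := by rw [mul_assoc, ← sq, hmm]
        _ ≤ A * √m * √(p y) := by gcongr
        _ = _ := by ring
    have b3 : |u₁ y| ^ 2 * ℓ ^ 2 / (4 * √(p y) ^ 3) ≤ A ^ 2 / 4 * √m := by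
      rw [div_le_iff₀ (by positivity)]
      calc |u₁ y| ^ 2 * ℓ ^ 2 = (|u₁ y| * ℓ) ^ 2 := by ring
        _ ≤ (A * m) ^ 2 := by gcongr
        _ = A ^ 2 * √m * √m ^ 3 := by
          rw [mul_pow, ← hmm]; simp only [Real.sqrt_sq hm0.le]; ring
        _ ≤ A ^ 2 * √m * √(p y) ^ 3 := by gcongr
        _ = _ := by ring
    have hAm : A * √m ≤ A ^ 2 * √m := by gcongr
    have hAm0 : 0 < A ^ 2 * √m := by positivity
    refine ⟨?_, ?_, ?_⟩
    · rw [abs_of_pos hq0, Real.sqrt_le_left (by positivity), mul_pow, hmm]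
      refine a0.trans ?_
      gcongr
      nlinarith
    · rw [abs_div, abs_of_pos (show 0 < 2 * √(p y) by positivity), div_mul_eq_mul_div]
      linarith
    · have := abs_sub (u₂ y / (2 * √(p y))) (u₁ y ^ 2 / (4 * √(p y) ^ 3))
      rw [abs_div, abs_div, abs_of_pos (show 0 < 2 * √(p y) by positivity),
        abs_of_pos (show 0 < 4 * √(p y) ^ 3 by positivity), abs_pow] at this
      have := mul_le_mul_of_nonneg_right this (sq_nonneg ℓ)
      rw [add_mul, div_mul_eq_mul_div, div_mul_eq_mul_div] at this
      linarith

end C2Bound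

end C2Bound

/-! ### Derivatives of polynomials and of their square roots -/

open Polynomial in
theorem exists_polynomial_C2Bound (n : ℕ) : ∃ C : ℝ, 1 ≤ C ∧ ∀ p : ℝ[X], p.natDegree ≤ n →
    ∀ c d M : ℝ, c < d → (∀ y ∈ Ioo c d, |p.eval y| ≤ M) →
    (∀ y ∈ Ioo c d, |p.derivative.eval y| * (d - c) ≤ C * M) ∧
    (∀ y ∈ Ioo c d, |p.derivative.derivative.eval y| * (d - c) ^ 2 ≤ C * M) ∧
    C2Bound (Ioo c d) (d - c) (C * M) (fun y => p.eval y) := by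
  obtain ⟨C, hC, h⟩ := exists_markov n
  have hC2 : C ≤ C ^ 2 := by nlinarith
  refine ⟨C ^ 2, by nlinarith, fun p hp c d M hcd hM => ?_⟩
  have hd : 0 < d - c := sub_pos.2 hcd
  have h1 := h p hp c d M hcd hM
  -- Markov's inequality a second time, for p' with its new bound CM/(d - c); this is why the
  -- constant is squared.
  have h2 := h p.derivative ((natDegree_derivative_le p).trans (by omega)) c d (C * M / (d - c))
    hcd fun y hy => by rw [le_div_iff₀ hd]; exact h1 y hy
  have hM0 : 0 ≤ M := (abs_nonneg _).trans (hM ((c + d) / 2) ⟨by linarith, by linarith⟩)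
  have k1 : ∀ y ∈ Ioo c d, |p.derivative.eval y| * (d - c) ≤ C ^ 2 * M :=
    fun y hy => (h1 y hy).trans (by gcongr)
  have k2 : ∀ y ∈ Ioo c d, |p.derivative.derivative.eval y| * (d - c) ^ 2 ≤ C ^ 2 * M := by
    intro y hy
    have := h2 y hy
    rw [← mul_div_assoc, le_div_iff₀ hd] at this
    nlinarith
  refine ⟨k1, k2, fun y => p.derivative.eval y, fun y => p.derivative.derivative.eval y,
    fun y _ => p.hasDerivAt y, fun y _ => p.derivative.hasDerivAt y,
    p.derivative.derivative.continuous.continuousOn, fun y hy => ⟨?_, k1 y hy, k2 y hy⟩⟩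
  refine (hM y hy).trans ?_
  nlinarith

/-- A positive function bounded by `s` whose second derivative is at most `D s (d - c)⁻²`
has `|q'| ≲ √(q s)` up to the distance to the boundary. -/
theorem weight_mul_abs_deriv_le {q q₁ q₂ : ℝ → ℝ} {c d s D : ℝ} (hcd : c < d) (hD : 0 ≤ D)
    (h1 : ∀ y ∈ Ioo c d, HasDerivAt q (q₁ y) y) (h2 : ∀ y ∈ Ioo c d, HasDerivAt q₁ (q₂ y) y)
    (hb : ∀ y ∈ Ioo c d, |q₂ y| * (d - c) ^ 2 ≤ D * s)
    (hq : ∀ y ∈ Ioo c d, 0 < q y ∧ q y ≤ s) {y : ℝ} (hy : y ∈ Ioo c d) :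
    (y - c) * (d - y) / (d - c) * |q₁ y| ≤ (1 + D) * (√(q y) * √s) := by
  have hd : 0 < d - c := sub_pos.2 hcd
  obtain ⟨hq0, hqs⟩ := hq y hy
  have hs : 0 < s := hq0.trans_le hqs
  have hyc : 0 < y - c := sub_pos.2 hy.1
  have hyd : 0 < d - y := sub_pos.2 hy.2
  set κ := (y - c) * (d - y) / (d - c) with hκ
  have hκ0 : 0 < κ := by positivity
  have hκ1 : κ < y - c := by rw [hκ, div_lt_iff₀ hd]; nlinarith
  have hκ2 : κ < d - y := by rw [hκ, div_lt_iff₀ hd]; nlinarith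
  -- The step h = κ√(q/s) is chosen to balance. Positivity of q at y ± h and Taylor's formula give
  -- h|q'| ≤ q + D s (d - c)⁻² h², and for this h the last term is at most D q. As h ≤ κ, both
  -- points y ± h stay in (c, d).
  set r := √(q y) / √s with hr
  have hsq : 0 < √s := Real.sqrt_pos.2 hs
  have hqq : 0 < √(q y) := Real.sqrt_pos.2 hq0
  have hr0 : 0 < r := by positivity
  have hr1 : r ≤ 1 := by rw [hr, div_le_one hsq]; exact Real.sqrt_le_sqrt hqs
  have hr2 : r ^ 2 * s = q y := by
    rw [hr, div_pow, Real.sq_sqrt hq0.le, Real.sq_sqrt hs.le]; field_simp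
  set h := κ * r with hh
  have hh0 : 0 < h := by positivity
  have hhκ : h ≤ κ := by nlinarith
  set D' := D * s / (d - c) ^ 2 with hD'
  have hb' : ∀ z ∈ Ioo c d, ‖q₂ z‖ ≤ D' := fun z hz => by
    rw [hD', le_div_iff₀ (by positivity)]; exact hb z hz
  have hD0 : 0 ≤ D' := by positivity
  have hlip : ∀ z ∈ Ioo c d, |q₁ z - q₁ y| ≤ D' * |z - y| := fun z hz =>
    (convex_Ioo c d).norm_image_sub_le_of_norm_hasDerivWithin_le
      (fun w hw => (h2 w hw).hasDerivWithinAt) hb' hy hz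
  have htay : ∀ z ∈ Ioo c d, |z - y| = h → |q z - q y - q₁ y * (z - y)| ≤ D' * h * h := by
    intro z hz hzy
    have hsub : uIcc y z ⊆ Ioo c d := (convex_Ioo c d).ordConnected.uIcc_subset hy hz
    have := (convex_uIcc y z).norm_image_sub_le_of_norm_hasDerivWithin_le
      (f := fun w => q w - q₁ y * (w - y)) (f' := fun w => q₁ w - q₁ y) (C := D' * h)
      (fun w hw => by
        have := ((h1 w (hsub hw)).sub (((hasDerivAt_id w).sub_const y).const_mul (q₁ y)))
        exact (this.congr_deriv (by simp)).hasDerivWithinAt)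
      (fun w hw => (hlip w (hsub hw)).trans (by
        gcongr; rw [← hzy]; exact abs_sub_left_of_mem_uIcc hw))
      left_mem_uIcc right_mem_uIcc
    rw [Real.norm_eq_abs, Real.norm_eq_abs, hzy] at this
    simp only [sub_self, mul_zero, sub_zero] at this
    rwa [sub_right_comm] at this
  have hz1 : y + h ∈ Ioo c d := ⟨by linarith, by linarith⟩
  have hz2 : y - h ∈ Ioo c d := ⟨by linarith, by linarith⟩
  have t1 := abs_le.1 (htay _ hz1 (by simp [abs_of_pos hh0]))
  have t2 := abs_le.1 (htay _ hz2 (by simp [abs_of_pos hh0]))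
  have p1 := (hq _ hz1).1
  have p2 := (hq _ hz2).1
  have hmain : h * |q₁ y| ≤ q y + D' * h * h := by
    rcases abs_cases (q₁ y) with ⟨e, _⟩ | ⟨e, _⟩ <;> rw [e] <;> nlinarith
  have hDh : D' * h * h ≤ D * q y := by
    have hκd : κ ^ 2 ≤ (d - c) ^ 2 := by gcongr; linarith
    have : D' * h * h = D * q y * (κ ^ 2 / (d - c) ^ 2) := by
      rw [hD', hh, ← hr2]; field_simp
    rw [this]
    have h1 : κ ^ 2 / (d - c) ^ 2 ≤ 1 := by rw [div_le_one (by positivity)]; exact hκd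
    have : 0 ≤ D * q y := by positivity
    nlinarith
  have e1 : h * |q₁ y| * √s = κ * |q₁ y| * √(q y) := by rw [hh, hr]; field_simp
  have e2 : κ * |q₁ y| * √(q y) ≤ (1 + D) * (√(q y) * √s) * √(q y) := by
    rw [← e1]
    calc h * |q₁ y| * √s ≤ ((1 + D) * q y) * √s :=
          mul_le_mul_of_nonneg_right (by linarith) hsq.le
      _ = (1 + D) * (√(q y) ^ 2) * √s := by rw [Real.sq_sqrt hq0.le]
      _ = _ := by ring
  exact le_of_mul_le_mul_right e2 hqq

open Polynomial in
/-- The square root of a positive polynomial has bounded variation, and so has its derivative when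
weighted by the distance to the boundary. -/
theorem exists_sqrt_polynomial_variation (n : ℕ) : ∃ C : ℝ, 1 ≤ C ∧ ∀ Q : ℝ[X], Q.natDegree ≤ n →
    ∀ c d s α β : ℝ, (∀ y ∈ Ioo c d, 0 < Q.eval y ∧ Q.eval y ≤ s) →
    c < α → α ≤ β → β < d → ∃ f₁ f₂ : ℝ → ℝ,
      (∀ y ∈ Icc α β, HasDerivAt (fun t => √(Q.eval t)) (f₁ y) y) ∧
      (∀ y ∈ Icc α β, HasDerivAt f₁ (f₂ y) y) ∧ ContinuousOn f₂ (Icc α β) ∧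
      ∫ y in α..β, |f₁ y| ≤ C * √s ∧
      ∫ y in α..β, (y - c) * (d - y) / (d - c) * |f₂ y| ≤ C * √s := by
  obtain ⟨C, hC, h⟩ := exists_polynomial_C2Bound n
  refine ⟨2 * 2 ^ n + 2 * ((1 + C) + 2 * 2 ^ n) * 2 ^ (2 * n), ?_, ?_⟩
  · have h1 : (1 : ℝ) ≤ 2 ^ n := one_le_pow₀ (by norm_num)
    have h2 : (0 : ℝ) ≤ 2 * ((1 + C) + 2 * 2 ^ n) * 2 ^ (2 * n) := by positivity
    linarith
  intro Q hQ c d s α β hq hcα hαβ hβd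
  have hcd : c < d := by linarith
  have hd : 0 < d - c := sub_pos.2 hcd
  have hsub : Icc α β ⊆ Ioo c d := fun y hy => ⟨by linarith [hy.1], by linarith [hy.2]⟩
  have hs : 0 < s := (hq α (hsub ⟨le_rfl, hαβ⟩)).1.trans_le (hq α (hsub ⟨le_rfl, hαβ⟩)).2
  obtain ⟨-, hQ2, -⟩ := h Q hQ c d s hcd fun y hy => by
    rw [abs_of_pos (hq y hy).1]; exact (hq y hy).2
  set f : ℝ → ℝ := fun t => √(Q.eval t) with hf
  set f₁ : ℝ → ℝ := fun y => Q.derivative.eval y / (2 * √(Q.eval y)) with hf₁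
  -- The sign of (√Q)'' is that of 2QQ'' - Q'², a polynomial of degree at most 2n, so the sign count
  -- applies to it as well.
  set f₂ : ℝ → ℝ := fun y => (2 * Q * Q.derivative.derivative - Q.derivative ^ 2).eval y *
    (4 * √(Q.eval y) ^ 3)⁻¹ with hf₂
  have hr0 : ∀ y ∈ Ioo c d, 0 < √(Q.eval y) := fun y hy => Real.sqrt_pos.2 (hq y hy).1
  have d1 : ∀ y ∈ Ioo c d, HasDerivAt f (f₁ y) y :=
    fun y hy => (Q.hasDerivAt y).sqrt (hq y hy).1.ne'
  have d2 : ∀ y ∈ Ioo c d, HasDerivAt f₁ (f₂ y) y := by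
    intro y hy
    have h0 := hr0 y hy
    refine ((Q.derivative.hasDerivAt y).div ((d1 y hy).const_mul 2)
      (by positivity)).congr_deriv ?_
    have hsq : Q.eval y = √(Q.eval y) ^ 2 := (Real.sq_sqrt (hq y hy).1.le).symm
    simp only [hf₁, hf₂, hf, eval_sub, eval_mul, eval_pow, eval_ofNat]
    set r := √(Q.eval y)
    rw [hsq]
    field_simp
    ring
  have cf₁ : ContinuousOn f₁ (Ioo c d) :=
    fun y hy => (d2 y hy).continuousAt.continuousWithinAt
  have cf : ContinuousOn f (Ioo c d) :=
    fun y hy => (d1 y hy).continuousAt.continuousWithinAt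
  have cf₂ : ContinuousOn f₂ (Ioo c d) := by
    refine (Polynomial.continuous _).continuousOn.mul (((cf.pow 3).const_mul 4).inv₀ ?_)
    intro y hy
    have := hr0 y hy
    change 4 * √(Q.eval y) ^ 3 ≠ 0
    positivity
  have bf : ∀ y ∈ Icc α β, |f y| ≤ √s := fun y hy => by
    rw [abs_of_pos (hr0 y (hsub hy))]; exact Real.sqrt_le_sqrt (hq y (hsub hy)).2
  have var1 : ∀ z ∈ Icc α β, ∫ y in α..z, |f₁ y| ≤ 2 * √s * 2 ^ n := by
    intro z hz
    have hz' : Icc α z ⊆ Icc α β := Icc_subset_Icc le_rfl hz.2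
    refine integral_abs_deriv_le_of_sign_polynomial n Q.derivative
      ((natDegree_derivative_le Q).trans (by omega)) f f₁ (fun y => (2 * √(Q.eval y))⁻¹) α z √s
      hz.1 (fun y hy => d1 y (hsub (hz' hy))) (cf₁.mono (hz'.trans hsub))
      (fun y hy => by positivity) (fun y hy => div_eq_mul_inv _ _) (fun y hy => bf y (hz' hy))
  set κ : ℝ → ℝ := fun y => (y - c) * (d - y) / (d - c) with hκ
  set κ₁ : ℝ → ℝ := fun y => ((d - y) - (y - c)) / (d - c) with hκ₁
  have dκ : ∀ y, HasDerivAt κ (κ₁ y) y := by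
    intro y
    have := ((((hasDerivAt_id y).sub_const c).mul ((hasDerivAt_id y).const_sub d)).div_const
      (d - c))
    refine this.congr_deriv ?_
    simp [hκ₁]; ring
  have cκ₁ : Continuous κ₁ := by simp only [hκ₁]; fun_prop
  have cκ : Continuous κ := by simp only [hκ]; fun_prop
  have cp : ContinuousOn (fun y => κ₁ y * f₁ y) (Ioo c d) := cκ₁.continuousOn.mul cf₁
  have ii : ∀ z ∈ Ioo c d, IntervalIntegrable (fun y => κ₁ y * f₁ y) volume α z := by
    intro z hz
    apply ContinuousOn.intervalIntegrable
    exact cp.mono ((convex_Ioo c d).ordConnected.uIcc_subset (hsub ⟨le_rfl, hαβ⟩) hz)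
  -- An antiderivative of κ f₂, read off from (κ f₁)' = κ₁ f₁ + κ f₂. It is O(√s) because κ|Q'| ≲
  -- √(Q s) and |κ₁| ≤ 1, whereas f₁ alone has no bound independent of the lower bound of Q.
  set G : ℝ → ℝ := fun z => κ z * f₁ z - ∫ y in α..z, κ₁ y * f₁ y with hG
  have dG : ∀ y ∈ Icc α β, HasDerivAt G (κ y * f₂ y) y := by
    intro y hy
    have hy' := hsub hy
    have i1 := intervalIntegral.integral_hasDerivAt_right (ii y hy')
      (cp.stronglyMeasurableAtFilter isOpen_Ioo y hy') (cp.continuousAt (isOpen_Ioo.mem_nhds hy'))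
    refine (((dκ y).mul (d2 y hy')).sub i1).congr_deriv ?_
    ring
  have κnn : ∀ y ∈ Icc α β, 0 ≤ κ y := fun y hy => by
    have := hsub hy
    exact div_nonneg (mul_nonneg (by linarith [this.1]) (by linarith [this.2])) hd.le
  have bG : ∀ y ∈ Icc α β, |G y| ≤ ((1 + C) + 2 * 2 ^ n) * √s := by
    intro y hy
    have hy' := hsub hy
    have w1 : |κ y * f₁ y| ≤ (1 + C) * √s := by
      have := weight_mul_abs_deriv_le hcd (by linarith : 0 ≤ C) (fun y _ => Q.hasDerivAt y)
        (fun y _ => Q.derivative.hasDerivAt y) hQ2 hq hy'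
      have h0 := hr0 y hy'
      rw [abs_mul, abs_of_nonneg (κnn y hy)]
      simp only [hf₁]
      rw [abs_div, abs_of_pos (by positivity : 0 < 2 * √(Q.eval y)), ← mul_div_assoc,
        div_le_iff₀ (by positivity)]
      have : 0 ≤ (1 + C) * (√(Q.eval y) * √s) := by positivity
      linarith
    have w2 : |∫ t in α..y, κ₁ t * f₁ t| ≤ 2 * √s * 2 ^ n := by
      refine (intervalIntegral.abs_integral_le_integral_abs hy.1).trans (le_trans ?_ (var1 y hy))
      have hsy : Icc α y ⊆ Ioo c d := (Icc_subset_Icc le_rfl hy.2).trans hsub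
      refine intervalIntegral.integral_mono_on hy.1 (ii y hy').abs ?_ fun t ht => ?_
      · apply ContinuousOn.intervalIntegrable
        rw [uIcc_of_le hy.1]; exact (cf₁.mono hsy).abs
      · rw [abs_mul]
        have : |κ₁ t| ≤ 1 := by
          have := hsy ht
          rw [hκ₁, abs_div, abs_of_pos hd, div_le_one hd, abs_le]
          constructor <;> linarith [this.1, this.2]
        nlinarith [abs_nonneg (f₁ t)]
    have := abs_sub (κ y * f₁ y) (∫ t in α..y, κ₁ t * f₁ t)
    simp only [hG]
    linarith
  have var2 := integral_abs_deriv_le_of_sign_polynomial (2 * n)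
    (2 * Q * Q.derivative.derivative - Q.derivative ^ 2) (by
      have a1 := natDegree_derivative_le Q
      have a2 := natDegree_derivative_le Q.derivative
      refine (natDegree_sub_le _ _).trans (max_le ?_ ?_)
      · refine natDegree_mul_le.trans ?_
        have : (2 * Q : ℝ[X]).natDegree ≤ (2 : ℝ[X]).natDegree + Q.natDegree := natDegree_mul_le
        rw [natDegree_ofNat] at this
        omega
      · refine natDegree_pow_le.trans ?_
        have : Q.derivative.natDegree ≤ n := by omega
        gcongr) G (fun y => κ y * f₂ y)
    (fun y => κ y * (4 * √(Q.eval y) ^ 3)⁻¹) α β (((1 + C) + 2 * 2 ^ n) * √s) hαβ dG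
    (cκ.continuousOn.mul (cf₂.mono hsub))
    (fun y hy => mul_nonneg (κnn y hy) (by positivity))
    (fun y hy => by simp only [hf₂]; ring) bG
  have e2 : ∫ y in α..β, κ y * |f₂ y| = ∫ y in α..β, |κ y * f₂ y| := by
    apply intervalIntegral.integral_congr
    intro y hy
    rw [uIcc_of_le hαβ] at hy
    simp only [abs_mul, abs_of_nonneg (κnn y hy)]
  have hss : 0 ≤ √s := Real.sqrt_nonneg s
  have n1 : 0 ≤ 2 * 2 ^ n * √s := by positivity
  have n2 : 0 ≤ 2 * ((1 + C) + 2 * 2 ^ n) * 2 ^ (2 * n) * √s := by positivity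
  refine ⟨f₁, f₂, fun y hy => d1 y (hsub hy), fun y hy => d2 y (hsub hy), cf₂.mono hsub, ?_, ?_⟩
  · have := var1 β ⟨hαβ, le_rfl⟩
    linarith
  · rw [e2]; linarith

/-! ### Two integrations by parts in an oscillatory integral -/

/-- Integration by parts against `e^{iΦ}` with `Φ' = θ`. -/
theorem integral_exp_mul_deriv_phase {Φ θ : ℝ → ℝ} {w w₁ : ℝ → ℂ} {α β : ℝ} (hαβ : α ≤ β)
    (hΦ : ∀ y ∈ Icc α β, HasDerivAt Φ (θ y) y) (hθ : ContinuousOn θ (Icc α β))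
    (hw : ∀ y ∈ Icc α β, HasDerivAt w (w₁ y) y) (hw₁ : ContinuousOn w₁ (Icc α β))
    (hα : w α = 0) (hβ : w β = 0) :
    ∫ y in α..β, Complex.exp (Complex.I * (Φ y : ℂ)) * (θ y * w y) =
      Complex.I * ∫ y in α..β, Complex.exp (Complex.I * (Φ y : ℂ)) * w₁ y := by
  have de : ∀ y ∈ Icc α β, HasDerivAt (fun y => Complex.exp (Complex.I * (Φ y : ℂ)))
      (Complex.exp (Complex.I * (Φ y : ℂ)) * (Complex.I * (θ y : ℂ))) y := fun y hy =>
    (((hΦ y hy).ofReal_comp).const_mul Complex.I).cexp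
  have cΦ : ContinuousOn Φ (Icc α β) := fun y hy => (hΦ y hy).continuousAt.continuousWithinAt
  have cw : ContinuousOn w (Icc α β) := fun y hy => (hw y hy).continuousAt.continuousWithinAt
  have cθ : ContinuousOn (fun y => (θ y : ℂ)) (Icc α β) :=
    Complex.continuous_ofReal.comp_continuousOn hθ
  have ce : ContinuousOn (fun y => Complex.exp (Complex.I * (Φ y : ℂ))) (Icc α β) :=
    fun y hy => (de y hy).continuousAt.continuousWithinAt
  have ce' := ce.mul (continuousOn_const (c := Complex.I) |>.mul cθ)
  have h := intervalIntegral.integral_deriv_mul_eq_sub (a := α) (b := β)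
    (u := fun y => Complex.exp (Complex.I * (Φ y : ℂ))) (v := w) (v' := w₁)
    (by rwa [uIcc_of_le hαβ]) (by rwa [uIcc_of_le hαβ])
    (by apply ContinuousOn.intervalIntegrable; rwa [uIcc_of_le hαβ])
    (by apply ContinuousOn.intervalIntegrable; rwa [uIcc_of_le hαβ])
  rw [hα, hβ, mul_zero, mul_zero, sub_zero, intervalIntegral.integral_add] at h
  · have e : ∫ y in α..β, Complex.exp (Complex.I * (Φ y : ℂ)) * (Complex.I * θ y) * w y =
        Complex.I * ∫ y in α..β, Complex.exp (Complex.I * (Φ y : ℂ)) * (θ y * w y) := by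
      rw [← intervalIntegral.integral_const_mul]
      congr 1; ext y; ring
    rw [e] at h
    linear_combination (-Complex.I) * h +
      (∫ y in α..β, Complex.exp (Complex.I * (Φ y : ℂ)) * (θ y * w y)) * Complex.I_mul_I
  · apply ContinuousOn.intervalIntegrable; rw [uIcc_of_le hαβ]; exact ce'.mul cw
  · apply ContinuousOn.intervalIntegrable; rw [uIcc_of_le hαβ]; exact ce.mul hw₁

/-- A differentiable function vanishing off `[α, β] ⊆ (c, d)` vanishes at the ends, and so does its
continuous derivative. -/
theorem eq_zero_at_endpoints {u u₁ : ℝ → ℂ} {c d α β : ℝ} (hcα : c < α) (hαβ : α ≤ β) (hβd : β < d)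
    (h1 : ∀ y ∈ Ioo c d, HasDerivAt u (u₁ y) y) (h2 : ContinuousOn u₁ (Ioo c d))
    (h0 : ∀ y, y ∉ Icc α β → u y = 0) : (u α = 0 ∧ u β = 0) ∧ (u₁ α = 0 ∧ u₁ β = 0) := by
  have hz : ∀ y ∈ Ioo c d, y ∉ Icc α β → u₁ y = 0 := by
    intro y hy hn
    have : u =ᶠ[nhds y] fun _ => (0 : ℂ) := by
      filter_upwards [isClosed_Icc.isOpen_compl.mem_nhds hn] with t ht using h0 t ht
    exact (h1 y hy).unique ((hasDerivAt_const y (0 : ℂ)).congr_of_eventuallyEq this)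
  have key : ∀ v : ℝ → ℂ, ContinuousOn v (Ioo c d) → (∀ y ∈ Ioo c d, y ∉ Icc α β → v y = 0) →
      v α = 0 ∧ v β = 0 := by
    intro v hv hv0
    constructor
    · have hc : Filter.Tendsto v (nhdsWithin α (Iio α)) (nhds (v α)) :=
        ((hv.continuousAt (Ioo_mem_nhds hcα (by linarith))).tendsto).mono_left nhdsWithin_le_nhds
      refine tendsto_nhds_unique hc (tendsto_const_nhds.congr' ?_)
      filter_upwards [self_mem_nhdsWithin, nhdsWithin_le_nhds (Ioi_mem_nhds hcα)] with t ht htc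
      rw [hv0 t ⟨htc, by linarith [mem_Iio.1 ht]⟩ fun hm => absurd hm.1 (not_le.2 ht)]
    · have hc : Filter.Tendsto v (nhdsWithin β (Ioi β)) (nhds (v β)) :=
        ((hv.continuousAt (Ioo_mem_nhds (by linarith) hβd)).tendsto).mono_left nhdsWithin_le_nhds
      refine tendsto_nhds_unique hc (tendsto_const_nhds.congr' ?_)
      filter_upwards [self_mem_nhdsWithin, nhdsWithin_le_nhds (Iio_mem_nhds hβd)] with t ht htc
      rw [hv0 t ⟨by linarith [mem_Ioi.1 ht], htc⟩ fun hm => absurd hm.2 (not_le.2 ht)]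
  exact ⟨key u (fun y hy => (h1 y hy).continuousAt.continuousWithinAt) fun y _ hn => h0 y hn,
    key u₁ h2 hz⟩

/-- The Lipschitz bounds from the two ends, combined with weights d - y and y - c, produce exactly
the weight under which the second derivative of √Q is integrable. -/
theorem norm_mul_le_weight {u u₁ : ℝ → ℂ} {c d α β ℓ U : ℝ} (hcα : c < α) (hαβ : α ≤ β)
    (hβd : β < d) (hℓ : 0 < ℓ) (h1 : ∀ y ∈ Ioo c d, HasDerivAt u (u₁ y) y)
    (hb : ∀ y ∈ Ioo c d, ‖u₁ y‖ * ℓ ≤ U) (hα : u α = 0) (hβ : u β = 0) {y : ℝ}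
    (hy : y ∈ Icc α β) : ‖u y‖ * ℓ ≤ 2 * U * ((y - c) * (d - y) / (d - c)) := by
  have hsub : Icc α β ⊆ Ioo c d := fun y hy => ⟨by linarith [hy.1], by linarith [hy.2]⟩
  have hd : 0 < d - c := by linarith
  have hU : 0 ≤ U := le_trans (by positivity) (hb y (hsub hy))
  have hlip : ∀ z ∈ Icc α β, ‖u y - u z‖ ≤ U / ℓ * ‖y - z‖ := fun z hz =>
    (convex_Ioo c d).norm_image_sub_le_of_norm_hasDerivWithin_le
      (fun w hw => (h1 w hw).hasDerivWithinAt)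
      (fun w hw => by rw [le_div_iff₀ hℓ]; exact hb w hw) (hsub hz) (hsub hy)
  have e1 := hlip α ⟨le_rfl, hαβ⟩
  have e2 := hlip β ⟨hαβ, le_rfl⟩
  rw [hα, sub_zero, Real.norm_eq_abs, abs_of_nonneg (by linarith [hy.1]), div_mul_eq_mul_div,
    le_div_iff₀ hℓ] at e1
  rw [hβ, sub_zero, Real.norm_eq_abs, abs_of_nonpos (by linarith [hy.2]), div_mul_eq_mul_div,
    le_div_iff₀ hℓ] at e2
  have e1' : ‖u y‖ * ℓ ≤ U * (y - c) := e1.trans (by gcongr)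
  have e2' : ‖u y‖ * ℓ ≤ U * (d - y) := e2.trans (by gcongr; linarith)
  have hyc : 0 < y - c := by linarith [hy.1]
  have hyd : 0 < d - y := by linarith [hy.2]
  rw [← mul_div_assoc, le_div_iff₀ hd]
  have f1 := mul_le_mul_of_nonneg_right e1' hyd.le
  have f2 := mul_le_mul_of_nonneg_right e2' hyc.le
  calc ‖u y‖ * ℓ * (d - c) = ‖u y‖ * ℓ * (d - y) + ‖u y‖ * ℓ * (y - c) := by ring
    _ ≤ _ := by linarith

open Polynomial in
-- The factor `u` is smooth on the scale ℓ, but Q may be arbitrarily small, so derivatives falling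
-- on √Q are controlled only in L¹. The first one is so without weight; the second one always comes
-- multiplied by u/θ, whose vanishing at α and β supplies the weight. The constant involves no lower
-- bound for Q.
theorem exists_oscillatory_bound_of_pos (n : ℕ) : ∃ C : ℝ, 1 ≤ C ∧
    ∀ Q : ℝ[X], Q.natDegree ≤ n → ∀ c d s α β ℓ G U : ℝ, ∀ Φ θ g : ℝ → ℝ, ∀ u : ℝ → ℂ,
    (∀ y ∈ Ioo c d, 0 < Q.eval y ∧ Q.eval y ≤ s) → c < α → α ≤ β → β < d →
    0 < ℓ → β - α ≤ 4 * ℓ → (∀ y ∈ Ioo c d, HasDerivAt Φ (θ y) y) → ContinuousOn θ (Ioo c d) →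
    (∀ y ∈ Ioo c d, θ y * g y = 1) → C2Bound (Ioo c d) ℓ G g → C2Bound (Ioo c d) ℓ U u →
    (∀ y, y ∉ Icc α β → u y = 0) →
    ‖∫ y in α..β, Complex.exp (Complex.I * (Φ y : ℂ)) * (u y * (√(Q.eval y) : ℝ))‖ * ℓ ≤
      C * G ^ 2 * U * √s := by
  obtain ⟨C, hC, h⟩ := exists_sqrt_polynomial_variation n
  -- The factor 4 is from the product g u; 8 is from 2√s over length at most 4ℓ; 5 = 3 + 2 counts
  -- the two variation terms.
  refine ⟨4 * (8 + 5 * C), by linarith, ?_⟩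
  intro Q hQ c d s α β ℓ G U Φ θ g u hq hcα hαβ hβd hℓ hlen hΦ hθ hθg hg hu hu0
  have hsub : Icc α β ⊆ Ioo c d := fun y hy => ⟨by linarith [hy.1], by linarith [hy.2]⟩
  obtain ⟨f₁, f₂, d1, d2, cf₂, var1, var2⟩ := h Q hQ c d s α β hq hcα hαβ hβd
  have ha : C2Bound (Ioo c d) ℓ (4 * G * U) (fun y => (g y : ℂ) * u y) := hg.ofReal.mul hu hℓ.le
  obtain ⟨a₁, a₂, p1, p2, p3, p4⟩ := ha
  obtain ⟨g₁, g₂, k1, k2, -, k4⟩ := hg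
  set a : ℝ → ℂ := fun y => (g y : ℂ) * u y with hadef
  set W := 4 * G * U with hW
  set f : ℝ → ℝ := fun t => √(Q.eval t) with hf
  have ca₁ : ContinuousOn a₁ (Ioo c d) := fun y hy => (p2 y hy).continuousAt.continuousWithinAt
  have ca : ContinuousOn a (Ioo c d) := fun y hy => (p1 y hy).continuousAt.continuousWithinAt
  have cg : ContinuousOn g (Ioo c d) := fun y hy => (k1 y hy).continuousAt.continuousWithinAt
  have cg₁ : ContinuousOn g₁ (Ioo c d) := fun y hy => (k2 y hy).continuousAt.continuousWithinAt
  have cf : ContinuousOn f (Icc α β) := fun y hy => (d1 y hy).continuousAt.continuousWithinAt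
  have cf₁ : ContinuousOn f₁ (Icc α β) := fun y hy => (d2 y hy).continuousAt.continuousWithinAt
  have cR {w : ℝ → ℝ} {s : Set ℝ} (h : ContinuousOn w s) : ContinuousOn (fun y => (w y : ℂ)) s :=
    Complex.continuous_ofReal.comp_continuousOn h
  obtain ⟨⟨aα, aβ⟩, a₁α, a₁β⟩ := eq_zero_at_endpoints hcα hαβ hβd p1 ca₁
    (fun y hy => by simp [hadef, hu0 y hy])
  -- Here b = (a√Q)' with a = u/θ. The second integration by parts writes b = θ(g b) and
  -- differentiates g b; its boundary terms vanish because both a and a' do.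
  set b : ℝ → ℂ := fun y => a₁ y * f y + a y * f₁ y with hb
  set b₁ : ℝ → ℂ := fun y => (a₂ y * f y + a₁ y * f₁ y) + (a₁ y * f₁ y + a y * f₂ y) with hb₁
  have db : ∀ y ∈ Icc α β, HasDerivAt b (b₁ y) y := fun y hy =>
    ((p2 y (hsub hy)).mul (d1 y hy).ofReal_comp).add ((p1 y (hsub hy)).mul (d2 y hy).ofReal_comp)
  have cb : ContinuousOn b (Icc α β) := fun y hy => (db y hy).continuousAt.continuousWithinAt
  have cb₁ : ContinuousOn b₁ (Icc α β) :=
    (((p3.mono hsub).mul (cR cf)).add ((ca₁.mono hsub).mul (cR cf₁))).add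
      (((ca₁.mono hsub).mul (cR cf₁)).add ((ca.mono hsub).mul (cR cf₂)))
  have s1 := integral_exp_mul_deriv_phase (w := fun y => a y * f y) (w₁ := b) hαβ
    (fun y hy => hΦ y (hsub hy)) (hθ.mono hsub)
    (fun y hy => (p1 y (hsub hy)).mul (d1 y hy).ofReal_comp) cb (by simp [aα]) (by simp [aβ])
  set w₁ : ℝ → ℂ := fun y => g₁ y * b y + g y * b₁ y with hw₁
  have cw₁ : ContinuousOn w₁ (Icc α β) :=
    ((cR (cg₁.mono hsub)).mul cb).add ((cR (cg.mono hsub)).mul cb₁)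
  have s2 := integral_exp_mul_deriv_phase (w := fun y => g y * b y) (w₁ := w₁) hαβ
    (fun y hy => hΦ y (hsub hy)) (hθ.mono hsub)
    (fun y hy => ((k1 y (hsub hy)).ofReal_comp).mul (db y hy)) cw₁ (by simp [hb, aα, a₁α])
    (by simp [hb, aβ, a₁β])
  have hθg' : ∀ y ∈ Icc α β, (θ y : ℂ) * g y = 1 := fun y hy => by
    exact_mod_cast hθg y (hsub hy)
  have s1' : ∫ y in α..β, Complex.exp (Complex.I * (Φ y : ℂ)) * (u y * (√(Q.eval y) : ℝ)) =
      Complex.I * ∫ y in α..β, Complex.exp (Complex.I * (Φ y : ℂ)) * b y := by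
    rw [← s1]
    apply intervalIntegral.integral_congr
    intro y hy
    rw [uIcc_of_le hαβ] at hy
    simp only [hadef, hf]
    linear_combination (-(Complex.exp (Complex.I * (Φ y : ℂ)) * u y * (√(Q.eval y) : ℝ))) *
      hθg' y hy
  have s2' : ∫ y in α..β, Complex.exp (Complex.I * (Φ y : ℂ)) * b y =
      Complex.I * ∫ y in α..β, Complex.exp (Complex.I * (Φ y : ℂ)) * w₁ y := by
    rw [← s2]
    apply intervalIntegral.integral_congr
    intro y hy
    rw [uIcc_of_le hαβ] at hy
    simp only
    linear_combination (-(Complex.exp (Complex.I * (Φ y : ℂ)) * b y)) * hθg' y hy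
  have hd : 0 < d - c := by linarith
  have hα' := k4 α (hsub ⟨le_rfl, hαβ⟩)
  have hG : 0 ≤ G := (norm_nonneg _).trans hα'.1
  have hW0 : 0 ≤ W := (norm_nonneg _).trans (p4 α (hsub ⟨le_rfl, hαβ⟩)).1
  have hss : 0 ≤ √s := Real.sqrt_nonneg s
  set κ : ℝ → ℝ := fun y => (y - c) * (d - y) / (d - c) with hκ
  have cκ : Continuous κ := by simp only [hκ]; fun_prop
  have pt : ∀ y ∈ Icc α β, ‖w₁ y‖ * ℓ ^ 2 ≤
      G * W * (2 * √s + 3 * ℓ * |f₁ y| + 2 * ℓ * (κ y * |f₂ y|)) := by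
    intro y hy
    obtain ⟨g0, g1, -⟩ := k4 y (hsub hy)
    obtain ⟨A0, A1, A2⟩ := p4 y (hsub hy)
    have A3 : ‖a y‖ * ℓ ≤ 2 * W * κ y := norm_mul_le_weight hcα hαβ hβd hℓ p1
      (fun y hy => (p4 y hy).2.1) aα aβ hy
    have F0 : |f y| ≤ √s := by
      rw [abs_of_nonneg (Real.sqrt_nonneg _)]; exact Real.sqrt_le_sqrt (hq y (hsub hy)).2
    have κ0 : 0 ≤ κ y :=
      div_nonneg (mul_nonneg (by linarith [hy.1]) (by linarith [hy.2])) hd.le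
    have nb : ‖b y‖ * ℓ ≤ W * √s + W * ℓ * |f₁ y| := by
      calc ‖b y‖ * ℓ ≤ (‖a₁ y * f y‖ + ‖a y * f₁ y‖) * ℓ := by gcongr; exact norm_add_le _ _
        _ = (‖a₁ y‖ * ℓ) * |f y| + ‖a y‖ * (ℓ * |f₁ y|) := by
          rw [norm_mul, norm_mul, Complex.norm_real, Complex.norm_real, Real.norm_eq_abs,
            Real.norm_eq_abs]; ring
        _ ≤ W * √s + W * (ℓ * |f₁ y|) := by gcongr
        _ = _ := by ring
    have nb₁ : ‖b₁ y‖ * ℓ ^ 2 ≤ W * √s + 2 * (W * ℓ * |f₁ y|) + 2 * W * κ y * (ℓ * |f₂ y|) := by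
      calc ‖b₁ y‖ * ℓ ^ 2 ≤ ((‖a₂ y * f y‖ + ‖a₁ y * f₁ y‖) + (‖a₁ y * f₁ y‖ + ‖a y * f₂ y‖)) *
            ℓ ^ 2 := by
            gcongr
            exact (norm_add_le _ _).trans (add_le_add (norm_add_le _ _) (norm_add_le _ _))
        _ = (‖a₂ y‖ * ℓ ^ 2) * |f y| + 2 * ((‖a₁ y‖ * ℓ) * (ℓ * |f₁ y|)) +
            (‖a y‖ * ℓ) * (ℓ * |f₂ y|) := by
          simp only [norm_mul, Complex.norm_real, Real.norm_eq_abs]; ring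
        _ ≤ W * √s + 2 * (W * (ℓ * |f₁ y|)) + (2 * W * κ y) * (ℓ * |f₂ y|) := by gcongr
        _ = _ := by ring
    calc ‖w₁ y‖ * ℓ ^ 2 ≤ (‖(g₁ y : ℂ) * b y‖ + ‖(g y : ℂ) * b₁ y‖) * ℓ ^ 2 := by
          gcongr; exact norm_add_le _ _
      _ = (‖g₁ y‖ * ℓ) * (‖b y‖ * ℓ) + ‖g y‖ * (‖b₁ y‖ * ℓ ^ 2) := by
          simp only [norm_mul, Complex.norm_real]; ring
      _ ≤ G * (W * √s + W * ℓ * |f₁ y|) +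
          G * (W * √s + 2 * (W * ℓ * |f₁ y|) + 2 * W * κ y * (ℓ * |f₂ y|)) := by gcongr
      _ = _ := by ring
  have i1 : IntervalIntegrable (fun y => |f₁ y|) volume α β := by
    apply ContinuousOn.intervalIntegrable; rw [uIcc_of_le hαβ]; exact cf₁.abs
  have i2 : IntervalIntegrable (fun y => κ y * |f₂ y|) volume α β := by
    apply ContinuousOn.intervalIntegrable; rw [uIcc_of_le hαβ]; exact cκ.continuousOn.mul cf₂.abs
  have i3 : IntervalIntegrable (fun y => ‖w₁ y‖ * ℓ ^ 2) volume α β := by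
    apply ContinuousOn.intervalIntegrable; rw [uIcc_of_le hαβ]
    exact cw₁.norm.mul continuousOn_const
  have tot : ‖∫ y in α..β, Complex.exp (Complex.I * (Φ y : ℂ)) * w₁ y‖ * ℓ ^ 2 ≤
      G * W * (8 + 5 * C) * √s * ℓ := by
    calc _ ≤ (∫ y in α..β, ‖w₁ y‖) * ℓ ^ 2 := by
          gcongr
          refine (intervalIntegral.norm_integral_le_integral_norm hαβ).trans (le_of_eq ?_)
          congr 1; ext y
          rw [norm_mul, mul_comm Complex.I, Complex.norm_exp_ofReal_mul_I, one_mul]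
      _ = ∫ y in α..β, ‖w₁ y‖ * ℓ ^ 2 := (intervalIntegral.integral_mul_const _ _).symm
      _ ≤ ∫ y in α..β, G * W * (2 * √s + 3 * ℓ * |f₁ y| + 2 * ℓ * (κ y * |f₂ y|)) := by
          refine intervalIntegral.integral_mono_on hαβ i3 ?_ pt
          exact (((intervalIntegrable_const).add (i1.const_mul _)).add
            (i2.const_mul _)).const_mul _
      _ = G * W * (2 * √s * (β - α) + 3 * ℓ * (∫ y in α..β, |f₁ y|) +
            2 * ℓ * ∫ y in α..β, κ y * |f₂ y|) := by
          rw [intervalIntegral.integral_const_mul, intervalIntegral.integral_add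
            ((intervalIntegrable_const).add (i1.const_mul _)) (i2.const_mul _),
            intervalIntegral.integral_add intervalIntegrable_const (i1.const_mul _),
            intervalIntegral.integral_const, intervalIntegral.integral_const_mul,
            intervalIntegral.integral_const_mul, smul_eq_mul]
          ring
      _ ≤ G * W * (2 * √s * (4 * ℓ) + 3 * ℓ * (C * √s) + 2 * ℓ * (C * √s)) := by gcongr
      _ = _ := by ring
  rw [s1', s2', norm_mul, norm_mul, Complex.norm_I, one_mul, one_mul]
  refine le_of_mul_le_mul_right ?_ hℓ
  calc _ = ‖∫ y in α..β, Complex.exp (Complex.I * (Φ y : ℂ)) * w₁ y‖ * ℓ ^ 2 := by ring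
    _ ≤ _ := tot
    _ = _ := by rw [hW]; ring

open Polynomial in
-- Zeros of Q are admitted by applying the positive case to Q + ε, with s + ε, and letting ε
-- decrease to 0.
theorem exists_oscillatory_bound (n : ℕ) : ∃ C : ℝ, 1 ≤ C ∧
    ∀ Q : ℝ[X], Q.natDegree ≤ n → ∀ c d s α β ℓ G U : ℝ, ∀ Φ θ g : ℝ → ℝ, ∀ u : ℝ → ℂ,
    (∀ y ∈ Ioo c d, 0 ≤ Q.eval y ∧ Q.eval y ≤ s) → c < α → α ≤ β → β < d →
    0 < ℓ → β - α ≤ 4 * ℓ → (∀ y ∈ Ioo c d, HasDerivAt Φ (θ y) y) → ContinuousOn θ (Ioo c d) →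
    (∀ y ∈ Ioo c d, θ y * g y = 1) → C2Bound (Ioo c d) ℓ G g → C2Bound (Ioo c d) ℓ U u →
    (∀ y, y ∉ Icc α β → u y = 0) →
    ‖∫ y in α..β, Complex.exp (Complex.I * (Φ y : ℂ)) * (u y * (√(Q.eval y) : ℝ))‖ * ℓ ≤
      C * G ^ 2 * U * √s := by
  obtain ⟨C₀, hC, h⟩ := exists_oscillatory_bound_of_pos n
  refine ⟨C₀, hC, ?_⟩
  intro Q hQ c d s α β ℓ G U Φ θ g u hq hcα hαβ hβd hℓ hlen hΦ hθ hθg hg hu hu0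
  have hsub : Icc α β ⊆ Ioo c d := fun y hy => ⟨by linarith [hy.1], by linarith [hy.2]⟩
  have hlim : Filter.Tendsto (fun ε : ℝ =>
      ‖∫ y in α..β, Complex.exp (Complex.I * (Φ y : ℂ)) * (u y * (√(Q.eval y + ε) : ℝ))‖ * ℓ)
      (nhdsWithin 0 (Ioi 0))
      (nhds (‖∫ y in α..β, Complex.exp (Complex.I * (Φ y : ℂ)) * (u y * (√(Q.eval y) : ℝ))‖ *
        ℓ)) := by
    refine Filter.Tendsto.mul_const _ (Filter.Tendsto.norm ?_)
    have cΦ : ContinuousOn Φ (Icc α β) :=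
      fun y hy => (hΦ y (hsub hy)).continuousAt.continuousWithinAt
    obtain ⟨u₁, -, hu1, -⟩ := hu
    have cu : ContinuousOn u (Icc α β) :=
      fun y hy => (hu1 y (hsub hy)).continuousAt.continuousWithinAt
    have ce : ContinuousOn (fun y => Complex.exp (Complex.I * (Φ y : ℂ))) (Icc α β) :=
      (continuousOn_const.mul (Complex.continuous_ofReal.comp_continuousOn cΦ)).cexp
    have cs : ∀ ε : ℝ, Continuous (fun y => ((√(Q.eval y + ε) : ℝ) : ℂ)) := fun ε =>
      Complex.continuous_ofReal.comp (Real.continuous_sqrt.comp (Q.continuous.add continuous_const))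
    refine intervalIntegral.tendsto_integral_filter_of_dominated_convergence
      (fun y => ‖u y‖ * √(s + 1)) ?_ ?_ ?_ ?_
    · refine Filter.Eventually.of_forall fun ε => ?_
      refine ContinuousOn.aestronglyMeasurable ?_ measurableSet_uIoc
      exact (ce.mul (cu.mul (cs ε).continuousOn)).mono
        (by rw [uIoc_of_le hαβ]; exact Ioc_subset_Icc_self)
    · filter_upwards [Ioc_mem_nhdsGT (show (0 : ℝ) < 1 by norm_num)] with ε hε
      refine Filter.Eventually.of_forall fun y hy => ?_
      rw [uIoc_of_le hαβ] at hy
      rw [norm_mul, mul_comm Complex.I, Complex.norm_exp_ofReal_mul_I, one_mul, norm_mul,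
        Complex.norm_real, Real.norm_eq_abs, abs_of_nonneg (Real.sqrt_nonneg _)]
      gcongr
      · exact (hq y (hsub (Ioc_subset_Icc_self hy))).2
      · exact hε.2
    · apply ContinuousOn.intervalIntegrable
      rw [uIcc_of_le hαβ]
      exact cu.norm.mul continuousOn_const
    · refine Filter.Eventually.of_forall fun y _ => ?_
      have : Continuous fun ε : ℝ => Complex.exp (Complex.I * (Φ y : ℂ)) *
          (u y * ((√(Q.eval y + ε) : ℝ) : ℂ)) := by fun_prop
      have := (this.tendsto 0).mono_left (nhdsWithin_le_nhds (s := Ioi 0))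
      simpa using this
  have hlim2 : Filter.Tendsto (fun ε : ℝ => C₀ * G ^ 2 * U * √(s + ε)) (nhdsWithin 0 (Ioi 0))
      (nhds (C₀ * G ^ 2 * U * √s)) := by
    have : Continuous fun ε : ℝ => C₀ * G ^ 2 * U * √(s + ε) := by fun_prop
    have := (this.tendsto 0).mono_left (nhdsWithin_le_nhds (s := Ioi 0))
    simpa using this
  refine le_of_tendsto_of_tendsto hlim hlim2 ?_
  filter_upwards [self_mem_nhdsWithin] with ε hε
  have := h (Q + C ε) (by simpa using hQ) c d (s + ε) α β ℓ G U Φ θ g u (fun y hy => by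
      have := hq y hy
      have := mem_Ioi.1 hε
      rw [eval_add, eval_C]
      constructor <;> linarith) hcα hαβ hβd hℓ hlen hΦ hθ hθg hg hu hu0
  simpa only [eval_add, eval_C] using this

/-! ### Integral operators on L²: Schur's test, adjoints and products -/

/-- Young's inequality `L¹ * L² ⊆ L²` in `ℝ≥0∞`. -/
theorem lintegral_convolution_sq_le {h f : ℝ → ℝ≥0∞} (hh : Measurable h) (hf : Measurable f) :
    ∫⁻ x, (∫⁻ y, h (x - y) * f y) ^ 2 ≤ (∫⁻ t, h t) ^ 2 * ∫⁻ y, f y ^ 2 := by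
  have hsub : ∀ x, ∫⁻ y, h (x - y) = ∫⁻ t, h t := fun x => lintegral_sub_left_eq_self h x
  have hcs : ∀ x, (∫⁻ y, h (x - y) * f y) ^ 2 ≤ (∫⁻ t, h t) * ∫⁻ y, h (x - y) * f y ^ 2 := by
    intro x
    have hm : Measurable fun y => h (x - y) := hh.comp (measurable_const.sub measurable_id)
    -- Cauchy–Schwarz with h split as h^{1/2} · h^{1/2}.
    have key := ENNReal.lintegral_mul_le_Lp_mul_Lq volume Real.HolderConjugate.two_two
      (f := fun y => h (x - y) ^ (1 / 2 : ℝ)) (g := fun y => h (x - y) ^ (1 / 2 : ℝ) * f y)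
      (hm.pow_const _).aemeasurable ((hm.pow_const _).mul hf).aemeasurable
    have e0 : ∀ a : ℝ≥0∞, a ^ (1 / 2 : ℝ) * a ^ (1 / 2 : ℝ) = a := fun a => by
      rw [← ENNReal.rpow_add_of_nonneg _ _ (by norm_num) (by norm_num)]; norm_num
    have e1 : ∫⁻ y, ((fun y => h (x - y) ^ (1 / 2 : ℝ)) *
        (fun y => h (x - y) ^ (1 / 2 : ℝ) * f y)) y = ∫⁻ y, h (x - y) * f y := by
      congr 1; ext y
      simp only [Pi.mul_apply]
      rw [← mul_assoc, e0]
    have e2 : ∀ a : ℝ≥0∞, (a ^ (1 / 2 : ℝ)) ^ (2 : ℝ) = a := fun a => by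
      rw [← ENNReal.rpow_mul]; norm_num
    have e3 : ∀ a : ℝ≥0∞, (a ^ (1 / 2 : ℝ)) ^ 2 = a := fun a => by rw [sq, e0]
    rw [e1] at key
    simp only [ENNReal.mul_rpow_of_nonneg _ _ (show (0 : ℝ) ≤ 2 by norm_num), e2, hsub] at key
    calc _ ≤ _ := pow_le_pow_left' key 2
      _ = _ := by rw [mul_pow, e3, e3]; norm_cast
  calc _ ≤ ∫⁻ x, (∫⁻ t, h t) * ∫⁻ y, h (x - y) * f y ^ 2 := lintegral_mono hcs
    _ = (∫⁻ t, h t) * ∫⁻ x, ∫⁻ y, h (x - y) * f y ^ 2 := by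
      rw [lintegral_const_mul]
      exact Measurable.lintegral_prod_right
        ((hh.comp (measurable_fst.sub measurable_snd)).mul ((hf.comp measurable_snd).pow_const 2))
    _ = (∫⁻ t, h t) * ∫⁻ y, ∫⁻ x, h (x - y) * f y ^ 2 := by
      rw [lintegral_lintegral_swap]
      exact ((hh.comp (measurable_fst.sub measurable_snd)).mul
        ((hf.comp measurable_snd).pow_const 2)).aemeasurable
    _ = (∫⁻ t, h t) * ∫⁻ y, (∫⁻ t, h t) * f y ^ 2 := by
      congr 2; ext y
      have hm : Measurable fun x => h (x - y) := hh.comp (measurable_id.sub_const y)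
      rw [lintegral_mul_const _ hm, lintegral_sub_right_eq_self h y]
    _ = _ := by rw [lintegral_const_mul _ (hf.pow_const 2)]; ring

/-- Schur's test for kernels dominated by a convolution kernel. -/
theorem exists_hasKernel_of_convolution_bound {k : ℝ → ℝ → ℂ} {h : ℝ → ℝ≥0∞} {A : ℝ}
    (hk : Measurable (Function.uncurry k)) (hh : Measurable h) (hA : 0 ≤ A)
    (hkh : ∀ x y, ‖k x y‖ₑ ≤ h (x - y)) (hI : ∫⁻ t, h t ≤ ENNReal.ofReal A) :
    ∃ T : L2 →L[ℂ] L2, HasKernel T k ∧ ‖T‖ ≤ A := by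
  have hfm : ∀ f : L2, Measurable f := fun f => (Lp.stronglyMeasurable f).measurable
  have hfe : ∀ f : L2, Measurable fun y => ‖f y‖ₑ := fun f => (hfm f).enorm
  have hint2 : ∀ f : L2, ∫⁻ y, ‖f y‖ₑ ^ 2 = eLpNorm f 2 volume ^ 2 := fun f => by
    rw [eLpNorm_eq_lintegral_rpow_enorm_toReal (by norm_num) (by norm_num)]
    simp only [ENNReal.toReal_ofNat, one_div]
    rw [← ENNReal.rpow_natCast _ 2, ← ENNReal.rpow_mul]
    norm_num
  have hconv : ∀ f : L2, ∫⁻ x, (∫⁻ y, h (x - y) * ‖f y‖ₑ) ^ 2 ≤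
      (ENNReal.ofReal A * eLpNorm f 2 volume) ^ 2 := fun f => by
    refine (lintegral_convolution_sq_le hh (hfe f)).trans ?_
    rw [hint2, mul_pow]
    gcongr
  have hcm : ∀ f : L2, Measurable fun x => ∫⁻ y, h (x - y) * ‖f y‖ₑ := fun f =>
    Measurable.lintegral_prod_right
      ((hh.comp (measurable_fst.sub measurable_snd)).mul ((hfe f).comp measurable_snd))
  have hkm : ∀ x, Measurable (k x) := fun x => hk.comp measurable_prodMk_left
  have hle : ∀ f : L2, ∀ x, ∫⁻ y, ‖k x y * f y‖ₑ ≤ ∫⁻ y, h (x - y) * ‖f y‖ₑ := fun f x => by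
    refine lintegral_mono fun y => ?_
    simp only [enorm_mul]
    gcongr
    exact hkh x y
  have hae : ∀ f : L2, ∀ᵐ x, Integrable fun y => k x y * f y := fun f => by
    have hfin : ∀ᵐ x, (∫⁻ y, h (x - y) * ‖f y‖ₑ) ^ 2 < ⊤ := by
      refine ae_lt_top ((hcm f).pow_const 2) (ne_top_of_le_ne_top ?_ (hconv f))
      exact ENNReal.pow_ne_top (ENNReal.mul_ne_top ENNReal.ofReal_ne_top (Lp.eLpNorm_ne_top f))
    filter_upwards [hfin] with x hx
    refine ⟨((hkm x).mul (hfm f)).aestronglyMeasurable, ?_⟩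
    refine (hle f x).trans_lt ?_
    by_contra hcon
    rw [not_lt, top_le_iff] at hcon
    simp [hcon] at hx
  have hTm : ∀ f : L2, StronglyMeasurable fun x => ∫ y, k x y * f y := fun f =>
    StronglyMeasurable.integral_prod_right'
      (f := fun p : ℝ × ℝ => k p.1 p.2 * f p.2)
      (hk.mul ((hfm f).comp measurable_snd)).stronglyMeasurable
  have hTn : ∀ f : L2, eLpNorm (fun x => ∫ y, k x y * f y) 2 volume ≤
      ENNReal.ofReal A * eLpNorm f 2 volume := fun f => by
    rw [eLpNorm_eq_lintegral_rpow_enorm_toReal (by norm_num) (by norm_num)]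
    simp only [ENNReal.toReal_ofNat, one_div]
    rw [ENNReal.rpow_inv_le_iff (by norm_num)]
    norm_cast
    refine le_trans (lintegral_mono fun x => ?_) (hconv f)
    gcongr
    exact (enorm_integral_le_lintegral_enorm _).trans (hle f x)
  have hTL : ∀ f : L2, MemLp (fun x => ∫ y, k x y * f y) 2 volume := fun f =>
    ⟨(hTm f).aestronglyMeasurable, (hTn f).trans_lt
      (ENNReal.mul_lt_top ENNReal.ofReal_lt_top (Lp.eLpNorm_lt_top f))⟩
  let L : L2 →ₗ[ℂ] L2 :=
    { toFun := fun f => (hTL f).toLp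
      map_add' := fun f g => by
        apply Lp.ext
        filter_upwards [(hTL (f + g)).coeFn_toLp, (hTL f).coeFn_toLp, (hTL g).coeFn_toLp,
          Lp.coeFn_add (hTL f).toLp (hTL g).toLp, hae f, hae g] with x h1 h2 h3 h4 h5 h6
        rw [h1, h4, Pi.add_apply, h2, h3, ← integral_add h5 h6]
        apply integral_congr_ae
        filter_upwards [Lp.coeFn_add f g] with y hy
        rw [hy, Pi.add_apply, mul_add]
      map_smul' := fun c f => by
        apply Lp.ext
        filter_upwards [(hTL (c • f)).coeFn_toLp, (hTL f).coeFn_toLp,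
          Lp.coeFn_smul c (hTL f).toLp] with x h1 h2 h3
        rw [h1, RingHom.id_apply, h3, Pi.smul_apply, h2, smul_eq_mul, ← integral_const_mul]
        apply integral_congr_ae
        filter_upwards [Lp.coeFn_smul c f] with y hy
        rw [hy, Pi.smul_apply, smul_eq_mul]
        ring }
  have hLn : ∀ f, ‖L f‖ ≤ A * ‖f‖ := fun f => by
    change ‖(hTL f).toLp‖ ≤ _
    rw [Lp.norm_toLp, Lp.norm_def, ← ENNReal.toReal_ofReal hA, ← ENNReal.toReal_mul]
    refine ENNReal.toReal_mono ?_ (hTn f)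
    exact ENNReal.mul_ne_top ENNReal.ofReal_ne_top (Lp.eLpNorm_ne_top f)
  refine ⟨L.mkContinuous A hLn, fun f => ?_, L.mkContinuous_norm_le hA hLn⟩
  filter_upwards [hae f, (hTL f).coeFn_toLp] with x h1 h2
  exact ⟨h1, h2⟩

/-- A bounded measurable kernel with bounded support. -/
structure IsBoundedKernel (M R : ℝ) (k : ℝ → ℝ → ℂ) : Prop where
  measurable : Measurable (Function.uncurry k)
  bound : ∀ x y, ‖k x y‖ ≤ M
  supp : ∀ x y, k x y ≠ 0 → x ∈ Icc (-R) R ∧ y ∈ Icc (-R) R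

namespace IsBoundedKernel

variable {M R : ℝ} {k k₁ k₂ : ℝ → ℝ → ℂ}

theorem flip_conj (h : IsBoundedKernel M R k) :
    IsBoundedKernel M R fun x y => (starRingEnd ℂ) (k y x) where
  measurable := Complex.continuous_conj.measurable.comp (h.measurable.comp measurable_swap)
  bound x y := by rw [RCLike.norm_conj]; exact h.bound y x
  supp x y hxy := (h.supp y x fun h0 => hxy (by rw [h0, map_zero])).symm

theorem norm_le_indicator (h : IsBoundedKernel M R k) (x y : ℝ) :
    ‖k x y‖ ≤ M * ((Icc (-R) R).indicator 1 x * (Icc (-R) R).indicator 1 y) := by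
  by_cases h0 : k x y = 0
  · rw [h0, norm_zero]
    have := (norm_nonneg _).trans (h.bound x y)
    refine mul_nonneg this (mul_nonneg ?_ ?_) <;> exact indicator_nonneg (fun _ _ => zero_le_one) _
  · obtain ⟨hx, hy⟩ := h.supp x y h0
    rw [indicator_of_mem hx, indicator_of_mem hy]
    simpa using h.bound x y

/-- Purely qualitative: the norm bound is discarded, since it depends on `M` and `R`, which must not
enter the final constant. -/
theorem exists_hasKernel (h : IsBoundedKernel M R k) : ∃ T : L2 →L[ℂ] L2, HasKernel T k := by
  have hM : 0 ≤ M := (norm_nonneg _).trans (h.bound 0 0)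
  obtain ⟨T, hT, -⟩ := exists_hasKernel_of_convolution_bound (k := k)
    (h := (Icc (-(2 * R)) (2 * R)).indicator fun _ => ENNReal.ofReal M)
    (A := M * volume.real (Icc (-(2 * R)) (2 * R))) h.measurable
    (measurable_const.indicator measurableSet_Icc) (by positivity) (fun x y => by
      by_cases h0 : k x y = 0
      · simp [h0]
      · obtain ⟨hx, hy⟩ := h.supp x y h0
        have hxy : x - y ∈ Icc (-(2 * R)) (2 * R) :=
          ⟨by linarith [hx.1, hy.2], by linarith [hx.2, hy.1]⟩
        rw [indicator_of_mem hxy, ← ofReal_norm]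
        exact ENNReal.ofReal_le_ofReal (h.bound x y)) (by
      rw [lintegral_indicator_const measurableSet_Icc, ENNReal.ofReal_mul hM,
        ofReal_measureReal isCompact_Icc.measure_ne_top])
  exact ⟨T, hT⟩

theorem integrable_indicator_norm (f : L2) :
    Integrable fun y => (Icc (-R) R).indicator 1 y * ‖f y‖ := by
  have h1 : MemLp ((Icc (-R) R).indicator (1 : ℝ → ℝ)) 2 volume :=
    memLp_indicator_const 2 measurableSet_Icc 1 (Or.inr (by simp))
  exact h1.integrable_mul (Lp.memLp f).norm

/-- The adjoint of an integral operator. -/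
theorem adjoint_eq (h : IsBoundedKernel M R k) {T T' : L2 →L[ℂ] L2} (hT : HasKernel T k)
    (hT' : HasKernel T' fun x y => (starRingEnd ℂ) (k y x)) :
    T' = ContinuousLinearMap.adjoint T := by
  rw [ContinuousLinearMap.eq_adjoint_iff]
  intro f g
  rw [L2.inner_def, L2.inner_def]
  have hfm : ∀ f : L2, Measurable f := fun f => (Lp.stronglyMeasurable f).measurable
  have hint : Integrable (fun p : ℝ × ℝ => (starRingEnd ℂ) (f p.1) * (k p.1 p.2 * g p.2))
      (volume.prod volume) := by
    refine (((integrable_indicator_norm (R := R) f).mul_prod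
      (integrable_indicator_norm (R := R) g)).const_mul M).mono' ?_ ?_
    · exact ((Complex.continuous_conj.measurable.comp ((hfm f).comp measurable_fst)).mul
        (h.measurable.mul ((hfm g).comp measurable_snd))).aestronglyMeasurable
    · refine Filter.Eventually.of_forall fun p => ?_
      rw [norm_mul, norm_mul, RCLike.norm_conj]
      calc _ ≤ ‖f p.1‖ * (M * ((Icc (-R) R).indicator 1 p.1 * (Icc (-R) R).indicator 1 p.2) *
            ‖g p.2‖) := by gcongr; exact h.norm_le_indicator _ _
        _ = _ := by ring
  calc ∫ x, inner ℂ (T' f x) (g x)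
      = ∫ y, ∫ x, (starRingEnd ℂ) (f x) * (k x y * g y) := by
        apply integral_congr_ae
        filter_upwards [hT' f] with y hy
        rw [hy.2, RCLike.inner_apply, ← integral_conj, ← integral_const_mul]
        congr 1; ext x
        simp only [map_mul, Complex.conj_conj]
        ring
    _ = ∫ x, ∫ y, (starRingEnd ℂ) (f x) * (k x y * g y) := (integral_integral_swap hint).symm
    _ = ∫ x, inner ℂ (f x) (T g x) := by
        apply integral_congr_ae
        filter_upwards [hT g] with x hx
        rw [hx.2, RCLike.inner_apply, integral_const_mul, mul_comm]

/-- The kernel of `T₁ T₂*`. -/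
theorem measurable_comp_adjoint (h₁ : IsBoundedKernel M R k₁) (h₂ : IsBoundedKernel M R k₂) :
    Measurable (Function.uncurry fun x z => ∫ y, k₁ x y * (starRingEnd ℂ) (k₂ z y)) := by
  refine (StronglyMeasurable.integral_prod_right'
      (f := fun p : (ℝ × ℝ) × ℝ => k₁ p.1.1 p.2 * (starRingEnd ℂ) (k₂ p.1.2 p.2)) ?_).measurable
  refine Measurable.stronglyMeasurable ?_
  have a1 : Measurable fun p : (ℝ × ℝ) × ℝ => (p.1.1, p.2) := by fun_prop
  have a2 : Measurable fun p : (ℝ × ℝ) × ℝ => (p.1.2, p.2) := by fun_prop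
  exact (h₁.measurable.comp a1).mul
    (Complex.continuous_conj.measurable.comp (h₂.measurable.comp a2))

/-- Fubini applies for every x because the kernels are bounded with bounded support and an L²
function is integrable on bounded sets. -/
theorem hasKernel_comp_adjoint (h₁ : IsBoundedKernel M R k₁) (h₂ : IsBoundedKernel M R k₂)
    {T₁ T₂ : L2 →L[ℂ] L2} (hT₁ : HasKernel T₁ k₁) (hT₂ : HasKernel T₂ k₂) :
    HasKernel (T₁ ∘L ContinuousLinearMap.adjoint T₂)
      fun x z => ∫ y, k₁ x y * (starRingEnd ℂ) (k₂ z y) := by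
  obtain ⟨T', hT'⟩ := h₂.flip_conj.exists_hasKernel
  rw [← h₂.adjoint_eq hT₂ hT']
  intro f
  have hfm : Measurable f := (Lp.stronglyMeasurable f).measurable
  have hM : 0 ≤ M := (norm_nonneg _).trans (h₁.bound 0 0)
  have hint : ∀ x, Integrable
      (fun p : ℝ × ℝ => k₁ x p.1 * ((starRingEnd ℂ) (k₂ p.2 p.1) * f p.2))
      (volume.prod volume) := by
    intro x
    have hi : Integrable ((Icc (-R) R).indicator (1 : ℝ → ℝ)) :=
      (integrable_indicator_iff measurableSet_Icc).2 (by
        exact integrableOn_const (by simp))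
    refine ((hi.mul_prod (integrable_indicator_norm (R := R) f)).const_mul (M * M)).mono' ?_ ?_
    · exact (((h₁.measurable.comp measurable_prodMk_left).comp measurable_fst).mul
        ((Complex.continuous_conj.measurable.comp (h₂.measurable.comp measurable_swap)).mul
          (hfm.comp measurable_snd))).aestronglyMeasurable
    · refine Filter.Eventually.of_forall fun p => ?_
      rw [norm_mul, norm_mul, RCLike.norm_conj]
      calc _ ≤ M * ((M * ((Icc (-R) R).indicator 1 p.2 * (Icc (-R) R).indicator 1 p.1)) *
            ‖f p.2‖) := by
            gcongr
            · exact h₁.bound _ _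
            · exact h₂.norm_le_indicator _ _
        _ = _ := by ring
  filter_upwards [hT₁ (T' f)] with x hx
  have e : ∀ z, (∫ y, k₁ x y * (starRingEnd ℂ) (k₂ z y)) * f z =
      ∫ y, k₁ x y * ((starRingEnd ℂ) (k₂ z y) * f z) := fun z => by
    rw [← integral_mul_const]; congr 1; ext y; ring
  simp only [e]
  refine ⟨(hint x).integral_prod_right, ?_⟩
  rw [ContinuousLinearMap.comp_apply, hx.2, ← integral_integral_swap (hint x)]
  apply integral_congr_ae
  filter_upwards [hT' f] with y hy
  rw [hy.2, ← integral_const_mul]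

/-- Schur's test yields some operator with the right kernel; uniqueness of kernels identifies it
with the product. -/
theorem norm_comp_adjoint_le (h₁ : IsBoundedKernel M R k₁) (h₂ : IsBoundedKernel M R k₂)
    {T₁ T₂ : L2 →L[ℂ] L2} (hT₁ : HasKernel T₁ k₁) (hT₂ : HasKernel T₂ k₂) {h : ℝ → ℝ≥0∞} {A : ℝ}
    (hh : Measurable h) (hA : 0 ≤ A)
    (hkh : ∀ x z, ‖∫ y, k₁ x y * (starRingEnd ℂ) (k₂ z y)‖ₑ ≤ h (x - z))
    (hI : ∫⁻ t, h t ≤ ENNReal.ofReal A) :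
    ‖T₁ ∘L ContinuousLinearMap.adjoint T₂‖ ≤ A := by
  obtain ⟨T, hT, hTA⟩ := exists_hasKernel_of_convolution_bound
    (measurable_comp_adjoint h₁ h₂) hh hA hkh hI
  rwa [(hasKernel_comp_adjoint h₁ h₂ hT₁ hT₂).unique hT]

end IsBoundedKernel

/-! ### Slices of S and the size of the phase derivative -/

theorem totalDegree_pderiv_le (i : Fin 2) (S : MvPolynomial (Fin 2) ℝ) :
    (MvPolynomial.pderiv i S).totalDegree ≤ S.totalDegree := by
  conv_lhs => rw [S.as_sum, map_sum]
  refine MvPolynomial.totalDegree_finsetSum_le fun m hm => ?_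
  rw [MvPolynomial.pderiv_monomial]
  refine (MvPolynomial.totalDegree_monomial_le _ _).trans
    (le_trans ?_ (MvPolynomial.le_totalDegree hm))
  exact Finsupp.degree_mono tsub_le_self

theorem hasDerivAt_eval_snd (S : MvPolynomial (Fin 2) ℝ) (x y : ℝ) :
    HasDerivAt (fun t => MvPolynomial.eval ![x, t] S)
      (MvPolynomial.eval ![x, y] (MvPolynomial.pderiv 1 S)) y := by
  induction S using MvPolynomial.induction_on with
  | C a => simpa using hasDerivAt_const y a
  | add p q hp hq => simp only [map_add]; exact hp.add hq
  | mul_X p i hp =>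
    have hX : HasDerivAt (fun t => (![x, t] : Fin 2 → ℝ) i)
        (MvPolynomial.eval ![x, y] (MvPolynomial.pderiv 1 (MvPolynomial.X i))) y := by
      fin_cases i
      · simpa [MvPolynomial.pderiv_X] using hasDerivAt_const y x
      · simpa [MvPolynomial.pderiv_X] using hasDerivAt_id' y
    have := hp.mul hX
    simp only [Derivation.leibniz, smul_eq_mul, map_add, map_mul, MvPolynomial.eval_X]
    refine this.congr_deriv ?_
    ring

theorem hasDerivAt_eval_fst (S : MvPolynomial (Fin 2) ℝ) (x y : ℝ) :
    HasDerivAt (fun t => MvPolynomial.eval ![t, y] S)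
      (MvPolynomial.eval ![x, y] (MvPolynomial.pderiv 0 S)) x := by
  induction S using MvPolynomial.induction_on with
  | C a => simpa using hasDerivAt_const x a
  | add p q hp hq => simp only [map_add]; exact hp.add hq
  | mul_X p i hp =>
    have hX : HasDerivAt (fun t => (![t, y] : Fin 2 → ℝ) i)
        (MvPolynomial.eval ![x, y] (MvPolynomial.pderiv 0 (MvPolynomial.X i))) x := by
      fin_cases i
      · simpa [MvPolynomial.pderiv_X] using hasDerivAt_id' x
      · simpa [MvPolynomial.pderiv_X] using hasDerivAt_const x y
    have := hp.mul hX
    simp only [Derivation.leibniz, smul_eq_mul, map_add, map_mul, MvPolynomial.eval_X]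
    refine this.congr_deriv ?_
    ring

open Polynomial in
/-- The polynomial `y ↦ S(x, y)`. -/
def slice (S : MvPolynomial (Fin 2) ℝ) (x : ℝ) : ℝ[X] := MvPolynomial.aeval ![C x, X] S

theorem eval_slice (S : MvPolynomial (Fin 2) ℝ) (x y : ℝ) :
    (slice S x).eval y = MvPolynomial.eval ![x, y] S := by
  induction S using MvPolynomial.induction_on with
  | C a => simp [slice]
  | add p q hp hq => simp only [slice, map_add, Polynomial.eval_add] at *; rw [hp, hq]
  | mul_X p i hp =>
    simp only [slice, map_mul, Polynomial.eval_mul, MvPolynomial.aeval_X, MvPolynomial.eval_X] at *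
    rw [hp]
    fin_cases i <;> simp

theorem natDegree_slice_le (S : MvPolynomial (Fin 2) ℝ) (x : ℝ) :
    (slice S x).natDegree ≤ S.totalDegree := by
  have := MvPolynomial.aeval_natDegree_le S (le_refl S.totalDegree)
    (![Polynomial.C x, Polynomial.X] : Fin 2 → Polynomial ℝ) (n := 1) (fun i => by
      fin_cases i <;> simp)
  simpa [slice] using this

theorem exists_slope_uIcc {G g : ℝ → ℝ} (hG : ∀ u, HasDerivAt G (g u) u) (a b : ℝ) :
    ∃ ξ ∈ uIcc a b, G b - G a = g ξ * (b - a) := by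
  have key : ∀ a b : ℝ, a < b → ∃ ξ ∈ Icc a b, G b - G a = g ξ * (b - a) := fun a b hab => by
    obtain ⟨ξ, hξ, h⟩ := exists_hasDerivAt_eq_slope G g hab
      (fun u _ => (hG u).continuousAt.continuousWithinAt) (fun u _ => hG u)
    refine ⟨ξ, Ioo_subset_Icc_self hξ, ?_⟩
    rw [h, div_mul_cancel₀ _ (sub_pos.2 hab).ne']
  rcases lt_trichotomy a b with h | h | h
  · rw [uIcc_of_lt h]; exact key a b h
  · subst h; exact ⟨a, by simp, by simp⟩
  · rw [uIcc_of_gt h]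
    obtain ⟨ξ, hξ, e⟩ := key b a h
    exact ⟨ξ, hξ, by linarith⟩

/-- Mean value theorem on the first twentieth of the segment and on the rest. The short piece alone
carries the lower bound; on the long one only the sign and the upper bound are known. -/
theorem slope_bounds_of_nonneg {G g : ℝ → ℝ} (hG : ∀ u, HasDerivAt G (g u) u) {x z ν M : ℝ}
    (h0 : ∀ u ∈ uIcc x z, 0 ≤ g u ∧ g u ≤ M)
    (h1 : ∀ u ∈ uIcc x (x + (z - x) / 20), ν ≤ g u) :
    ν * |x - z| / 20 ≤ |G x - G z| ∧ |G x - G z| ≤ M * |x - z| := by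
  have hw : x + (z - x) / 20 ∈ uIcc x z := by
    rw [mem_uIcc]
    rcases le_total x z with h | h
    · left; constructor <;> linarith
    · right; constructor <;> linarith
  obtain ⟨ξ, hξ, e1⟩ := exists_slope_uIcc hG x (x + (z - x) / 20)
  obtain ⟨η, hη, e2⟩ := exists_slope_uIcc hG (x + (z - x) / 20) z
  have hη' := h0 η (uIcc_subset_uIcc hw right_mem_uIcc hη)
  have hξ' := h0 ξ (uIcc_subset_uIcc left_mem_uIcc hw hξ)
  have hξ'' := h1 ξ hξ
  have e : G x - G z = (g ξ / 20 + 19 / 20 * g η) * (x - z) := by linear_combination -e1 - e2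
  have hp := abs_nonneg (x - z)
  rw [e, abs_mul, abs_of_nonneg (by linarith : 0 ≤ g ξ / 20 + 19 / 20 * g η)]
  constructor
  · rw [mul_div_right_comm]
    gcongr
    linarith
  · gcongr
    linarith

namespace HessCond

variable {S : MvPolynomial (Fin 2) ℝ} {A ν : ℝ} {Q₁ Q₂ : Box}

theorem mem_span {x z y u : ℝ} (hx : x ∈ Ioo Q₁.a Q₁.b) (hy₁ : y ∈ Ioo Q₁.c Q₁.d)
    (hz : z ∈ Ioo Q₂.a Q₂.b) (hy₂ : y ∈ Ioo Q₂.c Q₂.d) (hu : u ∈ uIcc x z) :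
    (u, y) ∈ Q₁.span Q₂ := by
  refine ⟨x, z, y, ⟨hx, hy₁⟩, ⟨hz, hy₂⟩, ?_⟩
  rw [← segment_eq_uIcc] at hu
  obtain ⟨a, b, ha, hb, hab, rfl⟩ := hu
  refine ⟨a, b, ha, hb, hab, ?_⟩
  ext
  · simp
  · simp [← add_mul, hab]

theorem _root_.DampedOsc.Ioo_subset_of_subset_star (h : Q₂.toSet ⊆ Q₁.star) :
    Ioo Q₂.a Q₂.b ⊆ Ioo (Q₁.a - (Q₁.b - Q₁.a)) (Q₁.b + (Q₁.b - Q₁.a)) ∧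
      Ioo Q₂.c Q₂.d ⊆ Ioo Q₁.c Q₁.d := by
  obtain ⟨x, hx⟩ := nonempty_Ioo.2 Q₂.hab
  obtain ⟨y, hy⟩ := nonempty_Ioo.2 Q₂.hcd
  exact ⟨fun z hz => (h (mk_mem_prod hz hy)).1, fun z hz => (h (mk_mem_prod hx hz)).2⟩

/-- On the span the sign of the Hessian is constant. -/
theorem exists_sign (h : HessCond S A ν Q₁ Q₂) : ∃ σ : ℝ, (σ = 1 ∨ σ = -1) ∧
    ∀ p ∈ Q₁.span Q₂, |hess S p.1 p.2| = σ * hess S p.1 p.2 := by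
  rcases h.sign with h | h
  · exact ⟨1, Or.inl rfl, fun p hp => by rw [abs_of_nonneg (h p hp), one_mul]⟩
  · exact ⟨-1, Or.inr rfl, fun p hp => by rw [abs_of_nonpos (h p hp), neg_one_mul]⟩

/-- The size of the derivative of the phase of `T₁ T₂*`. -/
theorem phase_bounds (h : HessCond S A ν Q₁ Q₂) (hsub : Q₂.toSet ⊆ Q₁.star)
    {x z y : ℝ} (hx : x ∈ Ioo Q₁.a Q₁.b) (hz : z ∈ Ioo Q₂.a Q₂.b) (hy : y ∈ Ioo Q₂.c Q₂.d) :
    ν * |x - z| / 20 ≤ |MvPolynomial.eval ![x, y] (MvPolynomial.pderiv 1 S) -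
        MvPolynomial.eval ![z, y] (MvPolynomial.pderiv 1 S)| ∧
      |MvPolynomial.eval ![x, y] (MvPolynomial.pderiv 1 S) -
        MvPolynomial.eval ![z, y] (MvPolynomial.pderiv 1 S)| ≤ A * ν * |x - z| := by
  obtain ⟨hs1, hs2⟩ := Ioo_subset_of_subset_star hsub
  have hy1 := hs2 hy
  have hz1 := hs1 hz
  obtain ⟨σ, hσ, hs⟩ := h.exists_sign
  have hspan : ∀ u ∈ uIcc x z, (u, y) ∈ Q₁.span Q₂ := fun u hu => mem_span hx hy1 hz hy hu
  have hw : x + (z - x) / 20 ∈ uIcc x z := by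
    rw [mem_uIcc]
    rcases le_total x z with h | h
    · left; constructor <;> linarith
    · right; constructor <;> linarith
  -- As z lies in the star box, |x - z| < 2(b₁ - a₁), so a twentieth of the segment moves x by at
  -- most a tenth of the side and stays in the enlarged box.
  have htil : ∀ u ∈ uIcc x (x + (z - x) / 20), (u, y) ∈ Q₁.tilde := by
    intro u hu
    have hd := abs_sub_left_of_mem_uIcc hu
    have hxz : |x + (z - x) / 20 - x| ≤ 1 / 10 * (Q₁.b - Q₁.a) := by
      rw [abs_le]; constructor <;> linarith [hx.1, hx.2, hz1.1, hz1.2]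
    have := abs_le.1 (hd.trans hxz)
    exact ⟨⟨by simp only; linarith [hx.1], by simp only; linarith [hx.2]⟩, hy1⟩
  have key := slope_bounds_of_nonneg
    (G := fun u => σ * MvPolynomial.eval ![u, y] (MvPolynomial.pderiv 1 S))
    (g := fun u => σ * hess S u y)
    (fun u => (hasDerivAt_eval_fst (MvPolynomial.pderiv 1 S) u y).const_mul σ) (x := x) (z := z)
    (ν := ν) (M := A * ν)
    (fun u hu => by
      have := hs _ (hspan u hu)
      have hb := h.upper_span _ (hspan u hu)
      simp only at this hb
      rw [← this]
      exact ⟨abs_nonneg _, hb⟩)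
    (fun u hu => by
      have := hs _ (hspan u (uIcc_subset_uIcc left_mem_uIcc hw hu))
      have hb := h.lower _ (htil u hu)
      simp only at this hb
      rwa [← this])
  have hσ1 : |σ| = 1 := by rcases hσ with rfl | rfl <;> simp
  simpa only [← mul_sub, abs_mul, hσ1, one_mul] using key

end HessCond

/-! ### Dyadic pieces of the singular kernel, and the amplitudes -/

theorem C2Bound.of_contDiffOn {s : Set ℝ} {u : ℝ → ℂ} {ℓ U : ℝ} (hs : IsOpen s)
    (hu : ContDiffOn ℝ 2 u s)
    (hb : ∀ i ≤ 2, ∀ y ∈ s, ‖iteratedDeriv i u y‖ * ℓ ^ i ≤ U) : C2Bound s ℓ U u := by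
  have h1 : ContDiffOn ℝ (1 + 1) u s := by simpa [one_add_one_eq_two] using hu
  rw [contDiffOn_succ_iff_deriv_of_isOpen hs] at h1
  obtain ⟨d1, -, h2⟩ := h1
  have h2' : ContDiffOn ℝ (0 + 1) (deriv u) s := by simpa using h2
  rw [contDiffOn_succ_iff_deriv_of_isOpen hs] at h2'
  obtain ⟨d2, -, h3⟩ := h2'
  refine ⟨deriv u, deriv (deriv u), fun y hy => ?_, fun y hy => ?_, h3.continuousOn,
    fun y hy => ⟨?_, ?_, ?_⟩⟩
  · exact (d1.differentiableAt (hs.mem_nhds hy)).hasDerivAt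
  · exact (d2.differentiableAt (hs.mem_nhds hy)).hasDerivAt
  · simpa using hb 0 (by norm_num) y hy
  · simpa using hb 1 (by norm_num) y hy
  · simpa [iteratedDeriv_succ] using hb 2 le_rfl y hy

/-- The derivatives witnessing the two bounds need not agree off their sets, so both are replaced by
`deriv`, which openness allows. -/
theorem C2Bound.union {s t : Set ℝ} {u : ℝ → ℂ} {ℓ U : ℝ} (hs : IsOpen s) (ht : IsOpen t)
    (h : C2Bound s ℓ U u) (h' : C2Bound t ℓ U u) : C2Bound (s ∪ t) ℓ U u := by
  have key : ∀ {s : Set ℝ}, IsOpen s → C2Bound s ℓ U u → ∀ y ∈ s,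
      HasDerivAt u (deriv u y) y ∧ HasDerivAt (deriv u) (deriv (deriv u) y) y ∧
      ContinuousAt (deriv (deriv u)) y ∧
      (‖u y‖ ≤ U ∧ ‖deriv u y‖ * ℓ ≤ U ∧ ‖deriv (deriv u) y‖ * ℓ ^ 2 ≤ U) := by
    intro s hs h
    obtain ⟨u₁, u₂, h1, h2, h3, h4⟩ := h
    have e1 : EqOn (deriv u) u₁ s := fun y hy => (h1 y hy).deriv
    have h2' : ∀ y ∈ s, HasDerivAt (deriv u) (u₂ y) y := fun y hy =>
      (h2 y hy).congr_of_eventuallyEq (e1.eventuallyEq_of_mem (hs.mem_nhds hy))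
    have e2 : EqOn (deriv (deriv u)) u₂ s := fun y hy => (h2' y hy).deriv
    intro y hy
    rw [e2 hy, e1 hy]
    exact ⟨h1 y hy, h2' y hy, (h3.congr e2).continuousAt (hs.mem_nhds hy), h4 y hy⟩
  have hall : ∀ y ∈ s ∪ t, _ := fun y hy => hy.elim (key hs h y) (key ht h' y)
  exact ⟨deriv u, deriv (deriv u), fun y hy => (hall y hy).1, fun y hy => (hall y hy).2.1,
    fun y hy => (hall y hy).2.2.1.continuousWithinAt, fun y hy => (hall y hy).2.2.2⟩

theorem C2Bound.zero {s : Set ℝ} {ℓ U : ℝ} (hU : 0 ≤ U) :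
    C2Bound s ℓ U (fun _ => (0 : ℂ)) :=
  ⟨fun _ => 0, fun _ => 0, fun y _ => hasDerivAt_const y 0, fun y _ => hasDerivAt_const y 0,
    continuousOn_const, fun y _ => by simpa using hU⟩

theorem C2Bound.comp_const_sub_div {u : ℝ → ℂ} {U r : ℝ} (h : C2Bound univ 1 U u) (hr : 0 < r)
    (x : ℝ) : C2Bound univ r U (fun y => u ((x - y) / r)) := by
  obtain ⟨u₁, u₂, h1, h2, h3, h4⟩ := h
  have hL : ∀ y, HasDerivAt (fun y : ℝ => (x - y) / r) (-1 / r) y := fun y =>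
    ((hasDerivAt_id y).const_sub x).div_const r
  have c2 : Continuous u₂ := continuousOn_univ.1 h3
  refine ⟨fun y => (-1 / r : ℝ) • u₁ ((x - y) / r),
    fun y => (-1 / r : ℝ) • ((-1 / r : ℝ) • u₂ ((x - y) / r)),
    fun y _ => (h1 _ (mem_univ _)).scomp y (hL y),
    fun y _ => ((h2 _ (mem_univ _)).scomp y (hL y)).const_smul (-1 / r : ℝ), ?_, fun y _ => ?_⟩
  · refine Continuous.continuousOn ?_
    have : Continuous fun y : ℝ => (x - y) / r := by fun_prop
    exact ((c2.comp this).const_smul (-1 / r : ℝ)).const_smul (-1 / r : ℝ)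
  · obtain ⟨b0, b1, b2⟩ := h4 ((x - y) / r) (mem_univ _)
    have e : ‖(-1 / r : ℝ)‖ = 1 / r := by
      rw [norm_div, norm_neg, norm_one, Real.norm_eq_abs, abs_of_pos hr]
    refine ⟨b0, ?_, ?_⟩
    · rw [norm_smul, e]; field_simp; simpa using b1
    · rw [norm_smul, norm_smul, e]; field_simp; simpa using b2

/-- The dyadic piece `φ(t/2) - φ(t)` of a cut-off. -/
def annulus (φ : ℝ → ℝ) (t : ℝ) : ℝ := φ (t / 2) - φ t

namespace IsCutoff

variable {φ : ℝ → ℝ}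

theorem annulus_eq_zero (h : IsCutoff φ) {t : ℝ} (ht : |t| ≤ 1 / 2 ∨ 2 ≤ |t|) :
    annulus φ t = 0 := by
  have e : |t / 2| = |t| / 2 := by rw [abs_div, abs_two]
  rcases ht with ht | ht
  · rw [annulus, h.eq_one t ht, h.eq_one (t / 2) (by rw [e]; linarith), sub_self]
  · rw [annulus, h.eq_zero t (by linarith), h.eq_zero (t / 2) (by rw [e]; linarith), sub_self]

theorem exists_annulus_C2Bound (h : IsCutoff φ) :
    ∃ C : ℝ, 1 ≤ C ∧ C2Bound univ 1 C (fun t => (annulus φ t : ℂ)) := by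
  have hs : ContDiff ℝ 2 (fun t => (annulus φ t : ℂ)) := by
    have h2 : ContDiff ℝ 2 φ := contDiff_infty.1 h.smooth 2
    have : ContDiff ℝ 2 (annulus φ) := (h2.comp (contDiff_id.div_const 2)).sub h2
    exact Complex.ofRealCLM.contDiff.comp this
  have hb : ∀ i : ℕ, ∃ b : ℝ, 0 ≤ b ∧ (i ≤ 2 → ∀ t,
      ‖iteratedDeriv i (fun t => (annulus φ t : ℂ)) t‖ ≤ b) := by
    intro i
    by_cases hi : i ≤ 2
    · have hc : Continuous (iteratedDeriv i (fun t => (annulus φ t : ℂ))) :=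
        hs.continuous_iteratedDeriv i (by exact_mod_cast hi)
      obtain ⟨b, hb⟩ := (isCompact_Icc (a := (-3 : ℝ)) (b := 3)).exists_bound_of_continuousOn
        hc.continuousOn
      have hb0 : 0 ≤ b := (norm_nonneg _).trans (hb 0 (by norm_num))
      refine ⟨b, hb0, fun _ t => ?_⟩
      by_cases ht : t ∈ Icc (-3 : ℝ) 3
      · exact hb t ht
      · have hz : (fun t => (annulus φ t : ℂ)) =ᶠ[nhds t] fun _ => 0 := by
          have : 2 < |t| := by
            by_contra! hcon
            have := abs_le.1 hcon
            exact ht ⟨by linarith, by linarith⟩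
          filter_upwards [(isOpen_lt continuous_const continuous_abs).mem_nhds this] with w hw
          rw [h.annulus_eq_zero (Or.inr (le_of_lt hw)), Complex.ofReal_zero]
        rw [hz.iteratedDeriv_eq i]
        simpa [iteratedDeriv_const] using hb0
    · exact ⟨0, le_rfl, fun h => absurd h hi⟩
  choose b hb0 hb using hb
  refine ⟨1 + b 0 + b 1 + b 2, by linarith [hb0 0, hb0 1, hb0 2],
    C2Bound.of_contDiffOn isOpen_univ hs.contDiffOn fun i hi y _ => ?_⟩
  rw [one_pow, mul_one]
  refine (hb i hi y).trans ?_
  interval_cases i <;> linarith [hb0 0, hb0 1, hb0 2]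

theorem sum_annulus (h : IsCutoff φ) (J : ℕ) {t : ℝ} (ht : |t| ≤ 2 ^ J / 2) :
    ∑ j ∈ Finset.range J, annulus φ (t / 2 ^ j) = 1 - φ t := by
  have : ∀ J : ℕ, ∑ j ∈ Finset.range J, annulus φ (t / 2 ^ j) = φ (t / 2 ^ J) - φ t := by
    intro J
    induction J with
    | zero => simp
    | succ J ih =>
      rw [Finset.sum_range_succ, ih, annulus, pow_succ, div_div]
      ring
  rw [this, h.eq_one]
  rw [abs_div, abs_of_pos (by positivity : (0 : ℝ) < 2 ^ J), div_le_iff₀ (by positivity)]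
  linarith

end IsCutoff

/-- The part of the kernel living at distance `∼ r` from the diagonal. -/
def dyadicKernel (φ : ℝ → ℝ) (K : ℝ → ℝ → ℂ) (r x y : ℝ) : ℂ :=
  (annulus φ ((x - y) / r) : ℂ) * K x y

theorem dyadicKernel_eq_zero {φ : ℝ → ℝ} (hφ : IsCutoff φ) {K : ℝ → ℝ → ℂ} {r x y : ℝ}
    (hr : 0 < r) (h : y ∉ Icc (x - 2 * r) (x + 2 * r)) : dyadicKernel φ K r x y = 0 := by
  rw [dyadicKernel, hφ.annulus_eq_zero, Complex.ofReal_zero, zero_mul]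
  right
  rw [abs_div, abs_of_pos hr, le_div_iff₀ hr]
  by_contra! hcon
  have := abs_lt.1 hcon
  exact h ⟨by linarith, by linarith⟩

theorem exists_dyadicKernel_C2Bound {φ : ℝ → ℝ} (hφ : IsCutoff φ) {E μ : ℝ} (hE : 0 ≤ E)
    (hμ0 : 0 < μ) (hμ1 : μ < 1) : ∃ C : ℝ, 1 ≤ C ∧ ∀ K : ℝ → ℝ → ℂ, IsSingularKernel E μ K →
      ∀ r : ℝ, 0 < r → ∀ x : ℝ, C2Bound univ r (C * r ^ (-μ)) (dyadicKernel φ K r x) := by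
  obtain ⟨C, hC, hχ⟩ := hφ.exists_annulus_C2Bound
  refine ⟨1 + 4 * C * (64 * E), by nlinarith [mul_nonneg (by linarith : 0 ≤ C) hE], ?_⟩
  intro K hK r hr x
  -- Two overlapping open sets cover the line: on `s` the hypothesis on K applies at distance
  -- comparable to r, and on `t`, which contains the diagonal point, the annular cut-off is
  -- identically zero.
  set s : Set ℝ := {y | r / 4 < |x - y|} with hs
  set t : Set ℝ := {y | |x - y| < r / 2} with ht
  have hso : IsOpen s := isOpen_lt continuous_const (by fun_prop)
  have hto : IsOpen t := isOpen_lt (by fun_prop) continuous_const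
  have hst : s ∪ t = univ := by
    ext y
    simp only [hs, ht, mem_union, mem_ofPred_eq, mem_univ, iff_true]
    by_contra! hcon
    linarith
  have hrμ : 0 < r ^ (-μ) := Real.rpow_pos_of_pos hr _
  have hKs : C2Bound s r (64 * E * r ^ (-μ)) (K x) := by
    refine C2Bound.of_contDiffOn hso ?_ ?_
    · refine hK.contDiffOn.comp (contDiff_prodMk_right x).contDiffOn fun y hy => ?_
      have : 0 < |x - y| := lt_trans (by positivity) hy
      exact sub_ne_zero.1 (abs_pos.1 this)
    · intro i hi y hy
      have hxy : r / 4 < |x - y| := hy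
      have hne : x ≠ y := sub_ne_zero.1 (abs_pos.1 (lt_trans (by positivity) hxy))
      have hi2 : (i : ℝ) ≤ 2 := by exact_mod_cast hi
      have hi0 : (0 : ℝ) ≤ i := by positivity
      have h1 : |x - y| ^ (-μ - (i : ℝ)) ≤ (r / 4) ^ (-μ - (i : ℝ)) :=
        Real.rpow_le_rpow_of_nonpos (by positivity) hxy.le (by linarith)
      -- The value 64 = 4³ covers 4^{μ+i}, because μ + i < 3.
      have h2 : (r / 4) ^ (-μ - (i : ℝ)) * r ^ i ≤ 64 * r ^ (-μ) := by
        have e : (r / 4) ^ (-μ - (i : ℝ)) * r ^ i = (4 : ℝ) ^ (μ + i) * r ^ (-μ) := by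
          rw [div_eq_mul_inv, Real.mul_rpow hr.le (by norm_num), Real.inv_rpow (by norm_num),
            ← Real.rpow_neg (by norm_num), ← Real.rpow_natCast r i]
          rw [mul_right_comm, ← Real.rpow_add hr, mul_comm]
          congr 2 <;> ring
        rw [e]
        gcongr
        calc (4 : ℝ) ^ (μ + i) ≤ (4 : ℝ) ^ (3 : ℝ) :=
              Real.rpow_le_rpow_of_exponent_le (by norm_num) (by linarith)
          _ = 64 := by norm_num
      calc _ ≤ (E * |x - y| ^ (-μ - (i : ℝ))) * r ^ i := by
            gcongr; exact hK.bound i hi x y hne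
        _ ≤ (E * (r / 4) ^ (-μ - (i : ℝ))) * r ^ i := by gcongr
        _ = E * ((r / 4) ^ (-μ - (i : ℝ)) * r ^ i) := by ring
        _ ≤ E * (64 * r ^ (-μ)) := by gcongr
        _ = _ := by ring
  rw [← hst]
  refine C2Bound.union hso hto ?_ ?_
  · refine ((((hχ.comp_const_sub_div hr x).mono_set (subset_univ s)).mul hKs hr.le).mono hr.le
      le_rfl ?_)
    nlinarith
  · refine (C2Bound.zero (by positivity)).congr hto fun y hy => ?_
    have hy' : |x - y| < r / 2 := hy
    simp only [dyadicKernel]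
    rw [hφ.annulus_eq_zero, Complex.ofReal_zero, zero_mul]
    left
    rw [abs_div, abs_of_pos hr, div_le_iff₀ hr]
    linarith

namespace IsAmplitude

variable {B : ℝ} {Q : Box} {ψ : ℝ → ℝ → ℂ}

theorem C2Bound_slice (h : IsAmplitude B Q ψ) (x : ℝ) : C2Bound univ Q.rho B (ψ x) := by
  have hρ : 0 < Q.rho := sub_pos.2 Q.hcd
  refine C2Bound.of_contDiffOn isOpen_univ ?_ fun i hi y _ => ?_
  · exact ((contDiff_infty.1 h.smooth 2).comp (contDiff_prodMk_right x)).contDiffOn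
  · refine le_trans ?_ (h.bound x y)
    rw [mul_comm]
    exact Finset.single_le_sum (f := fun k => Q.rho ^ k * ‖iteratedDeriv k (fun t => ψ x t) y‖)
      (fun k _ => by positivity) (Finset.mem_range.2 (by omega))

theorem mem_of_ne_zero (h : IsAmplitude B Q ψ) {x y : ℝ} (hxy : ψ x y ≠ 0) :
    x ∈ Ioo Q.a Q.b ∧ y ∈ Ioo Q.c Q.d :=
  h.supp (subset_tsupport (fun p : ℝ × ℝ => ψ p.1 p.2) (show (x, y) ∈ _ from hxy))

/-- The projection of the compact support is a compact subset of (c, d), so one closed interval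
serves all x; integrals over it have no boundary terms. -/
theorem exists_Icc (h : IsAmplitude B Q ψ) : ∃ c' d' : ℝ, Q.c < c' ∧ c' ≤ d' ∧ d' < Q.d ∧
    ∀ x y, y ∉ Icc c' d' → ψ x y = 0 := by
  set T := Prod.snd '' tsupport (fun p : ℝ × ℝ => ψ p.1 p.2) with hT
  have hTc : IsCompact T := h.compact.isCompact.image continuous_snd
  have hTs : T ⊆ Ioo Q.c Q.d := by
    rintro _ ⟨p, hp, rfl⟩; exact (h.supp hp).2
  have hmem : ∀ x y, ψ x y ≠ 0 → y ∈ T := fun x y hxy =>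
    ⟨(x, y), subset_tsupport _ hxy, rfl⟩
  rcases T.eq_empty_or_nonempty with he | hne
  · have := Q.hcd
    refine ⟨(Q.c + Q.d) / 2, (Q.c + Q.d) / 2, by linarith, le_rfl, by linarith, fun x y _ => ?_⟩
    by_contra hxy
    have := hmem x y hxy
    rw [he] at this
    exact this
  · obtain ⟨a, haT, ha⟩ := hTc.exists_isLeast hne
    obtain ⟨b, hbT, hb⟩ := hTc.exists_isGreatest hne
    refine ⟨a, b, (hTs haT).1, ha hbT, (hTs hbT).2, fun x y hy => ?_⟩
    by_contra hxy
    exact hy ⟨ha (hmem x y hxy), hb (hmem x y hxy)⟩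

end IsAmplitude

/-! ### The pairing of two dyadic pieces -/

open Polynomial in
-- The integral J is bounded trivially by a multiple of ℓ, and J(λmℓ)² by a multiple of ℓ through
-- oscillation; adding the two gives the weight. The factor √p is smooth since p is comparable to ν,
-- so only √q needs the variation bounds.
theorem exists_damped_integral_bound (n : ℕ) {A : ℝ} (hA : 1 ≤ A) : ∃ C : ℝ, 1 ≤ C ∧
    ∀ p q P : ℝ[X], p.natDegree ≤ n → q.natDegree ≤ n → P.natDegree ≤ n →
    ∀ c d α β ℓ lam ν s m U : ℝ, ∀ Φ : ℝ → ℝ, ∀ w : ℝ → ℂ,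
    c < α → α ≤ β → β < d → 0 < ℓ → ℓ ≤ d - c → β - α ≤ 4 * ℓ → 0 < lam → 0 < ν → 0 ≤ m →
    (∀ y ∈ Ioo c d, ν ≤ p.eval y ∧ p.eval y ≤ A * ν) →
    (∀ y ∈ Ioo c d, 0 ≤ q.eval y ∧ q.eval y ≤ s) →
    (∀ y ∈ Ioo c d, m / 20 ≤ |P.eval y| ∧ |P.eval y| ≤ A * m) →
    (∀ y ∈ Ioo c d, HasDerivAt Φ (lam * P.eval y) y) → C2Bound (Ioo c d) ℓ U w →
    (∀ y, y ∉ Icc α β → w y = 0) →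
    ‖∫ y in α..β, Complex.exp (Complex.I * (Φ y : ℂ)) *
        ((√(p.eval y) : ℝ) * w y * (√(q.eval y) : ℝ))‖ ≤
      C * U * (√ν * √s) * (ℓ * (1 + (lam * m * ℓ) ^ 2)⁻¹) := by
  obtain ⟨C₀, hC₀, hpoly⟩ := exists_polynomial_C2Bound n
  obtain ⟨C₁, hC₁, hosc⟩ := exists_oscillatory_bound n
  have hCA : 1 ≤ C₀ * A := by nlinarith
  -- `C2Bound.sqrt` contributes (C₀A)², and the product with `w` contributes 4.
  set D := 4 * (C₀ * A) ^ 2 with hD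
  -- From `C2Bound.inv` with lower bound λm/20 and ratio 20C₀A, so that the reciprocal of the phase
  -- derivative is bounded by κ/(λm).
  set κ := 3 * (20 * C₀ * A) ^ 2 * 20 with hκ
  have hD1 : 1 ≤ D := by rw [hD]; nlinarith
  have hκ0 : 0 ≤ κ := by positivity
  refine ⟨(4 + C₁ * κ ^ 2) * D, ?_, ?_⟩
  · nlinarith [mul_nonneg (by linarith : 0 ≤ C₁) (sq_nonneg κ)]
  intro p q P hp hq hP c d α β ℓ lam ν s m U Φ w hcα hαβ hβd hℓ hℓd hlen hlam hν hm hpb hqb hPb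
    hΦ hw hw0
  have hcd : c < d := by linarith
  have hd : 0 < d - c := by linarith
  have hsub : Icc α β ⊆ Ioo c d := fun y hy => ⟨by linarith [hy.1], by linarith [hy.2]⟩
  have hss : 0 ≤ √s := Real.sqrt_nonneg s
  have hsν : 0 < √ν := Real.sqrt_pos.2 hν
  have hU : 0 ≤ U := by
    obtain ⟨w₁, w₂, -, -, -, hb⟩ := hw
    exact (norm_nonneg _).trans (hb α (hsub ⟨le_rfl, hαβ⟩)).1
  obtain ⟨-, -, jp⟩ := hpoly p hp c d (A * ν) hcd fun y hy => by
    rw [abs_of_nonneg (hν.le.trans (hpb y hy).1)]; exact (hpb y hy).2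
  rw [← mul_assoc] at jp
  have js := (jp.sqrt hCA hν hd.le fun y hy => (hpb y hy).1).mono hℓ.le hℓd le_rfl
  have ju : C2Bound (Ioo c d) ℓ (D * √ν * U) (fun y => ((√(p.eval y) : ℝ) : ℂ) * w y) :=
    (js.ofReal.mul hw hℓ.le).mono hℓ.le le_rfl (by rw [hD]; linarith)
  have hu0 : ∀ y, y ∉ Icc α β → ((√(p.eval y) : ℝ) : ℂ) * w y = 0 := fun y hy => by
    rw [hw0 y hy, mul_zero]
  set J := ‖∫ y in α..β, Complex.exp (Complex.I * (Φ y : ℂ)) *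
        ((√(p.eval y) : ℝ) * w y * (√(q.eval y) : ℝ))‖ with hJ
  have triv : J ≤ D * √ν * U * √s * (4 * ℓ) := by
    have hW : ∀ y ∈ Ioo c d, ‖((√(p.eval y) : ℝ) : ℂ) * w y‖ ≤ D * √ν * U := by
      obtain ⟨u₁, u₂, -, -, -, hb⟩ := ju
      exact fun y hy => (hb y hy).1
    refine (intervalIntegral.norm_integral_le_of_norm_le_const
      (C := D * √ν * U * √s) fun y hy => ?_).trans ?_
    · rw [uIoc_of_le hαβ] at hy
      have hy' := hsub (Ioc_subset_Icc_self hy)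
      rw [norm_mul, mul_comm Complex.I, Complex.norm_exp_ofReal_mul_I, one_mul, norm_mul]
      refine mul_le_mul (hW y hy') ?_ (norm_nonneg _) (by positivity)
      rw [Complex.norm_real, Real.norm_eq_abs, abs_of_nonneg (Real.sqrt_nonneg _)]
      exact Real.sqrt_le_sqrt (hqb y hy').2
    · rw [abs_of_nonneg (by linarith)]
      gcongr
  have osc : J * ℓ * (lam * m) ^ 2 ≤ C₁ * κ ^ 2 * (D * √ν * U) * √s := by
    -- The case m = 0 is x = z in the application: there is no oscillation and nothing to prove.
    rcases hm.eq_or_lt with rfl | hm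
    · rw [mul_zero, zero_pow two_ne_zero, mul_zero]; positivity
    · have hlm : 0 < lam * m := by positivity
      obtain ⟨-, -, jP⟩ := hpoly (Polynomial.C lam * P) ((natDegree_C_mul_le _ _).trans hP) c d
        (A * (lam * m)) hcd fun y hy => by
          rw [eval_mul, eval_C, abs_mul, abs_of_pos hlam]
          nlinarith [(hPb y hy).2]
      have e : C₀ * (A * (lam * m)) = (20 * C₀ * A) * (lam * m / 20) := by ring
      rw [e] at jP
      have hPlow : ∀ y ∈ Ioo c d, lam * m / 20 ≤ |(Polynomial.C lam * P).eval y| := fun y hy => by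
        rw [eval_mul, eval_C, abs_mul, abs_of_pos hlam]
        nlinarith [(hPb y hy).1]
      have jg := (jP.inv (by nlinarith) (by positivity) hd.le hPlow).mono hℓ.le hℓd le_rfl
      have := hosc q hq c d s α β ℓ _ _ Φ (fun y => (Polynomial.C lam * P).eval y) _ _ hqb hcα hαβ
        hβd hℓ hlen (fun y hy => by simpa using hΦ y hy)
        (Polynomial.continuous _).continuousOn (fun y hy => mul_inv_cancel₀
          (abs_pos.1 (lt_of_lt_of_le (by positivity) (hPlow y hy)))) jg ju hu0
      have eκ : 3 * (20 * C₀ * A) ^ 2 / (lam * m / 20) = κ / (lam * m) := by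
        rw [hκ]; field_simp
      rw [eκ] at this
      calc J * ℓ * (lam * m) ^ 2 ≤
            (C₁ * (κ / (lam * m)) ^ 2 * (D * √ν * U) * √s) * (lam * m) ^ 2 := by gcongr
        _ = _ := by field_simp
  have hpos : 0 < 1 + (lam * m * ℓ) ^ 2 := by positivity
  rw [← div_eq_mul_inv, ← mul_div_assoc, le_div_iff₀ hpos]
  have := mul_le_mul_of_nonneg_right osc hℓ.le
  calc J * (1 + (lam * m * ℓ) ^ 2) = J + J * ℓ * (lam * m) ^ 2 * ℓ := by ring
    _ ≤ D * √ν * U * √s * (4 * ℓ) + C₁ * κ ^ 2 * (D * √ν * U) * √s * ℓ := add_le_add triv this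
    _ = _ := by ring

/-- The dyadic pieces of the kernel of the damped operator. -/
def dyadicDampedKernel (φ : ℝ → ℝ) (lam : ℝ) (S : MvPolynomial (Fin 2) ℝ)
    (K ψ : ℝ → ℝ → ℂ) (r x y : ℝ) : ℂ :=
  Complex.exp (Complex.I * ((lam * val S x y : ℝ) : ℂ)) * ((√|hess S x y| : ℝ) : ℂ) *
    dyadicKernel φ K r x y * ψ x y

theorem continuous_val (S : MvPolynomial (Fin 2) ℝ) : Continuous fun p : ℝ × ℝ => val S p.1 p.2 :=
  (MvPolynomial.continuous_eval S).comp (by fun_prop)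

theorem continuous_val_right (S : MvPolynomial (Fin 2) ℝ) (x : ℝ) :
    Continuous fun y => val S x y :=
  (MvPolynomial.continuous_eval S).comp (f := fun y : ℝ => ![x, y]) (by fun_prop)

theorem continuous_hess_right (S : MvPolynomial (Fin 2) ℝ) (x : ℝ) :
    Continuous fun y => hess S x y :=
  (MvPolynomial.continuous_eval _).comp (f := fun y : ℝ => ![x, y]) (by fun_prop)

theorem hasDerivAt_val_right (S : MvPolynomial (Fin 2) ℝ) (x y : ℝ) :
    HasDerivAt (fun t => val S x t) (MvPolynomial.eval ![x, y] (MvPolynomial.pderiv 1 S)) y :=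
  hasDerivAt_eval_snd S x y

theorem continuous_hess (S : MvPolynomial (Fin 2) ℝ) :
    Continuous fun p : ℝ × ℝ => hess S p.1 p.2 :=
  (MvPolynomial.continuous_eval _).comp (by fun_prop)

theorem C2Bound.continuous {u : ℝ → ℂ} {ℓ U : ℝ} (h : C2Bound univ ℓ U u) : Continuous u := by
  obtain ⟨u₁, -, h1, -⟩ := h
  exact continuous_iff_continuousAt.2 fun y => (h1 y (mem_univ y)).continuousAt

/-- The amplitude of the pairing of two dyadic pieces, without the factors coming from `S`. -/
def pairingAmplitude (φ : ℝ → ℝ) (K ψ₁ ψ₂ : ℝ → ℝ → ℂ) (r r' x z y : ℝ) : ℂ :=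
  dyadicKernel φ K r x y * (starRingEnd ℂ) (dyadicKernel φ K r' z y) * ψ₁ x y *
    (starRingEnd ℂ) (ψ₂ z y)

theorem dyadicDampedKernel_mul_conj (φ : ℝ → ℝ) (lam : ℝ) (S : MvPolynomial (Fin 2) ℝ)
    (K ψ₁ ψ₂ : ℝ → ℝ → ℂ) (r r' x z y : ℝ) :
    dyadicDampedKernel φ lam S K ψ₁ r x y *
      (starRingEnd ℂ) (dyadicDampedKernel φ lam S K ψ₂ r' z y) =
    Complex.exp (Complex.I * ((lam * (val S x y - val S z y) : ℝ) : ℂ)) *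
      (((√|hess S x y| : ℝ) : ℂ) * pairingAmplitude φ K ψ₁ ψ₂ r r' x z y *
        ((√|hess S z y| : ℝ) : ℂ)) := by
  have e : Complex.exp (Complex.I * ((lam * (val S x y - val S z y) : ℝ) : ℂ)) =
      Complex.exp (Complex.I * ((lam * val S x y : ℝ) : ℂ)) *
      (starRingEnd ℂ) (Complex.exp (Complex.I * ((lam * val S z y : ℝ) : ℂ))) := by
    rw [← Complex.exp_conj, ← Complex.exp_add, map_mul, Complex.conj_I, Complex.conj_ofReal]
    congr 1
    push_cast
    ring
  rw [e]
  simp only [pairingAmplitude, dyadicDampedKernel, map_mul, Complex.conj_ofReal]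
  ring

/-- The support lies within 2r of x, within 2r' of z, and in the interval carrying ψ₂: three length
bounds, each at most four times the corresponding entry of the minimum. -/
theorem exists_pairingAmplitude_support {φ : ℝ → ℝ} (hφ : IsCutoff φ) (K : ℝ → ℝ → ℂ)
    {B : ℝ} {Q : Box} (ψ₁ : ℝ → ℝ → ℂ) {ψ₂ : ℝ → ℝ → ℂ} (hψ₂ : IsAmplitude B Q ψ₂)
    {r r' : ℝ} (hr : 0 < r) (hr' : 0 < r') (x z : ℝ) :
    ∃ α β : ℝ, Q.c < α ∧ α ≤ β ∧ β < Q.d ∧ β - α ≤ 4 * min (min r r') Q.rho ∧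
      ∀ y, y ∉ Icc α β → pairingAmplitude φ K ψ₁ ψ₂ r r' x z y = 0 := by
  obtain ⟨c', d', h1, h2, h3, h4⟩ := hψ₂.exists_Icc
  have hρ : Q.rho = Q.d - Q.c := rfl
  set α := max c' (max (x - 2 * r) (z - 2 * r'))
  set β := min d' (min (x + 2 * r) (z + 2 * r'))
  have hzero : ∀ y, y ∉ Icc α β → pairingAmplitude φ K ψ₁ ψ₂ r r' x z y = 0 := by
    intro y hy
    by_contra hne
    apply hy
    have hy1 : y ∈ Icc (x - 2 * r) (x + 2 * r) := by
      by_contra hn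
      exact hne (by rw [pairingAmplitude, dyadicKernel_eq_zero hφ hr hn]; simp)
    have hy2 : y ∈ Icc (z - 2 * r') (z + 2 * r') := by
      by_contra hn
      exact hne (by rw [pairingAmplitude, dyadicKernel_eq_zero hφ hr' hn]; simp)
    have hy3 : y ∈ Icc c' d' := by
      by_contra hn
      exact hne (by rw [pairingAmplitude, h4 z y hn]; simp)
    exact ⟨max_le hy3.1 (max_le hy1.1 hy2.1), le_min hy3.2 (le_min hy1.2 hy2.2)⟩
  by_cases hle : α ≤ β
  · have a1 : c' ≤ α := le_max_left _ _
    have a2 : x - 2 * r ≤ α := (le_max_left _ _).trans (le_max_right _ _)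
    have a3 : z - 2 * r' ≤ α := (le_max_right _ _).trans (le_max_right _ _)
    have b1 : β ≤ d' := min_le_left _ _
    have b2 : β ≤ x + 2 * r := (min_le_right _ _).trans (min_le_left _ _)
    have b3 : β ≤ z + 2 * r' := (min_le_right _ _).trans (min_le_right _ _)
    refine ⟨α, β, by linarith, hle, by linarith, ?_, hzero⟩
    have : (β - α) / 4 ≤ min (min r r') Q.rho :=
      le_min (le_min (by linarith) (by linarith)) (by rw [hρ]; linarith)
    linarith
  -- The constraints are incompatible and the amplitude vanishes identically; a one-point interval
  -- serves.
  · have hℓ : 0 < min (min r r') Q.rho := lt_min (lt_min hr hr') (by rw [hρ]; linarith [Q.hcd])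
    refine ⟨c', c', h1, le_rfl, by linarith, by linarith, fun y _ => hzero y ?_⟩
    rw [Icc_eq_empty hle]; simp

theorem exists_pairingAmplitude_C2Bound {φ : ℝ → ℝ} (hφ : IsCutoff φ) {E B μ : ℝ}
    (hE : 0 ≤ E) (hμ0 : 0 < μ) (hμ1 : μ < 1) : ∃ C : ℝ, 0 ≤ C ∧
    ∀ (K ψ₁ ψ₂ : ℝ → ℝ → ℂ) (B₁ B₂ : Box), IsSingularKernel E μ K → IsAmplitude B B₁ ψ₁ →
      IsAmplitude B B₂ ψ₂ → B₂.rho ≤ B₁.rho → ∀ r r' x z : ℝ, 0 < r → 0 < r' →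
      C2Bound univ (min (min r r') B₂.rho) (C * (r ^ (-μ) * r' ^ (-μ)))
        (pairingAmplitude φ K ψ₁ ψ₂ r r' x z) := by
  obtain ⟨C, hC, hK⟩ := exists_dyadicKernel_C2Bound hφ hE hμ0 hμ1
  -- Three products cost 4³ = 64. The scale ρ₂ is admissible for ψ₁ too, because ρ₂ ≤ ρ₁.
  refine ⟨64 * C ^ 2 * B ^ 2, by positivity, ?_⟩
  intro K ψ₁ ψ₂ B₁ B₂ hKs hψ₁ hψ₂ hρ r r' x z hr hr'
  have hρ0 : 0 < B₂.rho := sub_pos.2 B₂.hcd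
  have hℓ : 0 ≤ min (min r r') B₂.rho := (lt_min (lt_min hr hr') hρ0).le
  have hℓρ : min (min r r') B₂.rho ≤ B₂.rho := min_le_right _ _
  have j1 := (hK K hKs r hr x).mono hℓ ((min_le_left _ _).trans (min_le_left _ _)) le_rfl
  have j2 := (hK K hKs r' hr' z).conj.mono hℓ ((min_le_left _ _).trans (min_le_right _ _)) le_rfl
  have j3 := (hψ₁.C2Bound_slice x).mono hℓ (hℓρ.trans hρ) le_rfl
  have j4 := (hψ₂.C2Bound_slice z).conj.mono hℓ hℓρ le_rfl
  exact (((j1.mul j2 hℓ).mul j3 hℓ).mul j4 hℓ).mono hℓ le_rfl (le_of_eq (by ring))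

theorem continuous_dyadicDampedKernel_mul_conj {φ : ℝ → ℝ} {lam : ℝ}
    {S : MvPolynomial (Fin 2) ℝ} {K ψ₁ ψ₂ : ℝ → ℝ → ℂ} {r r' x z : ℝ}
    (h : Continuous (pairingAmplitude φ K ψ₁ ψ₂ r r' x z)) :
    Continuous fun y => dyadicDampedKernel φ lam S K ψ₁ r x y *
      (starRingEnd ℂ) (dyadicDampedKernel φ lam S K ψ₂ r' z y) := by
  simp only [dyadicDampedKernel_mul_conj]
  have c1 : Continuous fun y => ((lam * (val S x y - val S z y) : ℝ) : ℂ) :=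
    Complex.continuous_ofReal.comp (continuous_const.mul ((continuous_val_right S x).sub (continuous_val_right S z)))
  have c2 : ∀ u, Continuous fun y => ((√|hess S u y| : ℝ) : ℂ) := fun u =>
    Complex.continuous_ofReal.comp (Real.continuous_sqrt.comp (continuous_hess_right S u).abs)
  exact (Complex.continuous_exp.comp (continuous_const.mul c1)).mul (((c2 x).mul h).mul (c2 z))

theorem exists_dyadic_pairing_bound {φ : ℝ → ℝ} (hφ : IsCutoff φ) (n : ℕ) {E A B μ : ℝ}
    (hE : 0 ≤ E) (hA : 1 ≤ A) (hμ0 : 0 < μ) (hμ1 : μ < 1) : ∃ C : ℝ, 0 ≤ C ∧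
    ∀ (lam : ℝ) (S : MvPolynomial (Fin 2) ℝ) (K : ℝ → ℝ → ℂ) (ν : ℝ) (B₁ B₂ : Box)
      (ψ₁ ψ₂ : ℝ → ℝ → ℂ), 0 < lam → S.totalDegree ≤ n → IsSingularKernel E μ K → 0 < ν →
      HessCond S A ν B₁ B₂ → B₂.toSet ⊆ B₁.star → IsAmplitude B B₁ ψ₁ → IsAmplitude B B₂ ψ₂ →
      ∀ r r' x z s : ℝ, 0 < r → 0 < r' → x ∈ Ioo B₁.a B₁.b → z ∈ Ioo B₂.a B₂.b →
      (∀ y ∈ Ioo B₂.c B₂.d, |hess S z y| ≤ s) →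
      Integrable (fun y => dyadicDampedKernel φ lam S K ψ₁ r x y *
        (starRingEnd ℂ) (dyadicDampedKernel φ lam S K ψ₂ r' z y)) ∧
      ‖∫ y, dyadicDampedKernel φ lam S K ψ₁ r x y *
        (starRingEnd ℂ) (dyadicDampedKernel φ lam S K ψ₂ r' z y)‖ ≤
      C * (√ν * √s) * (r ^ (-μ) * r' ^ (-μ)) * (min (min r r') B₂.rho *
        (1 + (lam * (ν * |x - z|) * min (min r r') B₂.rho) ^ 2)⁻¹) := by
  obtain ⟨C₁, hC₁, hmain⟩ := exists_damped_integral_bound n hA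
  obtain ⟨C₂, hC₂, hamp⟩ := exists_pairingAmplitude_C2Bound (B := B) hφ hE hμ0 hμ1
  refine ⟨C₁ * C₂, by positivity, ?_⟩
  intro lam S K ν B₁ B₂ ψ₁ ψ₂ hlam hS hKs hν hH hsub hψ₁ hψ₂ r r' x z s hr hr' hx hz hs
  obtain ⟨hs1, hs2⟩ := Ioo_subset_of_subset_star hsub
  have hcd := B₂.hcd
  have hρ : B₂.rho = B₂.d - B₂.c := rfl
  have hρ12 : B₂.rho ≤ B₁.rho := by
    have := (Ioo_subset_Ioo_iff hcd).1 hs2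
    rw [hρ, Box.rho]; linarith [this.1, this.2]
  have hℓ : 0 < min (min r r') B₂.rho := lt_min (lt_min hr hr') (by rw [hρ]; linarith)
  have hℓρ : min (min r r') B₂.rho ≤ B₂.d - B₂.c := min_le_right _ _
  have jw := hamp K ψ₁ ψ₂ B₁ B₂ hKs hψ₁ hψ₂ hρ12 r r' x z hr hr'
  obtain ⟨α, β, hcα, hαβ, hβd, hlen, hw0⟩ :=
    exists_pairingAmplitude_support hφ K ψ₁ hψ₂ hr hr' x z
  have hIcc : Icc α β ⊆ Ioo B₂.c B₂.d := fun y hy => ⟨by linarith [hy.1], by linarith [hy.2]⟩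
  obtain ⟨σ, hσ, hsign⟩ := hH.exists_sign
  have hHd : (MvPolynomial.pderiv 0 (MvPolynomial.pderiv 1 S)).totalDegree ≤ n :=
    (totalDegree_pderiv_le _ _).trans ((totalDegree_pderiv_le _ _).trans hS)
  have hPd : (MvPolynomial.pderiv 1 S).totalDegree ≤ n := (totalDegree_pderiv_le _ _).trans hS
  -- Since S''_{xy} keeps its sign on the span, its absolute value there is ±S''_{xy}, again a
  -- polynomial in y; this is where the sign hypothesis makes √|S''_{xy}| the root of a polynomial.
  have hpoly : ∀ u : ℝ, (∀ y ∈ Ioo B₂.c B₂.d, (u, y) ∈ B₁.span B₂) → ∃ p : Polynomial ℝ,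
      p.natDegree ≤ n ∧ ∀ y ∈ Ioo B₂.c B₂.d, p.eval y = |hess S u y| := fun u hu =>
    ⟨Polynomial.C σ * slice (MvPolynomial.pderiv 0 (MvPolynomial.pderiv 1 S)) u,
      (Polynomial.natDegree_C_mul_le _ _).trans ((natDegree_slice_le _ _).trans hHd),
      fun y hy => by
        rw [Polynomial.eval_mul, Polynomial.eval_C, eval_slice]
        have := hsign (u, y) (hu y hy)
        simp only [hess] at this ⊢
        rw [this]⟩
  obtain ⟨p, hpd, hpe⟩ := hpoly x fun y hy => HessCond.mem_span hx (hs2 hy) hz hy left_mem_uIcc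
  obtain ⟨q, hqd, hqe⟩ := hpoly z fun y hy => HessCond.mem_span hx (hs2 hy) hz hy right_mem_uIcc
  obtain ⟨P, hPd', hPe⟩ : ∃ P : Polynomial ℝ, P.natDegree ≤ n ∧ ∀ y, P.eval y =
      MvPolynomial.eval ![x, y] (MvPolynomial.pderiv 1 S) -
        MvPolynomial.eval ![z, y] (MvPolynomial.pderiv 1 S) :=
    ⟨slice (MvPolynomial.pderiv 1 S) x - slice (MvPolynomial.pderiv 1 S) z,
      (Polynomial.natDegree_sub_le _ _).trans (max_le ((natDegree_slice_le _ _).trans hPd)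
        ((natDegree_slice_le _ _).trans hPd)), fun y => by
      rw [Polynomial.eval_sub, eval_slice, eval_slice]⟩
  have hpb : ∀ y ∈ Ioo B₂.c B₂.d, ν ≤ p.eval y ∧ p.eval y ≤ A * ν := fun y hy => by
    have hab := B₁.hab
    have ht : (x, y) ∈ B₁.tilde :=
      ⟨⟨by simp only; linarith [hx.1], by simp only; linarith [hx.2]⟩, hs2 hy⟩
    rw [hpe y hy]
    exact ⟨hH.lower (x, y) ht, hH.upper (x, y) ht⟩
  have hqb : ∀ y ∈ Ioo B₂.c B₂.d, 0 ≤ q.eval y ∧ q.eval y ≤ s := fun y hy => by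
    rw [hqe y hy]; exact ⟨abs_nonneg _, hs y hy⟩
  have hPb : ∀ y ∈ Ioo B₂.c B₂.d, ν * |x - z| / 20 ≤ |P.eval y| ∧
      |P.eval y| ≤ A * (ν * |x - z|) := fun y hy => by
    have := hH.phase_bounds hsub hx hz hy
    rw [hPe, ← mul_assoc]
    exact this
  have hΦ : ∀ y ∈ Ioo B₂.c B₂.d,
      HasDerivAt (fun y => lam * (val S x y - val S z y)) (lam * P.eval y) y := fun y _ => by
    rw [hPe]
    exact ((hasDerivAt_val_right S x y).fun_sub (hasDerivAt_val_right S z y)).const_mul lam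
  have hbound := hmain p q P hpd hqd hPd' B₂.c B₂.d α β (min (min r r') B₂.rho) lam ν s
    (ν * |x - z|) _ (fun y => lam * (val S x y - val S z y)) _ hcα hαβ hβd hℓ hℓρ hlen hlam hν
    (by positivity) hpb hqb hPb hΦ (jw.mono_set (subset_univ _)) hw0
  have hF0 : ∀ y, y ∉ Icc α β → dyadicDampedKernel φ lam S K ψ₁ r x y *
      (starRingEnd ℂ) (dyadicDampedKernel φ lam S K ψ₂ r' z y) = 0 := fun y hy => by
    rw [dyadicDampedKernel_mul_conj, hw0 y hy]; simp
  refine ⟨(continuous_dyadicDampedKernel_mul_conj jw.continuous).integrable_of_hasCompactSupport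
    (HasCompactSupport.intro isCompact_Icc hF0), ?_⟩
  rw [← setIntegral_eq_integral_of_forall_compl_eq_zero hF0, integral_Icc_eq_integral_Ioc,
    ← intervalIntegral.integral_of_le hαβ]
  refine le_trans (le_of_eq ?_) (hbound.trans (le_of_eq ?_))
  · congr 1
    apply intervalIntegral.integral_congr
    intro y hy
    rw [uIcc_of_le hαβ] at hy
    simp only
    rw [dyadicDampedKernel_mul_conj, hpe y (hIcc hy), hqe y (hIcc hy)]
  · ring

theorem IsSingularKernel.mono {E E' μ : ℝ} {K : ℝ → ℝ → ℂ} (h : IsSingularKernel E μ K)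
    (hE : E ≤ E') : IsSingularKernel E' μ K where
  contDiffOn := h.contDiffOn
  bound i hi x y hxy := (h.bound i hi x y hxy).trans (by gcongr)

theorem HessCond.mono {S : MvPolynomial (Fin 2) ℝ} {A A' ν : ℝ} {Q₁ Q₂ : Box}
    (h : HessCond S A ν Q₁ Q₂) (hν : 0 < ν) (hA : A ≤ A') : HessCond S A' ν Q₁ Q₂ where
  sign := h.sign
  lower := h.lower
  upper p hp := (h.upper p hp).trans (by gcongr)
  upper_span p hp := (h.upper_span p hp).trans (by gcongr)

theorem IsBoundedKernel.mono {M M' R R' : ℝ} {k : ℝ → ℝ → ℂ} (h : IsBoundedKernel M R k)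
    (hM : M ≤ M') (hR : R ≤ R') : IsBoundedKernel M' R' k where
  measurable := h.measurable
  bound x y := (h.bound x y).trans hM
  supp x y hxy := by
    have hs : Icc (-R) R ⊆ Icc (-R') R' := Icc_subset_Icc (by linarith) hR
    exact ⟨hs (h.supp x y hxy).1, hs (h.supp x y hxy).2⟩

/-! ### The damped kernel: continuity, compact support, dyadic sum -/

section DampedKernel

variable {φ : ℝ → ℝ} {n : ℕ} {lam E μ B : ℝ} {S : MvPolynomial (Fin 2) ℝ} {K ψ : ℝ → ℝ → ℂ}
  {Q : Box}

theorem continuous_dampedKernel (hφ : IsCutoff φ) (hK : IsSingularKernel E μ K)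
    (hψ : IsAmplitude B Q ψ) :
    Continuous fun p : ℝ × ℝ => dampedKernel φ n lam S K ψ p.1 p.2 := by
  have c1 : Continuous fun p : ℝ × ℝ => ((lam * val S p.1 p.2 : ℝ) : ℂ) :=
    Complex.continuous_ofReal.comp (continuous_const.mul (continuous_val S))
  have c2 : Continuous fun p : ℝ × ℝ => ((√|hess S p.1 p.2| : ℝ) : ℂ) :=
    Complex.continuous_ofReal.comp (Real.continuous_sqrt.comp (continuous_hess S).abs)
  have c3 : Continuous fun p : ℝ × ℝ => (p.1 - p.2) * lam ^ (1 / (n : ℝ)) := by fun_prop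
  have c4 : Continuous fun p : ℝ × ℝ =>
      K p.1 p.2 * ((1 - φ ((p.1 - p.2) * lam ^ (1 / (n : ℝ))) : ℝ) : ℂ) := by
    refine continuous_iff_continuousAt.2 fun p => ?_
    by_cases hp : p.1 = p.2
    -- On the diagonal K is uncontrolled, but the factor 1 - φ vanishes in a neighbourhood.
    · have hU : {p : ℝ × ℝ | |(p.1 - p.2) * lam ^ (1 / (n : ℝ))| < 1 / 2} ∈ nhds p :=
        (isOpen_lt c3.abs continuous_const).mem_nhds (by simp [hp])
      have he : (fun p : ℝ × ℝ =>
          K p.1 p.2 * ((1 - φ ((p.1 - p.2) * lam ^ (1 / (n : ℝ))) : ℝ) : ℂ)) =ᶠ[nhds p]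
          fun _ => 0 := by
        filter_upwards [hU] with q hq
        rw [hφ.eq_one _ (le_of_lt hq)]; simp
      exact continuousAt_const.congr he.symm
    · have hopen : IsOpen {p : ℝ × ℝ | p.1 ≠ p.2} :=
        isOpen_ne_fun continuous_fst continuous_snd
      refine (hK.contDiffOn.continuousOn.continuousAt (hopen.mem_nhds hp)).mul ?_
      exact (Complex.continuous_ofReal.comp
        (continuous_const.sub (hφ.smooth.continuous.comp c3))).continuousAt
  refine ((((Complex.continuous_exp.comp ((continuous_const (y := Complex.I)).mul c1)).mul c2).mul c4).mul
    hψ.smooth.continuous).congr fun p => ?_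
  simp only [dampedKernel, Function.comp, Pi.mul_apply]
  ring

theorem exists_isBoundedKernel (hφ : IsCutoff φ) (hK : IsSingularKernel E μ K)
    (hψ : IsAmplitude B Q ψ) : ∃ M R : ℝ, IsBoundedKernel M R (dampedKernel φ n lam S K ψ) := by
  have hc := continuous_dampedKernel (n := n) (lam := lam) (S := S) hφ hK hψ
  have hs : ∀ p : ℝ × ℝ, dampedKernel φ n lam S K ψ p.1 p.2 ≠ 0 →
      p ∈ tsupport fun p : ℝ × ℝ => ψ p.1 p.2 := fun p hp =>
    subset_tsupport (fun p : ℝ × ℝ => ψ p.1 p.2) (fun h0 => hp (by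
      have h0' : ψ p.1 p.2 = 0 := h0
      rw [dampedKernel, h0', mul_zero]))
  have hcs : HasCompactSupport fun p : ℝ × ℝ => dampedKernel φ n lam S K ψ p.1 p.2 :=
    HasCompactSupport.intro hψ.compact.isCompact fun p hp => by
      by_contra h; exact hp (hs p h)
  obtain ⟨M, hM⟩ := hc.bounded_above_of_compact_support hcs
  obtain ⟨R, hR⟩ := (isBounded_iff_forall_norm_le.1 hψ.compact.isCompact.isBounded)
  refine ⟨M, R, hc.measurable, fun x y => hM (x, y), fun x y hxy => ?_⟩
  have := hR _ (hs (x, y) hxy)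
  exact ⟨abs_le.1 ((norm_fst_le (x, y)).trans this), abs_le.1 ((norm_snd_le (x, y)).trans this)⟩

/-- The dyadic decomposition of the kernel of the damped operator. -/
theorem exists_dampedKernel_eq_sum (hφ : IsCutoff φ) (hlam : 0 < lam) (hψ : IsAmplitude B Q ψ) :
    ∃ J₀ : ℕ, ∀ J ≥ J₀, ∀ x y, dampedKernel φ n lam S K ψ x y =
      ∑ j ∈ Finset.range J,
        dyadicDampedKernel φ lam S K ψ (2 ^ j / lam ^ (1 / (n : ℝ))) x y := by
  have hL : 0 < lam ^ (1 / (n : ℝ)) := Real.rpow_pos_of_pos hlam _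
  obtain ⟨b, hb⟩ := hψ.compact.isCompact.exists_bound_of_continuousOn
    (f := fun p : ℝ × ℝ => (p.1 - p.2) * lam ^ (1 / (n : ℝ))) (by fun_prop)
  -- The number of pieces depends on the support of ψ and on λ; this is harmless because the sums
  -- over j are bounded independently of J.
  obtain ⟨J₀, hJ₀⟩ := pow_unbounded_of_one_lt (2 * b) (one_lt_two (α := ℝ))
  refine ⟨J₀, fun J hJ x y => ?_⟩
  by_cases h0 : ψ x y = 0
  · simp [dampedKernel, dyadicDampedKernel, h0]
  · have hxy := hb (x, y) (subset_tsupport (fun p : ℝ × ℝ => ψ p.1 p.2) h0)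
    have hJ2 : (2 : ℝ) ^ J₀ ≤ 2 ^ J := pow_le_pow_right₀ one_le_two hJ
    have hsum := hφ.sum_annulus J (t := (x - y) * lam ^ (1 / (n : ℝ)))
      (by rw [Real.norm_eq_abs] at hxy; simp only at hxy; linarith)
    have e : ∀ j : ℕ, (x - y) / (2 ^ j / lam ^ (1 / (n : ℝ))) =
        (x - y) * lam ^ (1 / (n : ℝ)) / 2 ^ j := fun j => by field_simp
    simp only [dampedKernel, dyadicDampedKernel, dyadicKernel, e, ← hsum]
    push_cast
    simp only [Finset.mul_sum, Finset.sum_mul]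
    refine Finset.sum_congr rfl fun j _ => ?_
    ring

end DampedKernel

/-! ### Summation of the dyadic pairings -/

theorem sum_dyadic_rpow_le {μ L : ℝ} (hμ : 0 < μ) (hL : 0 < L) (J : ℕ) :
    ∑ j ∈ Finset.range J, ((2 : ℝ) ^ j / L) ^ (-μ) ≤ L ^ μ * (1 - (2 : ℝ) ^ (-μ))⁻¹ := by
  have h0 : (0 : ℝ) ≤ (2 : ℝ) ^ (-μ) := by positivity
  have h1 : (2 : ℝ) ^ (-μ) < 1 :=
    Real.rpow_lt_one_of_one_lt_of_neg (by norm_num) (by linarith)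
  have e : ∀ j : ℕ, ((2 : ℝ) ^ j / L) ^ (-μ) = L ^ μ * ((2 : ℝ) ^ (-μ)) ^ j := fun j => by
    rw [Real.div_rpow (by positivity) hL.le, Real.rpow_neg hL.le μ, div_inv_eq_mul, mul_comm,
      ← Real.rpow_natCast, ← Real.rpow_natCast, ← Real.rpow_mul (by norm_num),
      ← Real.rpow_mul (by norm_num), mul_comm (j : ℝ)]
  simp only [e, ← Finset.mul_sum]
  gcongr
  rw [← tsum_geometric_of_lt_one h0 h1]
  exact (summable_geometric_of_lt_one h0 h1).sum_le_tsum _ fun i _ => by positivity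

/-- By scaling, ℓ drops out of the integral. Hence neither min(r, r') nor ρ₂ survives, and the
double dyadic sum factorises into a square. -/
theorem lintegral_ofReal_poisson {D ℓ lam ν : ℝ} (hD : 0 ≤ D) (hℓ : 0 < ℓ) (hlam : 0 < lam)
    (hν : 0 < ν) :
    ∫⁻ t : ℝ, ENNReal.ofReal (D * (ℓ * (1 + (lam * (ν * |t|) * ℓ) ^ 2)⁻¹)) =
      ENNReal.ofReal (D * (Real.pi / (lam * ν))) := by
  have ha : 0 < lam * ν * ℓ := by positivity
  have e : ∀ t : ℝ, D * (ℓ * (1 + (lam * (ν * |t|) * ℓ) ^ 2)⁻¹) =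
      D * ℓ * (1 + (t * (lam * ν * ℓ)) ^ 2)⁻¹ := fun t => by
    have : (lam * (ν * |t|) * ℓ) ^ 2 = (t * (lam * ν * ℓ)) ^ 2 := by
      have := sq_abs t
      linear_combination (lam * ν * ℓ) ^ 2 * this
    rw [this]; ring
  simp only [e]
  have hi : Integrable fun t : ℝ => D * ℓ * (1 + (t * (lam * ν * ℓ)) ^ 2)⁻¹ :=
    (integrable_inv_one_add_sq.comp_mul_right' ha.ne').const_mul _
  rw [← ofReal_integral_eq_lintegral_ofReal hi
    (Filter.Eventually.of_forall fun t => by positivity), integral_const_mul,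
    Measure.integral_comp_mul_right (fun t : ℝ => (1 + t ^ 2)⁻¹),
    integral_univ_inv_one_add_sq, abs_of_pos (inv_pos.2 ha), smul_eq_mul]
  congr 1
  field_simp

theorem exists_norm_comp_adjoint_le {φ : ℝ → ℝ} (hφ : IsCutoff φ) (n : ℕ) {E A B μ : ℝ}
    (hE : 0 ≤ E) (hA : 1 ≤ A) (hμ0 : 0 < μ) (hμ1 : μ < 1) : ∃ C : ℝ, 0 ≤ C ∧
    ∀ (lam : ℝ) (S : MvPolynomial (Fin 2) ℝ) (K : ℝ → ℝ → ℂ) (ν : ℝ) (B₁ B₂ : Box)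
      (ψ₁ ψ₂ : ℝ → ℝ → ℂ), 0 < lam → S.totalDegree ≤ n → IsSingularKernel E μ K → 0 < ν →
      HessCond S A ν B₁ B₂ → B₂.toSet ⊆ B₁.star → IsAmplitude B B₁ ψ₁ → IsAmplitude B B₂ ψ₂ →
      ∀ D₁ D₂ : L2 →L[ℂ] L2, HasKernel D₁ (dampedKernel φ n lam S K ψ₁) →
      HasKernel D₂ (dampedKernel φ n lam S K ψ₂) → ∀ s : ℝ,
      (∀ z ∈ Ioo B₂.a B₂.b, ∀ y ∈ Ioo B₂.c B₂.d, |hess S z y| ≤ s) →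
      ‖D₁ ∘L ContinuousLinearMap.adjoint D₂‖ ≤
        C * lam ^ (2 * μ / (n : ℝ) - 1) * (√s / √ν) := by
  obtain ⟨C, hC, hpair⟩ := exists_dyadic_pairing_bound (B := B) hφ n hE hA hμ0 hμ1
  have h2μ : (2 : ℝ) ^ (-μ) < 1 :=
    Real.rpow_lt_one_of_one_lt_of_neg (by norm_num) (by linarith)
  set g := (1 - (2 : ℝ) ^ (-μ))⁻¹ with hg
  have hg0 : 0 < g := inv_pos.2 (by linarith)
  refine ⟨C * g ^ 2 * Real.pi, by positivity, ?_⟩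
  intro lam S K ν B₁ B₂ ψ₁ ψ₂ hlam hS hK hν hH hsub hψ₁ hψ₂ D₁ D₂ hD₁ hD₂ s hs
  obtain ⟨M₁, R₁, k₁⟩ := exists_isBoundedKernel (n := n) (lam := lam) (S := S) hφ hK hψ₁
  obtain ⟨M₂, R₂, k₂⟩ := exists_isBoundedKernel (n := n) (lam := lam) (S := S) hφ hK hψ₂
  replace k₁ := k₁.mono (le_max_left M₁ M₂) (le_max_left R₁ R₂)
  replace k₂ := k₂.mono (le_max_right M₁ M₂) (le_max_right R₁ R₂)
  obtain ⟨J₁, hJ₁⟩ := exists_dampedKernel_eq_sum (n := n) (S := S) (K := K) hφ hlam hψ₁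
  obtain ⟨J₂, hJ₂⟩ := exists_dampedKernel_eq_sum (n := n) (S := S) (K := K) hφ hlam hψ₂
  set J := max J₁ J₂
  replace hJ₁ := hJ₁ J (le_max_left _ _)
  replace hJ₂ := hJ₂ J (le_max_right _ _)
  set L := lam ^ (1 / (n : ℝ)) with hL
  have hL0 : 0 < L := Real.rpow_pos_of_pos hlam _
  set r : ℕ → ℝ := fun j => 2 ^ j / L with hr
  have hr0 : ∀ j, 0 < r j := fun j => by simp only [hr]; positivity
  have hρ : 0 < B₂.rho := sub_pos.2 B₂.hcd
  set c : ℕ → ℕ → ℝ := fun j k => C * (√ν * √s) * (r j ^ (-μ) * r k ^ (-μ)) with hc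
  have hc0 : ∀ j k, 0 ≤ c j k := fun j k => by
    have h1 := Real.rpow_nonneg (hr0 j).le (-μ)
    have h2 := Real.rpow_nonneg (hr0 k).le (-μ)
    simp only [hc]; positivity
  set ℓ : ℕ → ℕ → ℝ := fun j k => min (min (r j) (r k)) B₂.rho with hℓ
  have hℓ0 : ∀ j k, 0 < ℓ j k := fun j k => lt_min (lt_min (hr0 j) (hr0 k)) hρ
  -- The sum of the pairing bounds depends on x - z only, which is what Schur's test in convolution
  -- form requires.
  set h : ℝ → ℝ≥0∞ := fun t => ∑ j ∈ Finset.range J, ∑ k ∈ Finset.range J,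
    ENNReal.ofReal (c j k * (ℓ j k * (1 + (lam * (ν * |t|) * ℓ j k) ^ 2)⁻¹)) with hh
  have hm1 : ∀ j k, Measurable fun t : ℝ =>
      ENNReal.ofReal (c j k * (ℓ j k * (1 + (lam * (ν * |t|) * ℓ j k) ^ 2)⁻¹)) :=
    fun j k => by fun_prop
  have hhm : Measurable h := Finset.measurable_fun_sum _ fun j _ =>
    Finset.measurable_fun_sum _ fun k _ => hm1 j k
  have hkh : ∀ x z, ‖∫ y, dampedKernel φ n lam S K ψ₁ x y *
      (starRingEnd ℂ) (dampedKernel φ n lam S K ψ₂ z y)‖ₑ ≤ h (x - z) := by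
    intro x z
    by_cases hx : x ∈ Ioo B₁.a B₁.b
    swap
    · have : ∀ y, dampedKernel φ n lam S K ψ₁ x y = 0 := fun y => by
        have : ψ₁ x y = 0 := by
          by_contra h0; exact hx (hψ₁.mem_of_ne_zero h0).1
        rw [dampedKernel, this, mul_zero]
      simp [this]
    by_cases hz : z ∈ Ioo B₂.a B₂.b
    swap
    · have : ∀ y, dampedKernel φ n lam S K ψ₂ z y = 0 := fun y => by
        have : ψ₂ z y = 0 := by
          by_contra h0; exact hz (hψ₂.mem_of_ne_zero h0).1
        rw [dampedKernel, this, mul_zero]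
      simp [this]
    have hp := fun j k => hpair lam S K ν B₁ B₂ ψ₁ ψ₂ hlam hS hK hν hH hsub hψ₁ hψ₂ (r j) (r k)
      x z s (hr0 j) (hr0 k) hx hz (hs z hz)
    simp only [hJ₁, hJ₂, map_sum, Finset.sum_mul_sum]
    rw [integral_finsetSum _ fun j _ => integrable_finsetSum _ fun k _ => (hp j k).1]
    refine (enorm_sum_le _ _).trans (Finset.sum_le_sum fun j _ => ?_)
    rw [integral_finsetSum _ fun k _ => (hp j k).1]
    refine (enorm_sum_le _ _).trans (Finset.sum_le_sum fun k _ => ?_)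
    rw [← ofReal_norm]
    exact ENNReal.ofReal_le_ofReal (hp j k).2
  set σ := ∑ j ∈ Finset.range J, r j ^ (-μ) with hσ
  have hσ0 : 0 ≤ σ := Finset.sum_nonneg fun j _ => Real.rpow_nonneg (hr0 j).le _
  have hI : ∫⁻ t, h t =
      ENNReal.ofReal (C * (√ν * √s) * σ ^ 2 * (Real.pi / (lam * ν))) := by
    simp only [hh]
    rw [lintegral_finsetSum _ fun j _ => Finset.measurable_fun_sum _ fun k _ => hm1 j k]
    have : ∀ j, ∫⁻ t : ℝ, ∑ k ∈ Finset.range J,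
        ENNReal.ofReal (c j k * (ℓ j k * (1 + (lam * (ν * |t|) * ℓ j k) ^ 2)⁻¹)) =
        ENNReal.ofReal (∑ k ∈ Finset.range J, c j k * (Real.pi / (lam * ν))) := fun j => by
      rw [lintegral_finsetSum _ fun k _ => hm1 j k, ENNReal.ofReal_sum_of_nonneg
        fun k _ => mul_nonneg (hc0 j k) (by positivity)]
      exact Finset.sum_congr rfl fun k _ =>
        lintegral_ofReal_poisson (hc0 j k) (hℓ0 j k) hlam hν
    simp only [this]
    rw [← ENNReal.ofReal_sum_of_nonneg fun j _ => Finset.sum_nonneg fun k _ =>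
      mul_nonneg (hc0 j k) (by positivity)]
    congr 1
    rw [sq, hσ, Finset.sum_mul_sum]
    simp only [hc, Finset.mul_sum, Finset.sum_mul]
  refine (k₁.norm_comp_adjoint_le k₂ hD₁ hD₂ hhm (by positivity) hkh hI.le).trans ?_
  have hσL : σ ≤ L ^ μ * g := sum_dyadic_rpow_le hμ0 hL0 J
  have hν2 : √ν ^ 2 = ν := Real.sq_sqrt hν.le
  have hν0 : 0 < √ν := Real.sqrt_pos.2 hν
  have e1 : (L ^ μ) ^ 2 / lam = lam ^ (2 * μ / (n : ℝ) - 1) := by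
    rw [hL, ← Real.rpow_mul hlam.le, ← Real.rpow_natCast, ← Real.rpow_mul hlam.le,
      Real.rpow_sub_one hlam.ne']
    congr 2
    push_cast
    ring
  calc C * (√ν * √s) * σ ^ 2 * (Real.pi / (lam * ν)) ≤
        C * (√ν * √s) * (L ^ μ * g) ^ 2 * (Real.pi / (lam * ν)) := by gcongr
    _ = C * g ^ 2 * Real.pi * ((L ^ μ) ^ 2 / lam) * (√s * √ν / ν) := by
      field_simp
    _ = _ := by
      rw [e1, show √s * √ν / ν = √s / √ν by
        nth_rewrite 2 [← hν2]; field_simp]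

/-! ### From ν and s to the ratio of suprema -/

section SupSqrtHess

variable {S : MvPolynomial (Fin 2) ℝ} {U V : Set (ℝ × ℝ)} {M : ℝ}

theorem bddAbove_sqrt_hess (h : ∀ p ∈ U, |hess S p.1 p.2| ≤ M) :
    BddAbove ((fun p : ℝ × ℝ => √|hess S p.1 p.2|) '' U) := by
  refine ⟨√M, ?_⟩
  rintro _ ⟨p, hp, rfl⟩
  exact Real.sqrt_le_sqrt (h p hp)

theorem supSqrtHess_nonneg : 0 ≤ supSqrtHess S U :=
  Real.sSup_nonneg (by rintro _ ⟨p, -, rfl⟩; exact Real.sqrt_nonneg _)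

theorem sqrt_hess_le_supSqrtHess (h : ∀ p ∈ U, |hess S p.1 p.2| ≤ M) {p : ℝ × ℝ} (hp : p ∈ U) :
    √|hess S p.1 p.2| ≤ supSqrtHess S U :=
  le_csSup (bddAbove_sqrt_hess h) (mem_image_of_mem _ hp)

theorem supSqrtHess_le (hU : U.Nonempty) (h : ∀ p ∈ U, |hess S p.1 p.2| ≤ M) :
    supSqrtHess S U ≤ √M := by
  refine csSup_le (hU.image _) ?_
  rintro _ ⟨p, hp, rfl⟩
  exact Real.sqrt_le_sqrt (h p hp)

theorem supSqrtHess_mono (hU : U.Nonempty) (hUV : U ⊆ V) (h : ∀ p ∈ V, |hess S p.1 p.2| ≤ M) :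
    supSqrtHess S U ≤ supSqrtHess S V :=
  csSup_le_csSup (bddAbove_sqrt_hess h) (hU.image _) (image_mono hUV)

end SupSqrtHess

namespace Box

theorem nonempty (Q : Box) : Q.toSet.Nonempty :=
  (nonempty_Ioo.2 Q.hab).prod (nonempty_Ioo.2 Q.hcd)

theorem toSet_subset_tilde (Q : Box) : Q.toSet ⊆ Q.tilde :=
  prod_mono (Ioo_subset_Ioo (by linarith [Q.hab]) (by linarith [Q.hab])) le_rfl

theorem toSet_subset_star (Q : Box) : Q.toSet ⊆ Q.star :=
  prod_mono (Ioo_subset_Ioo (by linarith [Q.hab]) (by linarith [Q.hab])) le_rfl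

end Box

theorem exists_norm_comp_adjoint_le_ratio {φ : ℝ → ℝ} (hφ : IsCutoff φ) (n : ℕ) {μ : ℝ}
    (hμ0 : 0 < μ) (hμ1 : μ < 1) (E A B : ℝ) : ∃ C : ℝ, 0 ≤ C ∧
    ∀ (lam : ℝ) (S : MvPolynomial (Fin 2) ℝ) (K : ℝ → ℝ → ℂ) (ν : ℝ) (B₁ B₂ : Box)
      (ψ₁ ψ₂ : ℝ → ℝ → ℂ), 0 < lam → S.totalDegree ≤ n → IsSingularKernel E μ K → 0 < ν →
      HessCond S A ν B₁ B₂ → B₂.toSet ⊆ B₁.star → IsAmplitude B B₁ ψ₁ → IsAmplitude B B₂ ψ₂ →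
      ∀ D₁ D₂ : L2 →L[ℂ] L2, HasKernel D₁ (dampedKernel φ n lam S K ψ₁) →
      HasKernel D₂ (dampedKernel φ n lam S K ψ₂) →
      ‖D₁ ∘L ContinuousLinearMap.adjoint D₂‖ ≤ C * lam ^ (2 * μ / (n : ℝ) - 1) *
        (supSqrtHess S B₂.toSet / supSqrtHess S B₁.tilde) := by
  -- `E` and `A` are arbitrary reals, so they are enlarged to satisfy the sign and size conditions
  -- of the estimate.
  obtain ⟨C, hC, h⟩ := exists_norm_comp_adjoint_le (E := max E 0) (A := max A 1) (B := B) hφ n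
    (le_max_right _ _) (le_max_right _ _) hμ0 hμ1
  refine ⟨C * √(max A 1), by positivity, ?_⟩
  intro lam S K ν B₁ B₂ ψ₁ ψ₂ hlam hS hK hν hH hsub hψ₁ hψ₂ D₁ D₂ hD₁ hD₂
  have hspan : ∀ p ∈ B₂.toSet, |hess S p.1 p.2| ≤ A * ν := by
    rintro ⟨z, y⟩ ⟨hz, hy⟩
    obtain ⟨x, hx⟩ := nonempty_Ioo.2 B₁.hab
    exact hH.upper_span (z, y)
      (HessCond.mem_span hx ((Ioo_subset_of_subset_star hsub).2 hy) hz hy right_mem_uIcc)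
  set τ₂ := supSqrtHess S B₂.toSet with hτ₂
  set τ₁ := supSqrtHess S B₁.tilde with hτ₁
  have hτ₂0 : 0 ≤ τ₂ := supSqrtHess_nonneg
  have key := h lam S K ν B₁ B₂ ψ₁ ψ₂ hlam hS (hK.mono (le_max_left _ _)) hν
    (hH.mono hν (le_max_left _ _)) hsub hψ₁ hψ₂ D₁ D₂ hD₁ hD₂ (τ₂ ^ 2) (fun z hz y hy => by
      have := sqrt_hess_le_supSqrtHess hspan (mk_mem_prod hz hy)
      rw [← Real.sq_sqrt (abs_nonneg (hess S z y))]
      gcongr)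
  rw [Real.sqrt_sq hτ₂0] at key
  have hτ₁0 : 0 < τ₁ := by
    obtain ⟨p, hp⟩ := B₁.nonempty
    have hp' := B₁.toSet_subset_tilde hp
    refine lt_of_lt_of_le ?_ (sqrt_hess_le_supSqrtHess hH.upper hp')
    exact Real.sqrt_pos.2 (hν.trans_le (hH.lower p hp'))
  -- On the enlarged box |S''_{xy}| ≤ Aν, so 1/√ν is at most √(max A 1)/τ₁; this introduces the
  -- denominator of the ratio.
  have hτ₁A : τ₁ ≤ √(max A 1) * √ν := by
    rw [← Real.sqrt_mul (le_max_of_le_right zero_le_one)]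
    refine supSqrtHess_le (B₁.nonempty.mono B₁.toSet_subset_tilde) fun p hp => ?_
    exact (hH.mono hν (le_max_left A 1)).upper p hp
  have hν0 : 0 < √ν := Real.sqrt_pos.2 hν
  refine key.trans ?_
  have : τ₂ / √ν ≤ √(max A 1) * (τ₂ / τ₁) := by
    rw [← mul_div_assoc, div_le_div_iff₀ hν0 hτ₁0]
    nlinarith
  calc C * lam ^ (2 * μ / (n : ℝ) - 1) * (τ₂ / √ν) ≤
        C * lam ^ (2 * μ / (n : ℝ) - 1) * (√(max A 1) * (τ₂ / τ₁)) := by gcongr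
    _ = _ := by ring

end DampedOsc

end

theorem lemma3p2 (φ : ℝ → ℝ) (hφ : DampedOsc.IsCutoff φ)
    (n : ℕ) (hn : 2 ≤ n) (μ : ℝ) (hμ0 : 0 < μ) (hμ1 : μ < 1) (E A B : ℝ) :
    ∃ C : ℝ, 0 < C ∧
      (∀ (lam : ℝ) (S : MvPolynomial (Fin 2) ℝ) (K : ℝ → ℝ → ℂ) (ν : ℝ)
          (B₁ B₂ : DampedOsc.Box) (ψ₁ ψ₂ : ℝ → ℝ → ℂ),
        0 < lam → S.totalDegree ≤ n → DampedOsc.IsSingularKernel E μ K → 0 < ν →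
        DampedOsc.HessCond S A ν B₁ B₂ → B₂.toSet ⊆ B₁.star →
        DampedOsc.IsAmplitude B B₁ ψ₁ → DampedOsc.IsAmplitude B B₂ ψ₂ →
        ∃ D₁ D₂ : DampedOsc.L2 →L[ℂ] DampedOsc.L2,
          DampedOsc.HasKernel D₁ (DampedOsc.dampedKernel φ n lam S K ψ₁) ∧
          DampedOsc.HasKernel D₂ (DampedOsc.dampedKernel φ n lam S K ψ₂) ∧
          ‖D₁ ∘L ContinuousLinearMap.adjoint D₂‖ ≤
            C * lam ^ (2 * μ / (n : ℝ) - 1) *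
              (DampedOsc.supSqrtHess S B₂.toSet / DampedOsc.supSqrtHess S B₁.tilde) ∧
          ‖D₂ ∘L ContinuousLinearMap.adjoint D₁‖ ≤
            C * lam ^ (2 * μ / (n : ℝ) - 1) *
              (DampedOsc.supSqrtHess S B₂.toSet / DampedOsc.supSqrtHess S B₁.tilde)) ∧
      (∀ (lam : ℝ) (S : MvPolynomial (Fin 2) ℝ) (K : ℝ → ℝ → ℂ) (ν : ℝ)
          (Q : DampedOsc.Box) (ψ : ℝ → ℝ → ℂ),
        0 < lam → S.totalDegree ≤ n → DampedOsc.IsSingularKernel E μ K → 0 < ν →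
        DampedOsc.HessCond S A ν Q Q → DampedOsc.IsAmplitude B Q ψ →
        ∃ D : DampedOsc.L2 →L[ℂ] DampedOsc.L2,
          DampedOsc.HasKernel D (DampedOsc.dampedKernel φ n lam S K ψ) ∧
          ‖D‖ ≤ C * lam ^ (μ / (n : ℝ) - 1 / 2)) := by
  obtain ⟨C, hC, h⟩ := DampedOsc.exists_norm_comp_adjoint_le_ratio hφ n hμ0 hμ1 E A B
  -- The added 1 makes the constant positive and gives C ≤ (C + 1)², needed after taking a square
  -- root.
  refine ⟨C + 1, by linarith, ?_, ?_⟩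
  · intro lam S K ν B₁ B₂ ψ₁ ψ₂ hlam hS hK hν hH hsub hψ₁ hψ₂
    obtain ⟨M₁, R₁, k₁⟩ := DampedOsc.exists_isBoundedKernel (n := n) (lam := lam) (S := S) hφ hK hψ₁
    obtain ⟨M₂, R₂, k₂⟩ := DampedOsc.exists_isBoundedKernel (n := n) (lam := lam) (S := S) hφ hK hψ₂
    obtain ⟨D₁, hD₁⟩ := k₁.exists_hasKernel
    obtain ⟨D₂, hD₂⟩ := k₂.exists_hasKernel
    have key := h lam S K ν B₁ B₂ ψ₁ ψ₂ hlam hS hK hν hH hsub hψ₁ hψ₂ D₁ D₂ hD₁ hD₂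
    have hratio : 0 ≤ DampedOsc.supSqrtHess S B₂.toSet / DampedOsc.supSqrtHess S B₁.tilde :=
      div_nonneg DampedOsc.supSqrtHess_nonneg DampedOsc.supSqrtHess_nonneg
    have key' := key.trans (show _ ≤ (C + 1) * lam ^ (2 * μ / (n : ℝ) - 1) *
      (DampedOsc.supSqrtHess S B₂.toSet / DampedOsc.supSqrtHess S B₁.tilde) by
        gcongr; linarith)
    refine ⟨D₁, D₂, hD₁, hD₂, key', ?_⟩
    have e : D₂ ∘L ContinuousLinearMap.adjoint D₁ =
        ContinuousLinearMap.adjoint (D₁ ∘L ContinuousLinearMap.adjoint D₂) := by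
      rw [ContinuousLinearMap.adjoint_comp, ContinuousLinearMap.adjoint_adjoint]
    rw [e, LinearIsometryEquiv.norm_map]
    exact key'
  · intro lam S K ν Q ψ hlam hS hK hν hH hψ
    obtain ⟨M, R, k⟩ := DampedOsc.exists_isBoundedKernel (n := n) (lam := lam) (S := S) hφ hK hψ
    obtain ⟨D, hD⟩ := k.exists_hasKernel
    refine ⟨D, hD, ?_⟩
    have key := h lam S K ν Q Q ψ ψ hlam hS hK hν hH Q.toSet_subset_star hψ hψ D D hD hD
    have hratio : DampedOsc.supSqrtHess S Q.toSet / DampedOsc.supSqrtHess S Q.tilde ≤ 1 :=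
      div_le_one_of_le₀ (DampedOsc.supSqrtHess_mono Q.nonempty Q.toSet_subset_tilde hH.upper)
        DampedOsc.supSqrtHess_nonneg
    -- The C*-identity for D*, which turns the bound on D D* into one on ‖D‖²; the ratio of suprema
    -- is at most 1 here.
    have hnorm : ‖D ∘L ContinuousLinearMap.adjoint D‖ = ‖D‖ * ‖D‖ := by
      have := ContinuousLinearMap.norm_adjoint_comp_self (ContinuousLinearMap.adjoint D)
      rwa [ContinuousLinearMap.adjoint_adjoint, LinearIsometryEquiv.norm_map] at this
    have hlp : 0 < lam ^ (μ / (n : ℝ) - 1 / 2) := Real.rpow_pos_of_pos hlam _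
    have e : lam ^ (2 * μ / (n : ℝ) - 1) = (lam ^ (μ / (n : ℝ) - 1 / 2)) ^ 2 := by
      rw [← Real.rpow_natCast, ← Real.rpow_mul hlam.le]
      congr 1
      push_cast
      ring
    rw [hnorm, e] at key
    refine abs_le_of_sq_le_sq' ?_ (by positivity) |>.2
    calc ‖D‖ ^ 2 = ‖D‖ * ‖D‖ := sq _
      _ ≤ C * (lam ^ (μ / (n : ℝ) - 1 / 2)) ^ 2 * 1 :=
        key.trans (mul_le_mul_of_nonneg_left hratio (by positivity))
      _ ≤ ((C + 1) * lam ^ (μ / (n : ℝ) - 1 / 2)) ^ 2 := by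
        rw [mul_one, mul_pow]
        gcongr
        nlinarith
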